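/- Let $V=V_0\oplus V_1$ be a finite-dimensional real supervector space with a symplectic form $B$ (even, nondegenerate, alternating on $V_0$, symmetric on $V_1$, with $V_0\perp V_1$), $m=\dim V_0$, $n=\dim V_1$, and let $\boldsymbol i\in\mathbb C$ with $\boldsymbol i^2=-1$. Let $(e_1,\dots,e_m,f_1,\dots,f_n)$ be a symplectic basis: $e$ is a basis of $V_0$ with $B(e_1,e_2)=B(e_3,e_4)=\dots=1$ and $B(e_r,e_s)=0$ for $r<s$ otherwise, and $f$ is an orthonormal basis of $V_1\otimes\mathbb C$ with $f_j\in V_1\cup\boldsymbol iV_1$. Let $(x,\xi)$ be the dual coordinates. Orient $V_1$ by $\xi^1\cdots\xi^n$ and let $\int_V d_V(v)\,\phi(v)=(2\pi)^{-m/2}\int_{\mathbb R^m}|dx|\,\big(\tfrac{\partial}{\partial\xi^1}\cdots\tfrac{\partial}{\partial\xi^n}\phi\big)\big|_{\xi=0}$ be the Liouville integral. Let $\mathfrak g=\mathfrak{spo}(V)$ be the Lie superalgebra of endomorphisms of $V$ preserving $B$, so $\mathfrak g_0=\mathfrak{sp}(V_0)\oplus\mathfrak{so}(V_1)$. Functions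 and generalized functions on the supermanifold $\mathfrak g$ are those on $\mathfrak g_0$ with values in $\Lambda(\mathfrak g_1^*)\otimes\mathbb C$. The superPfaffian is the generalized function on $\mathfrak g$ $$\mathrm{Spf}(X)=\boldsymbol i^{\frac{m-n}2}\int_V d_V(v)\,\exp\!\big(-\tfrac{\boldsymbol i}2B(v,Xv)\big),$$ meaning that, for a Lebesgue measure $\nu$ on $\mathfrak g_0$ and $\rho\in C_c^\infty(\mathfrak g_0)$, its value on $\rho\,\nu$ is $\boldsymbol i^{\frac{m-n}2}\int_Vd_V(v)\int_{\mathfrak g_0}\rho(X)\exp(-\frac{\boldsymbol i}2B(v,(X+\Xi)v))\,d\nu(X)\in\Lambda(\mathfrak g_1^*)\otimes\mathbb C$, where $\Xi$ is the generic point of $\mathfrak g_1$. Let $\mathcal U\subset\mathfrak{sp}(V_0)$ be the set of $A$ for which the quadratic form $v\mapsto B(v,Av)$ on $V_0$ is nondegenerate, $\mathcal U_{p,q}\subset\mathcal U$ (for $p+q=m$) the set where it has signature $(p,q)$, $\mathcal V=\mathcal U\times\mathfrak{so}(V_1)$ and $\mathcal V_{p,q}=\mathcal U_{p,q}\times\mathfrak{so}(V_1)$.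 A near superalgebra $\mathcal P$ is a finite-dimensional commutative real superalgebra which is local with residue field $\mathbb R$. A $\mathcal P$-point of $\mathfrak g$ is an element $X\in(\mathfrak g\otimes\mathcal P)_0$, represented by its matrix $\begin{pmatrix}A&B\\C&D\end{pmatrix}$ in the basis $(e,f)$; its body lies in $\mathfrak g_0$. The value of a smooth function at $X$ is defined by Taylor's formula at the body. Then the restriction of $\mathrm{Spf}$ to $\mathcal V$ is an analytic function: there is an analytic $F:\mathcal V\to\Lambda(\mathfrak g_1^*)\otimes\mathbb C$ such that, for all $\nu$ and all $\rho$ with compact support in $\mathcal V$, the integral over $V_0$ defining $\mathrm{Spf}(\rho\,\nu)$ converges absolutely and $\mathrm{Spf}(\rho\,\nu)=\int\rho F\,d\nu$. Write $\mathrm{Spf}(X)$ for the value of $F$ at a point $X$. For every near superalgebra $\mathcal P$ and every $\mathcal P$-point $X=\begin{pmatrix}A&B\\C&D\end{pmatrix}$ of $\mathfrak g$: 1. if $p+q=m$ and the body of $X$ lies in $\mathcal V_{p,q}$, then $$\mathrm{Spf}(X)=\boldsymbol i^{q}\,\frac{\mathrm{Pfaff}(D-CA^{-1}B)}{\sqrt{|\det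 A|}},$$ where $\mathrm{Pfaff}$ is the ordinary Pfaffian of the matrix in the basis $f$, normalized by $\mathrm{Pfaff}\begin{pmatrix}0&-c\\c&0\end{pmatrix}=c$ and zero for odd $n$; 2. if the body of $X$ lies in $\mathcal V$, then $\mathrm{Spf}(X)^2=\mathrm{Ber}^-(X)=\det(A)^{-1}\det(D-CA^{-1}B)$. -/

import Mathlib

open scoped TensorProduct ContDiff

noncomputable section

namespace SuperPfaffian

/-! ### Near superalgebras -/

/-- A commutative superalgebra `P = P₀ ⊕ P₁` over `ℝ` (with grading `𝒢`) is *near* if it is finite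
dimensional and local with residue field `ℝ`, i.e. there is a morphism `body : P → ℝ` such that every
element outside its kernel is invertible (so the kernel is the unique maximal ideal). -/
class NearSuperalgebra {P : Type*} [Ring P] [Algebra ℝ P] (𝒢 : ZMod 2 → Submodule ℝ P)
    [GradedAlgebra 𝒢] where
  supercomm : ∀ (s t : ZMod 2) (a c : P), a ∈ 𝒢 s → c ∈ 𝒢 t →
    a * c = (-1) ^ (s.val * t.val) * (c * a)
  finite : FiniteDimensional ℝ P
  body : P →ₐ[ℝ] ℝ
  isUnit_of_body_ne_zero : ∀ a : P, body a ≠ 0 → IsUnit a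

lemma odd_mul_even_mul_odd_mem {P : Type*} [Ring P] [Algebra ℝ P]
    {𝒢 : ZMod 2 → Submodule ℝ P} [GradedAlgebra 𝒢] (c : 𝒢 1) (a : 𝒢 0) (d : 𝒢 1) :
    (c : P) * a * d ∈ 𝒢 0 := by
  have h := SetLike.GradedMul.mul_mem (A := 𝒢) (SetLike.GradedMul.mul_mem (A := 𝒢) c.2 a.2) d.2
  exact h

section Near

variable {P : Type*} [Ring P] [Algebra ℝ P] (𝒢 : ZMod 2 → Submodule ℝ P) [GradedAlgebra 𝒢]
  [NearSuperalgebra 𝒢]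

/-- The even part of a commutative superalgebra is a commutative ring. -/
instance evenCommRing : CommRing (𝒢 0) :=
  { (inferInstance : Ring (𝒢 0)) with
    mul_comm := fun a c => Subtype.ext (by
      have h := NearSuperalgebra.supercomm (𝒢 := 𝒢) 0 0 (a : P) (c : P) a.2 c.2
      simp only [ZMod.val_zero, mul_zero, pow_zero, one_mul] at h
      exact h) }

/-- The body of an even element. -/
def evenBody : 𝒢 0 →ₗ[ℝ] ℝ :=
  (NearSuperalgebra.body (𝒢 := 𝒢)).toLinearMap ∘ₗ (𝒢 0).subtype

variable {𝒢}

/-- The absolute value `|α| = (|b(α)| / b(α)) α` of an invertible even element. -/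
def nearAbs (α : 𝒢 0) : 𝒢 0 := (|evenBody 𝒢 α| / evenBody 𝒢 α) • α

/-- The square root of an even element with positive body, by the (finite) binomial series
`√α = √b(α) ∑ₖ binom(1/2, k) (α / b(α) - 1)ᵏ`; the terms with `k ≥ dim P` vanish. -/
def nearSqrt (α : 𝒢 0) : 𝒢 0 :=
  Real.sqrt (evenBody 𝒢 α) •
    ∑ k ∈ Finset.range (Module.finrank ℝ P + 1),
      ((∏ l ∈ Finset.range k, ((1 / 2 : ℝ) - l)) / (k.factorial : ℝ)) •
        ((evenBody 𝒢 α)⁻¹ • α - 1) ^ k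

variable (𝒢)

/-- The inclusion of the complexified even part in the complexification of `P`. -/
def evenIncl : (ℂ ⊗[ℝ] 𝒢 0) →ₗ[ℝ] (ℂ ⊗[ℝ] P) := LinearMap.lTensor ℂ (𝒢 0).subtype

variable {𝒢}

/-- Evaluation of a real linear form on a point `w = ∑ wᵢ ⊗ pⁱ` : `ℓ(w) = ∑ ℓ(wᵢ) pⁱ`. -/
def applyPt {W N : Type*} [AddCommGroup W] [Module ℝ W] [AddCommGroup N] [Module ℝ N]
    (l : W →ₗ[ℝ] ℝ) (w : W ⊗[ℝ] N) : N :=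
  TensorProduct.lid ℝ N (LinearMap.rTensor N l w)

/-- Evaluation of a complex valued linear form on a point with odd coefficients. -/
def applyOdd {W : Type*} [AddCommGroup W] [Module ℝ W] (w : W ⊗[ℝ] 𝒢 1) :
    (W →ₗ[ℝ] ℂ) →ₗ[ℂ] ℂ ⊗[ℝ] P where
  toFun l := TensorProduct.map l (𝒢 1).subtype w
  map_add' l l' := by rw [TensorProduct.map_add_left]; rfl
  map_smul' c l := by
    induction w using TensorProduct.induction_on with
    | zero => simp
    | tmul x y => simp [TensorProduct.smul_tmul']
    | add x y hx hy => simp only [map_add, hx, hy, smul_add]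

lemma applyOdd_anticomm {W : Type*} [AddCommGroup W] [Module ℝ W] (w w' : W ⊗[ℝ] 𝒢 1)
    (l l' : W →ₗ[ℝ] ℂ) :
    applyOdd w l * applyOdd w' l' = -(applyOdd w' l' * applyOdd w l) := by
  change TensorProduct.map l (𝒢 1).subtype w * TensorProduct.map l' (𝒢 1).subtype w' =
    -(TensorProduct.map l' (𝒢 1).subtype w' * TensorProduct.map l (𝒢 1).subtype w)
  induction w using TensorProduct.induction_on with
  | zero => simp
  | add x y hx hy => simp only [map_add, add_mul, mul_add, hx, hy, neg_add]
  | tmul x y =>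
    induction w' using TensorProduct.induction_on with
    | zero => simp
    | add x' y' hx hy => simp only [map_add, add_mul, mul_add, hx, hy, neg_add]
    | tmul x' y' =>
      have h := NearSuperalgebra.supercomm (𝒢 := 𝒢) 1 1 (y : P) (y' : P) y.2 y'.2
      have h1 : (1 : ZMod 2).val = 1 := rfl
      rw [h1] at h
      simp only [mul_one, pow_one, neg_mul, one_mul] at h
      simp only [TensorProduct.map_tmul, Algebra.TensorProduct.tmul_mul_tmul, Submodule.subtype_apply,
        h, TensorProduct.tmul_neg, mul_comm (l x)]

/-- The substitution morphism `Λ(W^*) ⊗ ℂ → P ⊗ ℂ` given by a point `w ∈ W ⊗ P₁`. -/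
def evalOdd {W : Type*} [AddCommGroup W] [Module ℝ W] (w : W ⊗[ℝ] 𝒢 1) :
    ExteriorAlgebra ℂ (W →ₗ[ℝ] ℂ) →ₐ[ℂ] ℂ ⊗[ℝ] P :=
  ExteriorAlgebra.lift ℂ ⟨applyOdd w, fun l => by
    have h := applyOdd_anticomm w w l l
    have h2 : (2 : ℂ) • (applyOdd w l * applyOdd w l) = 0 := by
      rw [two_smul]; nth_rewrite 1 [h]; simp
    exact (smul_eq_zero.mp h2).resolve_left two_ne_zero⟩

end Near

/-! ### Grassmann algebras -/

section Grassmann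

variable (M : Type*) [AddCommGroup M] [Module ℂ M] [FiniteDimensional ℂ M]

instance finite_exteriorAlgebra : Module.Finite ℂ (ExteriorAlgebra ℂ M) :=
  Module.Finite.of_basis (Module.finBasis ℂ M).ExteriorAlgebra

/-- The finite dimensional space `Λ(M)` is given an auxiliary norm (all norms are equivalent). -/
instance normedAddCommGroup_exteriorAlgebra : NormedAddCommGroup (ExteriorAlgebra ℂ M) :=
  NormedAddCommGroup.induced _ _ (Module.finBasis ℂ (ExteriorAlgebra ℂ M)).equivFun
    (Module.finBasis ℂ (ExteriorAlgebra ℂ M)).equivFun.injective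

instance normedSpace_exteriorAlgebra : NormedSpace ℂ (ExteriorAlgebra ℂ M) :=
  NormedSpace.induced ℂ _ _ (Module.finBasis ℂ (ExteriorAlgebra ℂ M)).equivFun

variable {M}

/-- The exponential in a Grassmann algebra: `exp z = exp(b(z)) exp(z - b(z))`, where `b(z)` is the
scalar part of `z` and `z - b(z)` is nilpotent, its powers of order `> dim M` being zero. -/
def grassmannExp (z : ExteriorAlgebra ℂ M) : ExteriorAlgebra ℂ M :=
  Complex.exp (ExteriorAlgebra.algebraMapInv z) •
    ∑ d ∈ Finset.range (Module.finrank ℂ M + 1), ((d.factorial : ℂ)⁻¹) •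
      (z - algebraMap ℂ (ExteriorAlgebra ℂ M) (ExteriorAlgebra.algebraMapInv z)) ^ d

end Grassmann

/-- The ordinary Pfaffian of an antisymmetric matrix, normalized so that
`Pfaff !![0, -c; c, 0] = c`; it is `0` in odd size. -/
def pfaffian {R : Type*} [CommRing R] [Algebra ℂ R] {n : ℕ} (M : Matrix (Fin n) (Fin n) R) : R :=
  if Even n then
    ((2 ^ (n / 2) * (n / 2).factorial : ℂ)⁻¹) •
      ∑ s : Equiv.Perm (Fin n), ((Equiv.Perm.sign s : ℤˣ) : ℤ) •
        ∏ r : Fin (n / 2), M (s ⟨2 * r + 1, by omega⟩) (s ⟨2 * r, by omega⟩)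
  else 0

/-! ### Symplectic supervector spaces -/

section Spo

variable {V₀ V₁ : Type*} [NormedAddCommGroup V₀] [NormedSpace ℝ V₀] [FiniteDimensional ℝ V₀]
  [NormedAddCommGroup V₁] [NormedSpace ℝ V₁] [FiniteDimensional ℝ V₁]

variable (V₀ V₁) in
/-- A symplectic form on the supervector space `V = V₀ ⊕ V₁`: an even nondegenerate form which is
alternating on `V₀` and symmetric on `V₁` (and for which `V₀` and `V₁` are orthogonal). -/
structure SymplecticForm where
  form₀ : LinearMap.BilinForm ℝ V₀
  form₁ : LinearMap.BilinForm ℝ V₁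
  isAlt : form₀.IsAlt
  nondegenerate₀ : form₀.Nondegenerate
  isSymm : form₁.IsSymm
  nondegenerate₁ : form₁.Nondegenerate

/-- A symplectic basis `(e₁, …, e_m, f₁, …, f_n)`, `m = 2k`: the basis `e` of `V₀` consists of `k`
orthogonal pairs with `B(e (r, 0), e (r, 1)) = 1`; the `f_j` are an orthonormal basis of `V₁ ⊗ ℂ`
with `f_j ∈ V₁` or `f_j ∈ i V₁`, i.e. `f_j = g_j` or `f_j = i g_j` where `g` is a basis of `V₁`;
`neg` is the set of the `j` with `f_j ∈ i V₁`, for which `B(g_j, g_j) = -1`.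
The dual coordinates `ξ` orient `V₁` by `ξ¹ ⋯ ξⁿ`. -/
structure SymplecticBasis (B : SymplecticForm V₀ V₁) (k n : ℕ) where
  e : Module.Basis (Fin k × Fin 2) ℝ V₀
  form_e : ∀ r s, B.form₀ (e r) (e s) =
    if r.1 = s.1 then !![(0 : ℝ), 1; -1, 0] r.2 s.2 else 0
  g : Module.Basis (Fin n) ℝ V₁
  neg : Finset (Fin n)
  form_g : ∀ j l, B.form₁ (g j) (g l) = if j = l then (if j ∈ neg then -1 else 1) else 0

/-- The number `1` or `i` such that `f_j = phase j • g_j`. -/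
def SymplecticBasis.phase {B : SymplecticForm V₀ V₁} {k n : ℕ} (b : SymplecticBasis B k n)
    (i : ℂ) (j : Fin n) : ℂ := if j ∈ b.neg then i else 1

/-- The even part `𝔰𝔭(V₀) ⊕ 𝔰𝔬(V₁)` of the Lie superalgebra `𝔰𝔭𝔬(V)`. -/
def spoEven (B : SymplecticForm V₀ V₁) : Submodule ℝ ((V₀ →L[ℝ] V₀) × (V₁ →L[ℝ] V₁)) where
  carrier := {X | (∀ v w, B.form₀ (X.1 v) w + B.form₀ v (X.1 w) = 0) ∧
    ∀ v w, B.form₁ (X.2 v) w + B.form₁ v (X.2 w) = 0}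
  zero_mem' := by simp
  add_mem' := by
    rintro X Y ⟨h1, h2⟩ ⟨h3, h4⟩
    refine ⟨fun v w => ?_, fun v w => ?_⟩
    · have := h1 v w; have := h3 v w
      simp only [Prod.fst_add, add_apply, map_add, LinearMap.add_apply]
      linarith
    · have := h2 v w; have := h4 v w
      simp only [Prod.snd_add, add_apply, map_add, LinearMap.add_apply]
      linarith
  smul_mem' := by
    rintro c X ⟨h1, h2⟩
    refine ⟨fun v w => ?_, fun v w => ?_⟩
    · have := h1 v w
      simp only [Prod.smul_fst, smul_apply, map_smul, LinearMap.smul_apply,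
        ← smul_add, this, smul_zero]
    · have := h2 v w
      simp only [Prod.smul_snd, smul_apply, map_smul, LinearMap.smul_apply,
        ← smul_add, this, smul_zero]

/-- The odd part of `𝔰𝔭𝔬(V)`: pairs `X = (V₁ → V₀, V₀ → V₁)` with
`B(Xv, w) + (-1)^{p(X)p(v)} B(v, Xw) = 0` for homogeneous `v`, `w`. -/
def spoOdd (B : SymplecticForm V₀ V₁) : Submodule ℝ ((V₁ →ₗ[ℝ] V₀) × (V₀ →ₗ[ℝ] V₁)) where
  carrier := {X | (∀ v w, B.form₁ (X.2 v) w + B.form₀ v (X.1 w) = 0) ∧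
    ∀ w v, B.form₀ (X.1 w) v - B.form₁ w (X.2 v) = 0}
  zero_mem' := by simp
  add_mem' := by
    rintro X Y ⟨h1, h2⟩ ⟨h3, h4⟩
    refine ⟨fun v w => ?_, fun v w => ?_⟩
    · have := h1 v w; have := h3 v w
      simp only [Prod.fst_add, Prod.snd_add, LinearMap.add_apply, map_add]
      linarith
    · have := h2 v w; have := h4 v w
      simp only [Prod.fst_add, Prod.snd_add, LinearMap.add_apply, map_add]
      linarith
  smul_mem' := by
    rintro c X ⟨h1, h2⟩
    refine ⟨fun v w => ?_, fun v w => ?_⟩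
    · have := h1 v w
      simp only [Prod.smul_fst, Prod.smul_snd, LinearMap.smul_apply, map_smul, ← smul_add, this,
        smul_zero]
    · have := h2 v w
      simp only [Prod.smul_fst, Prod.smul_snd, LinearMap.smul_apply, map_smul, ← smul_sub, this,
        smul_zero]

variable {B : SymplecticForm V₀ V₁} {k n : ℕ}

variable (B) in
/-- The algebra `Λ(𝔰𝔭𝔬(V)₁^*) ⊗ ℂ` in which complex (generalized) functions on the supermanifold
`𝔰𝔭𝔬(V)`, viewed as (generalized) functions on `𝔰𝔭𝔬(V)₀`, take their values. -/
abbrev OddAlgebra := ExteriorAlgebra ℂ (spoOdd B →ₗ[ℝ] ℂ)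

/-- The bilinear form `(v, w) ↦ B(v, Xw)` on `V₀`, for `X ∈ 𝔰𝔭𝔬(V)₀`. -/
def evenForm (X : spoEven B) : LinearMap.BilinForm ℝ V₀ :=
  LinearMap.compl₂ B.form₀ (X.1.1 : V₀ →ₗ[ℝ] V₀)

/-- The quadratic form `v ↦ B(v, Xv)` on `V₀`, for `X ∈ 𝔰𝔭𝔬(V)₀`. -/
def quadForm (X : spoEven B) : QuadraticForm ℝ V₀ :=
  LinearMap.BilinMap.toQuadraticMap (evenForm X)

variable (B) in
/-- `𝒱 = 𝒰 × 𝔰𝔬(V₁)`: the form `B(v, Xv)` on `V₀` is nondegenerate. -/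
def regularSet : Set (spoEven B) := {X | (evenForm X).Nondegenerate}

variable (B) in
/-- `𝒱_{p,q} = 𝒰_{p,q} × 𝔰𝔬(V₁)` (for `p + q = m`): the form `B(v, Xv)` has signature `(p, q)`. -/
def signatureSet (p q : ℕ) : Set (spoEven B) :=
  {X | sigPos (quadForm X) = p ∧ sigNeg (quadForm X) = q}

/-! ### The superPfaffian as a generalized function -/

variable (B) in
/-- The Grassmann algebra `Λ(V₁^* ⊕ 𝔰𝔭𝔬(V)₁^*) ⊗ ℂ`, generated by the odd coordinates on `V` and
on `𝔰𝔭𝔬(V)`. -/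
abbrev JointAlgebra := ExteriorAlgebra ℂ ((V₁ →ₗ[ℝ] ℂ) × (spoOdd B →ₗ[ℝ] ℂ))

/-- The odd coordinate on `V` dual to the real basis vector `g_j` (so `∑ g_j ηʲ = ∑ f_j ξʲ` is the
generic point of `V₁`). -/
def oddCoord (b : SymplecticBasis B k n) (j : Fin n) : JointAlgebra B :=
  ExteriorAlgebra.ι ℂ (Complex.ofRealCLM.toLinearMap ∘ₗ b.g.coord j, 0)

/-- The odd function on `𝔰𝔭𝔬(V)` given by a linear form on `𝔰𝔭𝔬(V)₁`. -/
def oddForm (l : spoOdd B →ₗ[ℝ] ℝ) : JointAlgebra B :=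
  ExteriorAlgebra.ι ℂ (0, Complex.ofRealCLM.toLinearMap ∘ₗ l)

/-- The linear form `G ↦ B(w, G v)` on `𝔰𝔭𝔬(V)₁`, for `v ∈ V₀`, `w ∈ V₁`. -/
def pairOddEven (w : V₁) (v : V₀) : spoOdd B →ₗ[ℝ] ℝ where
  toFun G := B.form₁ w (G.1.2 v)
  map_add' G G' := by simp
  map_smul' c G := by simp

/-- The linear form `G ↦ B(v, G w)` on `𝔰𝔭𝔬(V)₁`, for `v ∈ V₀`, `w ∈ V₁`. -/
def pairEvenOdd (v : V₀) (w : V₁) : spoOdd B →ₗ[ℝ] ℝ where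
  toFun G := B.form₀ v (G.1.1 w)
  map_add' G G' := by simp
  map_smul' c G := by simp

/-- The point of `V₀` with coordinates `x`. -/
def evenPoint (b : SymplecticBasis B k n) (x : Fin k × Fin 2 → ℝ) : V₀ := ∑ r, x r • b.e r

/-- The function `B(v, Xv) = -2 μ(X, v)` on `𝔰𝔭𝔬(V) × V`, at the even coordinates `X ∈ 𝔰𝔭𝔬(V)₀` and
`x ∈ V₀`. With homogeneous bases `g_i` of `V`, `G_k` of `𝔰𝔭𝔬(V)`, and dual bases `zⁱ`, `Zᵏ`, it is
`∑ B(g_i, G_k g_j) zʲ Zᵏ zⁱ` by the rule of signs. -/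
def superForm (b : SymplecticBasis B k n) (X : spoEven B) (x : Fin k × Fin 2 → ℝ) :
    JointAlgebra B :=
  algebraMap ℂ _ ((B.form₀ (evenPoint b x) (X.1.1 (evenPoint b x)) : ℝ) : ℂ)
    + ∑ i, ∑ j, ((B.form₁ (b.g i) (X.1.2 (b.g j)) : ℝ) : ℂ) • (oddCoord b j * oddCoord b i)
    + ∑ i, oddForm (pairOddEven (b.g i) (evenPoint b x)) * oddCoord b i
    + ∑ j, oddCoord b j * oddForm (pairEvenOdd (evenPoint b x) (b.g j))

/-- The derivation `∂/∂ξʲ`, i.e. contraction with the vector `f_j` of `V₁ ⊗ ℂ`. -/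
def oddDeriv (b : SymplecticBasis B k n) (i : ℂ) (j : Fin n) :
    JointAlgebra B →ₗ[ℂ] JointAlgebra B :=
  CliffordAlgebra.contractLeft
    { toFun := fun φ => b.phase i j * φ.1 (b.g j)
      map_add' := fun φ ψ => by simp [mul_add]
      map_smul' := fun c φ => by simp [mul_left_comm] }

/-- The Liouville integral along `V₁`: `φ ↦ ∂/∂ξ¹ ⋯ ∂/∂ξⁿ φ` evaluated at `ξ = 0`. -/
def berezin (b : SymplecticBasis B k n) (i : ℂ) : JointAlgebra B →ₗ[ℂ] OddAlgebra B :=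
  (ExteriorAlgebra.map (LinearMap.snd ℂ (V₁ →ₗ[ℝ] ℂ) (spoOdd B →ₗ[ℝ] ℂ))).toLinearMap ∘ₗ
    ((List.ofFn (oddDeriv b i)).prod : Module.End ℂ (JointAlgebra B))

/-- The function `x ↦ ∫ dξ ∫ ρ(X) exp(-(i/2) B(v, Xv)) dν(X)` of `x ∈ V₀`. -/
def spfInner (b : SymplecticBasis B k n) (i : ℂ) (ν : MeasureTheory.Measure (spoEven B))
    (ρ : spoEven B → ℂ) (x : Fin k × Fin 2 → ℝ) : OddAlgebra B :=
  ∫ X, ρ X • berezin b i (grassmannExp ((-(i / 2)) • superForm b X x)) ∂ν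

/-- The superPfaffian, a generalized function on `𝔰𝔭𝔬(V)`, i.e. a generalized function on
`𝔰𝔭𝔬(V)₀` with values in `Λ(𝔰𝔭𝔬(V)₁^*) ⊗ ℂ`: its value on the smooth compactly supported
distribution `ρ ν` (`ν` a Lebesgue measure on `𝔰𝔭𝔬(V)₀`) is
`i^{(m-n)/2} ∫_V d_V(v) ∫ ρ(X) exp(-(i/2) B(v, Xv)) dν(X)`. -/
def spf (b : SymplecticBasis B k n) (i : ℂ) (ν : MeasureTheory.Measure (spoEven B))
    (ρ : spoEven B → ℂ) : OddAlgebra B :=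
  (i ^ (((2 * k : ℂ) - n) / 2) * ((2 * Real.pi : ℝ) : ℂ)⁻¹ ^ k) •
    ∫ x : Fin k × Fin 2 → ℝ, spfInner b i ν ρ x

/-! ### Points of `𝔰𝔭𝔬(V)` -/

section Points

variable {P : Type*} [Ring P] [Algebra ℝ P] {𝒢 : ZMod 2 → Submodule ℝ P} [GradedAlgebra 𝒢]
  [NearSuperalgebra 𝒢]

variable (B 𝒢) in
/-- The points `(𝔰𝔭𝔬(V) ⊗ P)₀` of `𝔰𝔭𝔬(V)` with values in `P`. -/
abbrev SpoPoint := (spoEven B ⊗[ℝ] 𝒢 0) × (spoOdd B ⊗[ℝ] 𝒢 1)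

/-- The body of a point of `𝔰𝔭𝔬(V)`. -/
def pointBody (X : SpoPoint B 𝒢) : spoEven B :=
  TensorProduct.rid ℝ (spoEven B) (LinearMap.lTensor (spoEven B) (evenBody 𝒢) X.1)

/-- The nilpotent part of the `l`-th even coordinate of a point, in a basis of `𝔰𝔭𝔬(V)₀`. -/
def soulCoord (X : SpoPoint B 𝒢) (l : Fin (Module.finrank ℝ (spoEven B))) : 𝒢 0 :=
  applyPt ((Module.finBasis ℝ (spoEven B)).coord l) X.1 -
    algebraMap ℝ (𝒢 0) ((Module.finBasis ℝ (spoEven B)).coord l (pointBody X))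

/-- The value `F(X) ∈ P ⊗ ℂ` of a smooth complex function `F` on the supermanifold `𝔰𝔭𝔬(V)` at a
point `X`: Taylor's formula at the body in the even directions (the terms with `d ≥ dim P` vanish),
and substitution in the odd directions. -/
def value (F : spoEven B → OddAlgebra B) (X : SpoPoint B 𝒢) : ℂ ⊗[ℝ] P :=
  ∑ d ∈ Finset.range (Module.finrank ℝ P + 1), ((d.factorial : ℂ)⁻¹) •
    ∑ s : Fin d → Fin (Module.finrank ℝ (spoEven B)),
      evalOdd X.2 (iteratedFDeriv ℝ d F (pointBody X)
          (fun r => Module.finBasis ℝ (spoEven B) (s r))) *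
        ((1 : ℂ) ⊗ₜ[ℝ] ((∏ r, soulCoord X (s r) : 𝒢 0) : P))

/-- The block `A` of the matrix of `X` in the basis `(e, g)`. -/
def blockA (b : SymplecticBasis B k n) (X : SpoPoint B 𝒢) :
    Matrix (Fin k × Fin 2) (Fin k × Fin 2) (𝒢 0) := fun r s =>
  applyPt
    { toFun := fun G : spoEven B => b.e.coord r (G.1.1 (b.e s))
      map_add' := fun G G' => by simp
      map_smul' := fun c G => by simp } X.1

/-- The block `D` of the matrix of `X` in the basis `(e, g)`. -/
def blockD (b : SymplecticBasis B k n) (X : SpoPoint B 𝒢) :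
    Matrix (Fin n) (Fin n) (𝒢 0) := fun j l =>
  applyPt
    { toFun := fun G : spoEven B => b.g.coord j (G.1.2 (b.g l))
      map_add' := fun G G' => by simp
      map_smul' := fun c G => by simp } X.1

/-- The block `C` of the matrix of `X` in the basis `(e, g)`. -/
def blockC (b : SymplecticBasis B k n) (X : SpoPoint B 𝒢) :
    Matrix (Fin n) (Fin k × Fin 2) (𝒢 1) := fun j s =>
  applyPt
    { toFun := fun G : spoOdd B => b.g.coord j (G.1.2 (b.e s))
      map_add' := fun G G' => by simp
      map_smul' := fun c G => by simp } X.2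

/-- The block `B` of the matrix of `X` in the basis `(e, g)`. The entries of the matrix stand to the
right of the basis vectors, `X g_l = ∑ e_r B_{rl} + ⋯`; the sign comes from
`(G ⊗ p) g_l = -(G g_l) ⊗ p` for odd `p`. -/
def blockB (b : SymplecticBasis B k n) (X : SpoPoint B 𝒢) :
    Matrix (Fin k × Fin 2) (Fin n) (𝒢 1) := fun r l =>
  -applyPt
    { toFun := fun G : spoOdd B => b.e.coord r (G.1.1 (b.g l))
      map_add' := fun G G' => by simp
      map_smul' := fun c G => by simp } X.2

/-- The matrix `D - C A⁻¹ B`, in the real basis `g` of `V₁`. -/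
def schur (b : SymplecticBasis B k n) (X : SpoPoint B 𝒢) : Matrix (Fin n) (Fin n) (𝒢 0) :=
  fun j l => blockD b X j l -
    ⟨∑ r, ∑ s, (blockC b X j r : P) * ((blockA b X)⁻¹ r s : P) * (blockB b X s l : P),
      Submodule.sum_mem _ fun r _ => Submodule.sum_mem _ fun s _ =>
        odd_mul_even_mul_odd_mem (blockC b X j r) ((blockA b X)⁻¹ r s) (blockB b X s l)⟩

/-- The matrix `D - C A⁻¹ B`, in the orthonormal basis `f` of `V₁ ⊗ ℂ`. -/
def schurOrthonormal (b : SymplecticBasis B k n) (i : ℂ) (X : SpoPoint B 𝒢) :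
    Matrix (Fin n) (Fin n) (ℂ ⊗[ℝ] 𝒢 0) :=
  fun j l => ((b.phase i j)⁻¹ * b.phase i l) ⊗ₜ[ℝ] schur b X j l

/-- `Pfaff(D - C A⁻¹ B) / √|det A|`. -/
def pfaffQuotient (b : SymplecticBasis B k n) (i : ℂ) (X : SpoPoint B 𝒢) : ℂ ⊗[ℝ] P :=
  evenIncl 𝒢 (pfaffian (schurOrthonormal b i X) *
    ((1 : ℂ) ⊗ₜ[ℝ] Ring.inverse (nearSqrt (nearAbs (blockA b X).det))))

/-- The inverse Berezinian `Ber⁻(X) = det(A)⁻¹ det(D - C A⁻¹ B)` (for `A` invertible). -/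
def berInv (b : SymplecticBasis B k n) (X : SpoPoint B 𝒢) : P :=
  ((Ring.inverse (blockA b X).det * (schur b X).det : 𝒢 0) : P)

end Points

end Spo

end SuperPfaffian

end

open scoped TensorProduct ContDiff

noncomputable section

set_option linter.unusedSectionVars false

namespace SuperPfaffian

/-! ### Exterior algebras: nilpotency, the commutative even part, analysis -/

section Exterior

variable {M : Type*} [AddCommGroup M] [Module ℂ M]

/-! The superPfaffian is a Gaussian integral, oscillatory along `V₀` and fermionic along `V₁`,
coupled by the odd part of `X`. Let `S` be the Gram matrix of `B(v, Av)` on `V₀`. The exponent is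
`-(i/2) xᵀSx - i ∑ xᵣ sᵣ` plus a term quadratic in `ξ`, where the sources `sᵣ` (`oddSrc`) are
bilinear in `ξ` and the odd coordinates of the Lie superalgebra, hence even and nilpotent.
Completing the square in `x` leaves `exp((i/2) sᵀS⁻¹s)`, which changes the quadratic form of `D` in
`ξ` into that of `D - C A⁻¹ B` (`exponent_eq`). The Berezin integral then produces `i^(n/2)` times a
Pfaffian (`berezinMap_exp`, `gaussValue_eq`). An eigenvalue `λ` of `S` contributes `√(2π/|λ|)` times
`i^(1/2)` if `λ < 0` and `(-i)^(1/2)` if `λ > 0`. As `det S = det A`, the moduli give `1/√|det A|`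
and the phases collect to `i^q` (`prod_cpow_half_gaussian`, `spfFun_eq`).

Analytically, integrating over `X` first gives a Fourier transform of a test function at a frequency
quadratic in `x`. Pairing this frequency with an element whose Gram matrix is the identity gives a
multiple of `|x|²`, whence rapid decay and absolute convergence
(`exists_pow_mul_norm_oscIntegral_le`, `integrable_spfInner`). The two integrals do not commute as
they stand, so a factor `exp(-ε|x|²)` is inserted, Fubini is applied, the inner integral is computed
(`integral_gaussian_form`), and `ε → 0` by dominated convergence on both sides (`spf_eq_integral`).
The resulting function is analytic because the signature is locally constant where the form is
nondegenerate (`analyticAt_spfFun`).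

At a `P`-point, the truncated Taylor formula is multiplicative, by Leibniz's rule and nilpotency
(`taylor_mul`). Values therefore commute with sums, products and Pfaffians; inverse matrices and
inverse square roots are identified by the equations that characterize them. This gives the first
formula (`value_spfFun`). The second follows from `(i^q)² = (-1)^q`, the sign of `det A`, and from
`Pfaff² = det` (`pfaffian_mul_self`), proved by connecting the matrix to the standard antisymmetric
one over a polynomial ring. -/

/-- Rational scalars act on a complex Grassmann algebra. -/
instance ratModuleExteriorAlgebra : Module ℚ (ExteriorAlgebra ℂ M) :=
  Module.compHom _ (algebraMap ℚ ℂ)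

/-- The algebra is the supremum of the powers of the range of `ι`, and these commute with the range.
The generators thus span a two-sided ideal, whose powers can be regrouped. -/
theorem top_mul_range_ι :
    (⊤ : Submodule ℂ (ExteriorAlgebra ℂ M)) * LinearMap.range (ExteriorAlgebra.ι ℂ) =
      LinearMap.range (ExteriorAlgebra.ι ℂ) * ⊤ := by
  rw [← CliffordAlgebra.iSup_ι_range_eq_top, Submodule.iSup_mul, Submodule.mul_iSup]
  exact iSup_congr fun d => (pow_succ _ d).symm.trans (pow_succ' _ d)

theorem range_ι_mul_top_pow (d : ℕ) :
    (LinearMap.range (ExteriorAlgebra.ι ℂ : M →ₗ[ℂ] ExteriorAlgebra ℂ M) * ⊤) ^ (d + 1) =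
      LinearMap.range (ExteriorAlgebra.ι ℂ : M →ₗ[ℂ] ExteriorAlgebra ℂ M) ^ (d + 1) * ⊤ := by
  have htop : (⊤ : Submodule ℂ (ExteriorAlgebra ℂ M)) * ⊤ = ⊤ :=
    top_le_iff.mp fun x _ => by
      simpa using Submodule.mul_mem_mul (Submodule.mem_top (x := x)) (Submodule.mem_top (x := (1 : ExteriorAlgebra ℂ M)))
  induction d with
  | zero => simp
  | succ d ih =>
    rw [pow_succ, ih, mul_assoc, ← mul_assoc ⊤, top_mul_range_ι, mul_assoc, htop, ← mul_assoc,
      ← pow_succ]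

/-- The kernel of the scalar part is the ideal generated by the odd generators. -/
theorem sub_algebraMapInv_mem (z : ExteriorAlgebra ℂ M) :
    z - algebraMap ℂ _ (ExteriorAlgebra.algebraMapInv z) ∈
      LinearMap.range (ExteriorAlgebra.ι ℂ : M →ₗ[ℂ] ExteriorAlgebra ℂ M) * ⊤ := by
  induction z using ExteriorAlgebra.induction with
  | algebraMap r => simp
  | ι x =>
    have : ExteriorAlgebra.algebraMapInv (ExteriorAlgebra.ι ℂ x) = 0 := by
      simp [ExteriorAlgebra.algebraMapInv]
    rw [this, map_zero, sub_zero]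
    simpa using Submodule.mul_mem_mul (LinearMap.mem_range_self (ExteriorAlgebra.ι ℂ) x)
      (Submodule.mem_top (x := (1 : ExteriorAlgebra ℂ M)))
  | mul a c ha hc =>
    -- A product splits as `(a - b(a)) c + b(a) (c - b(c))`, where `b` is the scalar part.
    have e : a * c - algebraMap ℂ _ (ExteriorAlgebra.algebraMapInv (a * c)) =
        (a - algebraMap ℂ _ (ExteriorAlgebra.algebraMapInv a)) * c +
          ExteriorAlgebra.algebraMapInv a •
            (c - algebraMap ℂ _ (ExteriorAlgebra.algebraMapInv c)) := by
      rw [map_mul, map_mul, Algebra.smul_def]; noncomm_ring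
    rw [e]
    refine add_mem ?_ (Submodule.smul_mem _ _ hc)
    have h := Submodule.mul_mem_mul ha (Submodule.mem_top (x := c))
    rw [mul_assoc] at h
    exact (Submodule.mul_le.mpr fun p hp q _ => Submodule.mul_mem_mul hp Submodule.mem_top) h
  | add a c ha hc =>
    have := add_mem ha hc
    simpa [sub_add_sub_comm] using this

theorem range_ι_pow_finrank_succ [FiniteDimensional ℂ M] :
    LinearMap.range (ExteriorAlgebra.ι ℂ : M →ₗ[ℂ] ExteriorAlgebra ℂ M) ^
      (Module.finrank ℂ M + 1) = ⊥ := by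
  have h := exteriorPower.finrank_eq ℂ (M := M) (Module.finrank ℂ M + 1)
  rw [Nat.choose_succ_self] at h
  exact Submodule.finrank_eq_zero.mp h

/-- A power of the augmentation ideal is generated by the exterior power of the same degree, and
that one vanishes above the dimension. This is what makes the truncation in `grassmannExp` harmless.
-/
theorem sub_algebraMapInv_pow_eq_zero [FiniteDimensional ℂ M] (z : ExteriorAlgebra ℂ M) :
    (z - algebraMap ℂ _ (ExteriorAlgebra.algebraMapInv z)) ^ (Module.finrank ℂ M + 1) = 0 := by
  have h := Submodule.pow_mem_pow _ (sub_algebraMapInv_mem z) (Module.finrank ℂ M + 1)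
  rwa [range_ι_mul_top_pow, range_ι_pow_finrank_succ, Submodule.bot_mul, Submodule.mem_bot] at h

theorem isNilpotent_of_algebraMapInv_eq_zero [FiniteDimensional ℂ M] {z : ExteriorAlgebra ℂ M}
    (hz : ExteriorAlgebra.algebraMapInv z = 0) : z ^ (Module.finrank ℂ M + 1) = 0 := by
  simpa [hz] using sub_algebraMapInv_pow_eq_zero z

/-- Replaces the truncated series by `IsNilpotent.exp`, for which the addition theorem is available.
-/
theorem grassmannExp_eq [FiniteDimensional ℂ M] (c : ℂ) {z : ExteriorAlgebra ℂ M}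
    (hz : ExteriorAlgebra.algebraMapInv z = 0) :
    grassmannExp (algebraMap ℂ _ c + z) = Complex.exp c • IsNilpotent.exp z := by
  have h : ExteriorAlgebra.algebraMapInv (algebraMap ℂ (ExteriorAlgebra ℂ M) c + z) = c := by
    rw [map_add, hz, add_zero]; exact ExteriorAlgebra.algebraMap_leftInverse M c
  rw [grassmannExp, h, add_sub_cancel_left,
    IsNilpotent.exp_eq_sum (isNilpotent_of_algebraMapInv_eq_zero hz)]
  congr 1
  refine Finset.sum_congr rfl fun d _ => ?_
  rw [← Rat.cast_smul_eq_qsmul ℂ]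
  simp

variable (M) in
/-- The subalgebra of a Grassmann algebra generated by the products of two odd generators. -/
def evenSub : Subalgebra ℂ (ExteriorAlgebra ℂ M) :=
  Algebra.adjoin ℂ {x | ∃ a c : M, ExteriorAlgebra.ι ℂ a * ExteriorAlgebra.ι ℂ c = x}

theorem ι_mul_ι_mem (a c : M) : ExteriorAlgebra.ι ℂ a * ExteriorAlgebra.ι ℂ c ∈ evenSub M :=
  Algebra.subset_adjoin ⟨a, c, rfl⟩

theorem ι_mul_ι_anticomm (a c : M) : ExteriorAlgebra.ι ℂ a * ExteriorAlgebra.ι ℂ c =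
    -(ExteriorAlgebra.ι ℂ c * ExteriorAlgebra.ι ℂ a) :=
  eq_neg_of_add_eq_zero_left (ExteriorAlgebra.ι_add_mul_swap a c)

/-- Moving a generator past a pair costs two signs, so pairs are central. All exponents below are
built from pairs and hence live in a commutative ring, where exponentials multiply and determinants
and Pfaffians make sense. -/
theorem evenSub_commute {x : ExteriorAlgebra ℂ M} (hx : x ∈ evenSub M) (z : ExteriorAlgebra ℂ M) :
    Commute x z := by
  induction hx using Algebra.adjoin_induction with
  | algebraMap r => exact Algebra.commutes r z
  | add _ _ _ _ h1 h2 => exact h1.add_left h2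
  | mul _ _ _ _ h1 h2 => exact h1.mul_left h2
  | mem x h =>
    obtain ⟨a, c, rfl⟩ := h
    induction z using ExteriorAlgebra.induction with
    | algebraMap r => exact (Algebra.commutes r _).symm
    | add _ _ h1 h2 => exact h1.add_right h2
    | mul _ _ h1 h2 => exact h1.mul_right h2
    | ι y =>
      change _ * _ = _ * _
      rw [mul_assoc, ι_mul_ι_anticomm c y, mul_neg, ← mul_assoc, ι_mul_ι_anticomm a y, neg_mul,
        neg_neg, mul_assoc]

variable (M) in
/-- The commutative algebra of even elements of a Grassmann algebra. -/
@[ext]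
structure EvenAlg where
  /-- The underlying element of the Grassmann algebra. -/
  coe : ExteriorAlgebra ℂ M
  mem : coe ∈ evenSub M

namespace EvenAlg

instance : Zero (EvenAlg M) := ⟨⟨0, zero_mem _⟩⟩
instance : One (EvenAlg M) := ⟨⟨1, one_mem _⟩⟩
instance : Add (EvenAlg M) := ⟨fun a c => ⟨a.coe + c.coe, add_mem a.mem c.mem⟩⟩
instance : Mul (EvenAlg M) := ⟨fun a c => ⟨a.coe * c.coe, mul_mem a.mem c.mem⟩⟩
instance : Neg (EvenAlg M) := ⟨fun a => ⟨-a.coe, neg_mem a.mem⟩⟩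
instance : Sub (EvenAlg M) := ⟨fun a c => ⟨a.coe - c.coe, sub_mem a.mem c.mem⟩⟩
instance : SMul ℕ (EvenAlg M) := ⟨fun d a => ⟨d • a.coe, nsmul_mem a.mem d⟩⟩
instance : SMul ℤ (EvenAlg M) := ⟨fun d a => ⟨d • a.coe, zsmul_mem a.mem d⟩⟩
instance : Pow (EvenAlg M) ℕ := ⟨fun a d => ⟨a.coe ^ d, pow_mem a.mem d⟩⟩
instance : NatCast (EvenAlg M) := ⟨fun d => ⟨d, natCast_mem _ d⟩⟩
instance : IntCast (EvenAlg M) := ⟨fun d => ⟨d, intCast_mem _ d⟩⟩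

theorem coe_injective : Function.Injective (coe : EvenAlg M → ExteriorAlgebra ℂ M) :=
  fun _ _ => EvenAlg.ext

instance ring : Ring (EvenAlg M) :=
  coe_injective.ring _ rfl rfl (fun _ _ => rfl) (fun _ _ => rfl) (fun _ => rfl) (fun _ _ => rfl)
    (fun _ _ => rfl) (fun _ _ => rfl) (fun _ _ => rfl) (fun _ => rfl) (fun _ => rfl)

instance commRing : CommRing (EvenAlg M) :=
  { EvenAlg.ring with
    mul_comm := fun a c => EvenAlg.ext (evenSub_commute a.mem c.coe) }

instance algebra : Algebra ℂ (EvenAlg M) where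
  smul r a := ⟨r • a.coe, Subalgebra.smul_mem _ a.mem r⟩
  algebraMap :=
    { toFun := fun r => ⟨algebraMap ℂ _ r, Subalgebra.algebraMap_mem _ r⟩
      map_one' := EvenAlg.ext (map_one _)
      map_mul' := fun _ _ => EvenAlg.ext (map_mul _ _ _)
      map_zero' := EvenAlg.ext (map_zero _)
      map_add' := fun _ _ => EvenAlg.ext (map_add _ _ _) }
  commutes' _ _ := mul_comm _ _
  smul_def' r a := EvenAlg.ext (Algebra.smul_def r a.coe)

end EvenAlg

/-- Rational scalars act on the even part of a complex Grassmann algebra. -/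
instance EvenAlg.ratModule : Module ℚ (EvenAlg M) :=
  Module.compHom _ (algebraMap ℚ ℂ)

variable (M) in
/-- The inclusion of the even part in a Grassmann algebra. -/
def EvenAlg.val : EvenAlg M →ₐ[ℂ] ExteriorAlgebra ℂ M where
  toFun := EvenAlg.coe
  map_one' := rfl
  map_mul' _ _ := rfl
  map_zero' := rfl
  map_add' _ _ := rfl
  commutes' _ := rfl

theorem EvenAlg.val_injective : Function.Injective (EvenAlg.val M) := EvenAlg.coe_injective

theorem EvenAlg.commute (x : EvenAlg M) (z : ExteriorAlgebra ℂ M) : Commute (EvenAlg.val M x) z :=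
  evenSub_commute x.mem z

/-- The product of two odd generators, as an even element. -/
def EvenAlg.mul₂ (a c : M) : EvenAlg M := ⟨_, ι_mul_ι_mem a c⟩

theorem EvenAlg.val_mul₂ (a c : M) :
    EvenAlg.val M (EvenAlg.mul₂ a c) = ExteriorAlgebra.ι ℂ a * ExteriorAlgebra.ι ℂ c := rfl

theorem EvenAlg.mul₂_swap (a c : M) : EvenAlg.mul₂ a c = -EvenAlg.mul₂ c a :=
  EvenAlg.val_injective (by rw [map_neg, val_mul₂, val_mul₂, ι_mul_ι_anticomm])

theorem EvenAlg.algebraMapInv_mul₂ (a c : M) :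
    ExteriorAlgebra.algebraMapInv (EvenAlg.val M (EvenAlg.mul₂ a c)) = 0 := by
  rw [val_mul₂, map_mul]
  simp [ExteriorAlgebra.algebraMapInv]

/-- `EvenAlg.mul₂` as a bilinear map. -/
def EvenAlg.mul₂ₗ : M →ₗ[ℂ] M →ₗ[ℂ] EvenAlg M :=
  LinearMap.mk₂ ℂ EvenAlg.mul₂
    (fun a a' c => EvenAlg.val_injective (by simp only [map_add, val_mul₂, add_mul]))
    (fun r a c => EvenAlg.val_injective (by simp only [map_smul, val_mul₂, smul_mul_assoc]))
    (fun a c c' => EvenAlg.val_injective (by simp only [map_add, val_mul₂, mul_add]))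
    (fun r a c => EvenAlg.val_injective (by simp only [map_smul, val_mul₂, mul_smul_comm]))

theorem EvenAlg.mul₂ₗ_apply (a c : M) : EvenAlg.mul₂ₗ a c = EvenAlg.mul₂ a c := rfl

theorem evenSub_map {N : Type*} [AddCommGroup N] [Module ℂ N] (f : M →ₗ[ℂ] N)
    {x : ExteriorAlgebra ℂ M} (hx : x ∈ evenSub M) : ExteriorAlgebra.map f x ∈ evenSub N := by
  induction hx using Algebra.adjoin_induction with
  | algebraMap r => rw [AlgHom.commutes]; exact (evenSub N).algebraMap_mem r
  | add _ _ _ _ h1 h2 => rw [map_add]; exact add_mem h1 h2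
  | mul _ _ _ _ h1 h2 => rw [map_mul]; exact mul_mem h1 h2
  | mem x h =>
    obtain ⟨a, c, rfl⟩ := h
    simpa using ι_mul_ι_mem (f a) (f c)

/-- The morphism of commutative algebras induced by a linear map. -/
def EvenAlg.map {N : Type*} [AddCommGroup N] [Module ℂ N] (f : M →ₗ[ℂ] N) :
    EvenAlg M →ₐ[ℂ] EvenAlg N where
  toFun x := ⟨ExteriorAlgebra.map f x.coe, evenSub_map f x.mem⟩
  map_one' := EvenAlg.ext (map_one _)
  map_mul' _ _ := EvenAlg.ext (map_mul _ _ _)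
  map_zero' := EvenAlg.ext (map_zero _)
  map_add' _ _ := EvenAlg.ext (map_add _ _ _)
  commutes' r := EvenAlg.ext (AlgHom.commutes _ r)

theorem EvenAlg.val_map {N : Type*} [AddCommGroup N] [Module ℂ N] (f : M →ₗ[ℂ] N)
    (x : EvenAlg M) : EvenAlg.val N (EvenAlg.map f x) = ExteriorAlgebra.map f (EvenAlg.val M x) :=
  rfl

theorem EvenAlg.map_mul₂ {N : Type*} [AddCommGroup N] [Module ℂ N] (f : M →ₗ[ℂ] N) (a c : M) :
    EvenAlg.map f (EvenAlg.mul₂ a c) = EvenAlg.mul₂ (f a) (f c) :=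
  EvenAlg.val_injective (by
    rw [val_map, val_mul₂, val_mul₂, map_mul, ExteriorAlgebra.map_apply_ι,
      ExteriorAlgebra.map_apply_ι])

theorem EvenAlg.pow_eq_zero [FiniteDimensional ℂ M] {x : EvenAlg M}
    (hx : ExteriorAlgebra.algebraMapInv (EvenAlg.val M x) = 0) :
    x ^ (Module.finrank ℂ M + 1) = 0 :=
  EvenAlg.val_injective (by rw [map_pow, isNilpotent_of_algebraMapInv_eq_zero hx, map_zero])

theorem EvenAlg.val_exp [FiniteDimensional ℂ M] {x : EvenAlg M}
    (hx : ExteriorAlgebra.algebraMapInv (EvenAlg.val M x) = 0) :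
    EvenAlg.val M (IsNilpotent.exp x) = IsNilpotent.exp (EvenAlg.val M x) :=
  IsNilpotent.map_exp (f := (EvenAlg.val M).toRingHom) ⟨_, EvenAlg.pow_eq_zero hx⟩

theorem EvenAlg.grassmannExp_eq [FiniteDimensional ℂ M] (c : ℂ) {x y : EvenAlg M}
    (hx : ExteriorAlgebra.algebraMapInv (EvenAlg.val M x) = 0)
    (hy : ExteriorAlgebra.algebraMapInv (EvenAlg.val M y) = 0) :
    grassmannExp (algebraMap ℂ _ c + EvenAlg.val M (x + y)) =
      Complex.exp c • EvenAlg.val M (IsNilpotent.exp x * IsNilpotent.exp y) := by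
  have h : ExteriorAlgebra.algebraMapInv (EvenAlg.val M (x + y)) = 0 := by
    rw [map_add, map_add, hx, hy, add_zero]
  rw [SuperPfaffian.grassmannExp_eq c h, ← IsNilpotent.exp_add_of_commute (Commute.all _ _)
    ⟨_, EvenAlg.pow_eq_zero hx⟩ ⟨_, EvenAlg.pow_eq_zero hy⟩, EvenAlg.val_exp h]

variable [FiniteDimensional ℂ M]

variable (M) in
/-- Multiplication in a Grassmann algebra as a continuous bilinear map. -/
def mulCLM : ExteriorAlgebra ℂ M →L[ℝ] ExteriorAlgebra ℂ M →L[ℝ] ExteriorAlgebra ℂ M :=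
  haveI : FiniteDimensional ℝ (ExteriorAlgebra ℂ M) := FiniteDimensional.complexToReal _
  LinearMap.toContinuousBilinearMap (LinearMap.mul ℝ (ExteriorAlgebra ℂ M))

theorem mulCLM_apply (x y : ExteriorAlgebra ℂ M) : mulCLM M x y = x * y := rfl

/-- The auxiliary norm is not claimed to be submultiplicative; continuity and analyticity of
products come from bilinearity in finite dimension. -/
instance continuousMul_exteriorAlgebra : ContinuousMul (ExteriorAlgebra ℂ M) :=
  ⟨(mulCLM M).continuous₂⟩

variable {E : Type*} [NormedAddCommGroup E] [NormedSpace ℝ E]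

theorem analyticAt_exterior_mul {f g : E → ExteriorAlgebra ℂ M} {x : E} (hf : AnalyticAt ℝ f x)
    (hg : AnalyticAt ℝ g x) : AnalyticAt ℝ (fun y => f y * g y) x :=
  ((mulCLM M).analyticAt_bilinear _).comp₂ hf hg

theorem analyticAt_exterior_pow {f : E → ExteriorAlgebra ℂ M} {x : E} (hf : AnalyticAt ℝ f x)
    (d : ℕ) : AnalyticAt ℝ (fun y => f y ^ d) x := by
  induction d with
  | zero => simpa using analyticAt_const
  | succ d ih => simpa only [pow_succ] using analyticAt_exterior_mul ih hf

end Exterior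

local instance finite_oddForms {V₀ V₁ : Type*} [NormedAddCommGroup V₀] [NormedSpace ℝ V₀]
    [FiniteDimensional ℝ V₀] [NormedAddCommGroup V₁] [NormedSpace ℝ V₁] [FiniteDimensional ℝ V₁]
    {B : SymplecticForm V₀ V₁} :
    Module.Finite ℂ (spoOdd B →ₗ[ℝ] ℂ) := inferInstance

local instance finite_jointForms {V₀ V₁ : Type*} [NormedAddCommGroup V₀] [NormedSpace ℝ V₀]
    [FiniteDimensional ℝ V₀] [NormedAddCommGroup V₁] [NormedSpace ℝ V₁] [FiniteDimensional ℝ V₁]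
    {B : SymplecticForm V₀ V₁} :
    Module.Finite ℂ ((V₁ →ₗ[ℝ] ℂ) × (spoOdd B →ₗ[ℝ] ℂ)) := inferInstance

local instance normedSpace_real_oddAlgebra {V₀ V₁ : Type*} [NormedAddCommGroup V₀] [NormedSpace ℝ V₀]
    [FiniteDimensional ℝ V₀] [NormedAddCommGroup V₁] [NormedSpace ℝ V₁] [FiniteDimensional ℝ V₁]
    {B : SymplecticForm V₀ V₁} :
    NormedSpace ℝ (OddAlgebra B) := NormedSpace.complexToReal

local instance normedSpace_real_jointAlgebra {V₀ V₁ : Type*} [NormedAddCommGroup V₀] [NormedSpace ℝ V₀]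
    [FiniteDimensional ℝ V₀] [NormedAddCommGroup V₁] [NormedSpace ℝ V₁] [FiniteDimensional ℝ V₁]
    {B : SymplecticForm V₀ V₁} :
    NormedSpace ℝ (JointAlgebra B) := NormedSpace.complexToReal

/-! ### Nilpotent exponentials in commutative algebras -/

section NilpotentExp

variable {R : Type*} [CommRing R] [Algebra ℂ R] [Module ℚ R]

theorem exp_eq_sum_complex {N : ℕ} {u : R} (hu : u ^ N = 0) :
    IsNilpotent.exp u = ∑ d ∈ Finset.range N, ((d.factorial : ℂ)⁻¹) • u ^ d := by
  rw [IsNilpotent.exp_eq_sum hu]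
  refine Finset.sum_congr rfl fun d _ => ?_
  rw [← Rat.cast_smul_eq_qsmul ℂ]
  simp

theorem exp_sum {α : Type*} (s : Finset α) {u : α → R} (hu : ∀ j, IsNilpotent (u j)) :
    IsNilpotent.exp (∑ j ∈ s, u j) = ∏ j ∈ s, IsNilpotent.exp (u j) := by
  classical
  induction s using Finset.induction_on with
  | empty => simp
  | insert a s ha ih =>
    rw [Finset.sum_insert ha, Finset.prod_insert ha, ← ih]
    exact IsNilpotent.exp_add_of_commute (Commute.all _ _) (hu a)
      (isNilpotent_sum fun j _ => hu j)

/-- Separates the integration variables `y` from the algebra: the exponential of a nilpotent source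
is a polynomial in `y` with coefficients in `R`, so only moments have to be integrated. -/
theorem exp_sum_smul {α : Type*} [Fintype α] [DecidableEq α] {N : ℕ} {u : α → R}
    (hu : ∀ j, u j ^ N = 0) (y : α → ℂ) :
    IsNilpotent.exp (∑ j, y j • u j) = ∑ δ ∈ Fintype.piFinset fun _ : α => Finset.range N,
      (∏ j, y j ^ δ j) • ∏ j, ((δ j).factorial : ℂ)⁻¹ • u j ^ δ j := by
  have h (j : α) : (y j • u j) ^ N = 0 := by rw [smul_pow, hu, smul_zero]
  rw [exp_sum _ fun j => ⟨N, h j⟩]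
  simp_rw [fun j => exp_eq_sum_complex (h j), Finset.prod_univ_sum]
  refine Finset.sum_congr rfl fun δ _ => ?_
  rw [← Finset.prod_smul]
  exact Finset.prod_congr rfl fun j _ => by rw [smul_pow, smul_comm]

end NilpotentExp

/-! ### The function `exp(-(i/2) B(v, Xv))` in coordinates -/

section Coordinates

variable {V₀ V₁ : Type*} [NormedAddCommGroup V₀] [NormedSpace ℝ V₀] [FiniteDimensional ℝ V₀]
  [NormedAddCommGroup V₁] [NormedSpace ℝ V₁] [FiniteDimensional ℝ V₁]
  {B : SymplecticForm V₀ V₁} {k n : ℕ}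

/-- The Gram matrix of the form `B(v, Xw)` on `V₀`. -/
def gram (b : SymplecticBasis B k n) (X : spoEven B) :
    Matrix (Fin k × Fin 2) (Fin k × Fin 2) ℝ :=
  Matrix.of fun r s => B.form₀ (b.e r) (X.1.1 (b.e s))

variable (B) in
/-- The even part of the joint Grassmann algebra. -/
abbrev JointEven := EvenAlg ((V₁ →ₗ[ℝ] ℂ) × (spoOdd B →ₗ[ℝ] ℂ))

variable (B) in
/-- The inclusion of the even part in the joint Grassmann algebra. -/
abbrev jointVal : JointEven B →ₐ[ℂ] JointAlgebra B := EvenAlg.val _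

variable (B) in
/-- An exponent that kills the nilpotent elements of the joint Grassmann algebra. -/
abbrev jointOrder : ℕ := Module.finrank ℂ ((V₁ →ₗ[ℝ] ℂ) × (spoOdd B →ₗ[ℝ] ℂ)) + 1

/-- The linear form underlying `oddCoord`. -/
def coordVec (b : SymplecticBasis B k n) (j : Fin n) :
    (V₁ →ₗ[ℝ] ℂ) × (spoOdd B →ₗ[ℝ] ℂ) :=
  (Complex.ofRealCLM.toLinearMap ∘ₗ b.g.coord j, 0)

/-- The linear form underlying `oddForm (pairOddEven (b.g j) (b.e r))`. -/
def pairVec (b : SymplecticBasis B k n) (j : Fin n) (r : Fin k × Fin 2) :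
    (V₁ →ₗ[ℝ] ℂ) × (spoOdd B →ₗ[ℝ] ℂ) :=
  (0, Complex.ofRealCLM.toLinearMap ∘ₗ pairOddEven (b.g j) (b.e r))

/-- The part of `B(v, Xv)` of degree two in the odd coordinates on `V`. -/
def oddSq (b : SymplecticBasis B k n) (X : spoEven B) : JointEven B :=
  ∑ i, ∑ j, ((B.form₁ (b.g i) (X.1.2 (b.g j)) : ℝ) : ℂ) •
    EvenAlg.mul₂ (coordVec b j) (coordVec b i)

/-- Half the coefficient of the even coordinate `x r` in `B(v, Xv)`. -/
def oddSrc (b : SymplecticBasis B k n) (r : Fin k × Fin 2) : JointEven B :=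
  ∑ i, EvenAlg.mul₂ (pairVec b i r) (coordVec b i)

theorem coe_oddSq (b : SymplecticBasis B k n) (X : spoEven B) :
    jointVal B (oddSq b X) =
      ∑ i, ∑ j, ((B.form₁ (b.g i) (X.1.2 (b.g j)) : ℝ) : ℂ) • (oddCoord b j * oddCoord b i) := by
  simp only [oddSq, map_sum, map_smul]
  rfl

theorem coe_oddSrc (b : SymplecticBasis B k n) (r : Fin k × Fin 2) :
    jointVal B (oddSrc b r) =
      ∑ i, oddForm (pairOddEven (b.g i) (b.e r)) * oddCoord b i := by
  simp only [oddSrc, map_sum]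
  rfl

theorem algebraMapInv_oddSq (b : SymplecticBasis B k n) (X : spoEven B) :
    ExteriorAlgebra.algebraMapInv (jointVal B (oddSq b X)) = 0 := by
  simp only [oddSq, map_sum, map_smul, EvenAlg.algebraMapInv_mul₂, smul_zero,
    Finset.sum_const_zero]

theorem algebraMapInv_oddSrc (b : SymplecticBasis B k n) (r : Fin k × Fin 2) :
    ExteriorAlgebra.algebraMapInv (jointVal B (oddSrc b r)) = 0 := by
  simp only [oddSrc, map_sum, EvenAlg.algebraMapInv_mul₂, Finset.sum_const_zero]

theorem form_evenPoint (b : SymplecticBasis B k n) (X : spoEven B) (x : Fin k × Fin 2 → ℝ) :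
    B.form₀ (evenPoint b x) (X.1.1 (evenPoint b x)) = ∑ r, ∑ s, x r * gram b X r s * x s := by
  simp only [evenPoint, map_sum, map_smul, LinearMap.sum_apply, LinearMap.smul_apply, gram,
    Matrix.of_apply, smul_eq_mul, Finset.mul_sum]
  rw [Finset.sum_comm]
  exact Finset.sum_congr rfl fun r _ => Finset.sum_congr rfl fun s _ => by ring

theorem oddForm_anticomm (b : SymplecticBasis B k n) (l : spoOdd B →ₗ[ℝ] ℝ) (j : Fin n) :
    oddCoord b j * oddForm l = -(oddForm l * oddCoord b j) :=
  ι_mul_ι_anticomm _ _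

/-- This is the invariance of `B` under odd endomorphisms, together with the symmetry of the form on
`V₁`. -/
theorem pairEvenOdd_eq (v : V₀) (w : V₁) :
    (pairEvenOdd v w : spoOdd B →ₗ[ℝ] ℝ) = -pairOddEven w v := by
  ext G
  have h := G.2.1 v w
  rw [← B.isSymm.eq] at h
  exact eq_neg_of_add_eq_zero_right h

theorem oddForm_add (l l' : spoOdd B →ₗ[ℝ] ℝ) :
    (oddForm (l + l') : JointAlgebra B) = oddForm l + oddForm l' := by
  rw [oddForm, oddForm, oddForm, ← map_add, Prod.mk_add_mk, add_zero, LinearMap.comp_add]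

theorem oddForm_smul (c : ℝ) (l : spoOdd B →ₗ[ℝ] ℝ) :
    (oddForm (c • l) : JointAlgebra B) = (c : ℂ) • oddForm l := by
  rw [oddForm, oddForm, ← map_smul, Prod.smul_mk, smul_zero]
  congr 2
  ext G
  simp

/-- `oddForm` as a linear map. -/
def oddFormₗ : (spoOdd B →ₗ[ℝ] ℝ) →ₗ[ℝ] JointAlgebra B where
  toFun := oddForm
  map_add' := oddForm_add
  map_smul' c l := oddForm_smul c l

/-- `pairOddEven` as a linear map in the even argument. -/
def pairOddEvenₗ (w : V₁) : V₀ →ₗ[ℝ] (spoOdd B →ₗ[ℝ] ℝ) where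
  toFun := pairOddEven w
  map_add' v v' := by ext G; simp [pairOddEven]
  map_smul' c v := by ext G; simp [pairOddEven]

theorem oddForm_pairOddEven_evenPoint (b : SymplecticBasis B k n) (w : V₁)
    (x : Fin k × Fin 2 → ℝ) : (oddForm (pairOddEven w (evenPoint b x)) : JointAlgebra B) =
      ∑ r, (x r : ℂ) • oddForm (pairOddEven w (b.e r)) := by
  change (oddFormₗ ∘ₗ pairOddEvenₗ w) (evenPoint b x) = _
  rw [evenPoint, map_sum]
  exact Finset.sum_congr rfl fun r _ => map_smul _ _ _

theorem oddForm_neg (l : spoOdd B →ₗ[ℝ] ℝ) :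
    (oddForm (-l) : JointAlgebra B) = -oddForm l :=
  map_neg oddFormₗ l

/-- The two mixed sums are equal: invariance gives one sign, the exchange of two odd coordinates
another. Hence the factor 2. -/
theorem superForm_mixed (b : SymplecticBasis B k n) (x : Fin k × Fin 2 → ℝ) :
    ∑ i, oddForm (pairOddEven (b.g i) (evenPoint b x)) * oddCoord b i +
      ∑ j, oddCoord b j * oddForm (pairEvenOdd (evenPoint b x) (b.g j)) =
    jointVal B (∑ r, (2 * x r : ℂ) • oddSrc b r) := by
  have h (j : Fin n) : oddCoord b j * oddForm (pairEvenOdd (evenPoint b x) (b.g j)) =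
      oddForm (pairOddEven (b.g j) (evenPoint b x)) * oddCoord b j := by
    rw [pairEvenOdd_eq, oddForm_anticomm, oddForm_neg, neg_mul, neg_neg]
  simp only [h]
  rw [← two_smul ℂ]
  simp only [map_sum, map_smul, coe_oddSrc, oddForm_pairOddEven_evenPoint, Finset.sum_mul,
    Finset.smul_sum, smul_mul_assoc, mul_smul]
  exact Finset.sum_comm

theorem superForm_eq (b : SymplecticBasis B k n) (X : spoEven B) (x : Fin k × Fin 2 → ℝ) :
    superForm b X x =
      algebraMap ℂ _ ((∑ r, ∑ s, x r * gram b X r s * x s : ℝ) : ℂ) +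
        jointVal B (oddSq b X + ∑ r, (2 * x r : ℂ) • oddSrc b r) := by
  have aux {G : Type _} [AddSemigroup G] (a q s t p : G) (e : s + t = p) :
      a + q + s + t = a + (q + p) := by rw [← e]; simp only [add_assoc]
  rw [map_add, coe_oddSq, ← form_evenPoint b X x]
  exact aux _ _ _ _ _ (superForm_mixed b x)

theorem smul_superForm (b : SymplecticBasis B k n) (c : ℂ) (X : spoEven B)
    (x : Fin k × Fin 2 → ℝ) : c • superForm b X x =
      algebraMap ℂ _ (c * (∑ r, ∑ s, x r * gram b X r s * x s : ℝ)) +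
        jointVal B (c • oddSq b X + ∑ r, (x r : ℂ) • (2 * c) • oddSrc b r) := by
  have h : ∑ r, (x r : ℂ) • (2 * c) • oddSrc b r = c • ∑ r, (2 * x r : ℂ) • oddSrc b r := by
    rw [Finset.smul_sum]
    refine Finset.sum_congr rfl fun r _ => ?_
    rw [smul_smul, smul_smul]
    congr 1
    ring
  rw [h, ← smul_add, map_smul, superForm_eq, smul_add, map_mul, Algebra.smul_def]

/-- The function `exp(-(i/2) B(v, Xv))`. -/
theorem grassmannExp_superForm (b : SymplecticBasis B k n) (i : ℂ) (X : spoEven B)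
    (x : Fin k × Fin 2 → ℝ) :
    grassmannExp ((-(i / 2)) • superForm b X x) =
      Complex.exp (-(i / 2) * (∑ r, ∑ s, x r * gram b X r s * x s : ℝ)) •
        jointVal B (IsNilpotent.exp ((-(i / 2)) • oddSq b X) *
          IsNilpotent.exp (∑ r, (x r : ℂ) • (-i) • oddSrc b r)) := by
  have h4 : 2 * -(i / 2) = -i := by ring
  rw [smul_superForm, h4, EvenAlg.grassmannExp_eq]
  · rw [map_smul, map_smul, algebraMapInv_oddSq, smul_zero]
  · simp only [map_sum, map_smul, algebraMapInv_oddSrc, smul_zero, Finset.sum_const_zero]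

/-- The exponential of the odd part, followed by the Liouville integral along `V₁`. -/
def berezinExp (b : SymplecticBasis B k n) (i : ℂ) (X : spoEven B) :
    JointEven B →ₗ[ℂ] OddAlgebra B :=
  berezin b i ∘ₗ (jointVal B).toLinearMap ∘ₗ
    LinearMap.mulLeft ℂ (A := JointEven B) (IsNilpotent.exp ((-(i / 2)) • oddSq b X))

theorem berezinExp_apply (b : SymplecticBasis B k n) (i : ℂ) (X : spoEven B) (z : JointEven B) :
    berezinExp b i X z =
      berezin b i (jointVal B (IsNilpotent.exp ((-(i / 2)) • oddSq b X) * z)) := rfl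

theorem berezin_grassmannExp (b : SymplecticBasis B k n) (i : ℂ) (X : spoEven B)
    (x : Fin k × Fin 2 → ℝ) :
    berezin b i (grassmannExp ((-(i / 2)) • superForm b X x)) =
      Complex.exp (-(i / 2) * (∑ r, ∑ s, x r * gram b X r s * x s : ℝ)) •
        berezinExp b i X (IsNilpotent.exp (∑ r, (x r : ℂ) • (-i) • oddSrc b r)) := by
  rw [grassmannExp_superForm, map_smul, berezinExp_apply]

theorem oddSrc_pow_eq_zero (b : SymplecticBasis B k n) (c : ℂ) (r : Fin k × Fin 2) :
    (c • oddSrc b r) ^ jointOrder B = 0 := by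
  rw [smul_pow, EvenAlg.pow_eq_zero (algebraMapInv_oddSrc b r), smul_zero]

theorem oddSq_pow_eq_zero (b : SymplecticBasis B k n) (c : ℂ) (X : spoEven B) :
    (c • oddSq b X) ^ jointOrder B = 0 := by
  rw [smul_pow, EvenAlg.pow_eq_zero (algebraMapInv_oddSq b X), smul_zero]

end Coordinates

/-! ### The Berezin integral of a Gaussian is a Pfaffian -/

section Berezin

variable {M : Type*} [AddCommGroup M] [Module ℂ M]

/-- Contraction of a Grassmann algebra with a linear form. -/
abbrev contr (d : Module.Dual ℂ M) : ExteriorAlgebra ℂ M →ₗ[ℂ] ExteriorAlgebra ℂ M :=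
  CliffordAlgebra.contractLeft d

theorem contr_ι_mul (d : Module.Dual ℂ M) (v : M) (z : ExteriorAlgebra ℂ M) :
    contr d (ExteriorAlgebra.ι ℂ v * z) = d v • z - ExteriorAlgebra.ι ℂ v * contr d z :=
  CliffordAlgebra.contractLeft_ι_mul d v z

/-- The contraction crosses two generators that it annihilates, and the two signs cancel. -/
theorem contr_mul₂_mul {d : Module.Dual ℂ M} {v w : M} (hv : d v = 0) (hw : d w = 0)
    (z : ExteriorAlgebra ℂ M) : contr d (EvenAlg.val M (EvenAlg.mul₂ v w) * z) =
      EvenAlg.val M (EvenAlg.mul₂ v w) * contr d z := by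
  rw [EvenAlg.val_mul₂, mul_assoc, contr_ι_mul, contr_ι_mul, hv, hw, zero_smul, zero_smul,
    zero_sub, zero_sub, mul_neg, neg_neg, mul_assoc]

theorem list_prod_contr_mul {a : ExteriorAlgebra ℂ M} {L : List (Module.Dual ℂ M)}
    (h : ∀ d ∈ L, ∀ z, contr d (a * z) = a * contr d z) (z : ExteriorAlgebra ℂ M) :
    ((L.map contr).prod : Module.End ℂ (ExteriorAlgebra ℂ M)) (a * z) =
      a * ((L.map contr).prod : Module.End ℂ (ExteriorAlgebra ℂ M)) z := by
  induction L with
  | nil => rfl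
  | cons d L ih =>
    rw [List.map_cons, List.prod_cons, Module.End.mul_apply, Module.End.mul_apply,
      ih fun d hd => h d (List.mem_cons_of_mem _ hd), h d List.mem_cons_self]

/-- Contractions anticommute, so an element killed by one of them stays killed after applying
others. -/
theorem contr_list_prod_contr {d : Module.Dual ℂ M} {z : ExteriorAlgebra ℂ M}
    (h : contr d z = 0) (L : List (Module.Dual ℂ M)) :
    contr d (((L.map contr).prod : Module.End ℂ (ExteriorAlgebra ℂ M)) z) = 0 := by
  induction L with
  | nil => exact h
  | cons d' L ih =>
    rw [List.map_cons, List.prod_cons, Module.End.mul_apply]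
    exact (CliffordAlgebra.contractLeft_comm _ _ _).trans (by rw [ih, map_zero, neg_zero])

theorem list_prod_contr_eq_zero {d : Module.Dual ℂ M} {z : ExteriorAlgebra ℂ M}
    (h : contr d z = 0) {L : List (Module.Dual ℂ M)} (hd : d ∈ L) :
    ((L.map contr).prod : Module.End ℂ (ExteriorAlgebra ℂ M)) z = 0 := by
  induction L with
  | nil => simp at hd
  | cons d' L ih =>
    rw [List.map_cons, List.prod_cons, Module.End.mul_apply]
    rcases List.mem_cons.mp hd with rfl | hd
    · exact contr_list_prod_contr h L
    · rw [ih hd, map_zero]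

theorem list_ofFn_two_mul_succ {α : Type*} (h : ℕ) (f : Fin (2 * (h + 1)) → α) : List.ofFn f =
    f ⟨0, by omega⟩ :: f ⟨1, by omega⟩ ::
      List.ofFn fun j : Fin (2 * h) => f ⟨j + 2, by omega⟩ := by
  change List.ofFn (n := 2 * h + 1 + 1) f = _
  rw [List.ofFn_succ, List.ofFn_succ]
  rfl

theorem list_prod_ι_eq (h : ℕ) (w : Fin (2 * h) → M) :
    (List.ofFn fun j => ExteriorAlgebra.ι ℂ (w j)).prod =
      EvenAlg.val M (∏ r : Fin h, EvenAlg.mul₂ (w ⟨2 * r, by omega⟩) (w ⟨2 * r + 1, by omega⟩)) := by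
  induction h with
  | zero => simp
  | succ h ih =>
    rw [list_ofFn_two_mul_succ, List.prod_cons, List.prod_cons, ← mul_assoc, ih (fun j => w ⟨j + 2, by omega⟩),
      Fin.prod_univ_succ, map_mul, EvenAlg.val_mul₂]
    rfl

/-- Induction on pairs. The later contractions act first and cross the leading pair. Then the second
contraction meets its vector behind the first one, which costs a sign, and the pair contributes `-a₀
a₁`. -/
theorem list_prod_contr_list_prod_ι (h : ℕ) (d : Fin (2 * h) → Module.Dual ℂ M)
    (v : Fin (2 * h) → M) (a : Fin (2 * h) → ℂ)
    (hd : ∀ j l, d j (v l) = if j = l then a j else 0) :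
    (((List.ofFn d).map contr).prod : Module.End ℂ (ExteriorAlgebra ℂ M))
      (List.ofFn fun j => ExteriorAlgebra.ι ℂ (v j)).prod =
        algebraMap ℂ _ ((-1) ^ h * ∏ j, a j) := by
  induction h with
  | zero => simp
  | succ h ih =>
    have hr := ih (fun j => d ⟨j + 2, by omega⟩) (fun j => v ⟨j + 2, by omega⟩)
      (fun j => a ⟨j + 2, by omega⟩) (fun j l => by rw [hd]; simp [Fin.ext_iff])
    have hp : ∏ j, a j = a ⟨0, by omega⟩ * (a ⟨1, by omega⟩ *
        ∏ j : Fin (2 * h), a ⟨j + 2, by omega⟩) := by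
      change ∏ j : Fin (2 * h + 1 + 1), a j = _
      rw [Fin.prod_univ_succ, Fin.prod_univ_succ]
      rfl
    have h10 : d ⟨1, by omega⟩ (v ⟨0, by omega⟩) = 0 := by rw [hd]; simp
    have h11 : d ⟨1, by omega⟩ (v ⟨1, by omega⟩) = a ⟨1, by omega⟩ := by rw [hd]; simp
    have h00 : d ⟨0, by omega⟩ (v ⟨0, by omega⟩) = a ⟨0, by omega⟩ := by rw [hd]; simp
    rw [list_ofFn_two_mul_succ h d,
      list_ofFn_two_mul_succ h fun j => ExteriorAlgebra.ι ℂ (v j), List.prod_cons, List.prod_cons, ← mul_assoc,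
      ← EvenAlg.val_mul₂, List.map_cons, List.map_cons, List.prod_cons, List.prod_cons,
      Module.End.mul_apply, Module.End.mul_apply, list_prod_contr_mul, hr, EvenAlg.val_mul₂,
      mul_assoc, contr_ι_mul, contr_ι_mul, h10, h11, hp]
    · have hc (r : ℂ) (d : Module.Dual ℂ M) : contr d (algebraMap ℂ _ r) = 0 :=
        CliffordAlgebra.contractLeft_algebraMap _ d r
      rw [hc, mul_zero, sub_zero, zero_smul, zero_sub, map_neg, Algebra.mul_smul_comm, map_smul,
        contr_ι_mul, hc, mul_zero, sub_zero, h00]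
      simp only [Algebra.algebraMap_eq_smul_one, smul_smul, ← neg_smul]
      congr 1
      ring
    · intro d' hd' z
      obtain ⟨j, rfl⟩ := (List.mem_ofFn' _ _).mp hd'
      refine contr_mul₂_mul ?_ ?_ z
      · exact (hd _ _).trans (if_neg (by rw [Fin.mk.injEq]; omega))
      · exact (hd _ _).trans (if_neg (by rw [Fin.mk.injEq]; omega))

/-! ### Berezin integration with odd parameters -/

variable {N : Type*} [AddCommGroup N] [Module ℂ N] {n : ℕ}

/-- The successive contractions with linear forms, followed by a substitution. -/
def berezinMap (d : Fin n → Module.Dual ℂ M) (g : M →ₗ[ℂ] N) :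
    ExteriorAlgebra ℂ M →ₗ[ℂ] ExteriorAlgebra ℂ N :=
  (ExteriorAlgebra.map g).toLinearMap ∘ₗ
    (((List.ofFn d).map contr).prod : Module.End ℂ (ExteriorAlgebra ℂ M))

theorem contr_map_mul {d : Module.Dual ℂ M} {f : N →ₗ[ℂ] M} (hf : ∀ x, d (f x) = 0)
    (x : EvenAlg N) (z : ExteriorAlgebra ℂ M) :
    contr d (EvenAlg.val M (EvenAlg.map f x) * z) =
      EvenAlg.val M (EvenAlg.map f x) * contr d z := by
  obtain ⟨x, hx⟩ := x
  change contr d (ExteriorAlgebra.map f x * z) = ExteriorAlgebra.map f x * contr d z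
  induction hx using Algebra.adjoin_induction generalizing z with
  | algebraMap r => rw [AlgHom.commutes, ← Algebra.smul_def, ← Algebra.smul_def, map_smul]
  | add _ _ _ _ h1 h2 => rw [map_add, add_mul, add_mul, map_add, h1, h2]
  | mul _ _ _ _ h1 h2 => rw [map_mul (ExteriorAlgebra.map f), mul_assoc, mul_assoc, h1, h2]
  | mem x h =>
    obtain ⟨a, c, rfl⟩ := h
    rw [map_mul (ExteriorAlgebra.map f), ExteriorAlgebra.map_apply_ι, ExteriorAlgebra.map_apply_ι]
    exact contr_mul₂_mul (hf a) (hf c) z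

/-- Linearity of the Berezin integral over the even functions of the parameters: contractions ignore
what comes from `N`, and `g` undoes `f`. -/
theorem berezinMap_map_mul {d : Fin n → Module.Dual ℂ M} {g : M →ₗ[ℂ] N} {f : N →ₗ[ℂ] M}
    (hf : ∀ j x, d j (f x) = 0) (hg : g ∘ₗ f = LinearMap.id) (x : EvenAlg N) (z : EvenAlg M) :
    berezinMap d g (EvenAlg.val M (EvenAlg.map f x * z)) =
      EvenAlg.val N x * berezinMap d g (EvenAlg.val M z) := by
  rw [berezinMap, LinearMap.comp_apply, LinearMap.comp_apply, map_mul, list_prod_contr_mul]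
  · rw [AlgHom.toLinearMap_apply, AlgHom.toLinearMap_apply, map_mul]
    congr 1
    rw [EvenAlg.val_map, ← AlgHom.comp_apply, ExteriorAlgebra.map_comp_map, hg,
      ExteriorAlgebra.map_id, AlgHom.id_apply]
  · intro d' hd' z
    obtain ⟨j, rfl⟩ := (List.mem_ofFn' _ _).mp hd'
    exact contr_map_mul (hf j) x z

/-- The product of a list of vectors grouped in pairs. -/
def pairProd (v : Fin n → M) (r : ℕ) (t : Fin (2 * r) → Fin n) : EvenAlg M :=
  ∏ l : Fin r, EvenAlg.mul₂ (v (t ⟨2 * l, by omega⟩)) (v (t ⟨2 * l + 1, by omega⟩))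

/-- Brings in the alternating map `ιMulti`, which supplies the signs of permutations and the
vanishing on repeated vectors. -/
theorem val_pairProd (v : Fin n → M) (r : ℕ) (t : Fin (2 * r) → Fin n) :
    EvenAlg.val M (pairProd v r t) = ExteriorAlgebra.ιMulti ℂ (2 * r) (v ∘ t) := by
  rw [ExteriorAlgebra.ιMulti_apply]
  exact (list_prod_ι_eq r (v ∘ t)).symm

theorem contr_list_prod_ι {d : Module.Dual ℂ M} {L : List M} (h : ∀ v ∈ L, d v = 0) :
    contr d (L.map (ExteriorAlgebra.ι ℂ)).prod = 0 := by
  induction L with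
  | nil => exact CliffordAlgebra.contractLeft_one _ d
  | cons v L ih =>
    rw [List.map_cons, List.prod_cons, contr_ι_mul, h v List.mem_cons_self, zero_smul, zero_sub,
      ih fun w hw => h w (List.mem_cons_of_mem _ hw), mul_zero, neg_zero]

/-- Either an index is missed, and the corresponding contraction kills the product, or an index is
repeated, and the product is already zero. This includes the case of a wrong degree, `2 * r ≠ n`. -/
theorem berezinMap_pairProd_eq_zero {d : Fin n → Module.Dual ℂ M} {v : Fin n → M} {a : Fin n → ℂ}
    (hd : ∀ j l, d j (v l) = if j = l then a j else 0) (g : M →ₗ[ℂ] N) {r : ℕ}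
    {t : Fin (2 * r) → Fin n} (ht : ¬ Function.Bijective t) :
    berezinMap d g (EvenAlg.val M (pairProd v r t)) = 0 := by
  rw [val_pairProd]
  by_cases hs : Function.Surjective t
  · have hi : ¬ Function.Injective t := fun hi => ht ⟨hi, hs⟩
    simp only [Function.Injective, not_forall] at hi
    obtain ⟨j, l, hjl, hne⟩ := hi
    rw [AlternatingMap.map_eq_zero_of_eq (i := j) (j := l) _ _ (congrArg v hjl) hne, map_zero]
  · simp only [Function.Surjective, not_forall, not_exists] at hs
    obtain ⟨j, hj⟩ := hs
    have h : contr (d j) (ExteriorAlgebra.ιMulti ℂ (2 * r) (v ∘ t)) = 0 := by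
      rw [ExteriorAlgebra.ιMulti_apply]
      have := contr_list_prod_ι (d := d j) (L := List.ofFn (v ∘ t)) fun w hw => by
        obtain ⟨l, rfl⟩ := (List.mem_ofFn' _ _).mp hw
        exact (hd _ _).trans (if_neg fun e => hj l e.symm)
      rwa [List.map_ofFn] at this
    rw [berezinMap, LinearMap.comp_apply,
      list_prod_contr_eq_zero h ((List.mem_ofFn' _ _).mpr ⟨j, rfl⟩), map_zero]

theorem berezinMap_pairProd_perm {h : ℕ} {d : Fin (2 * h) → Module.Dual ℂ M}
    {v : Fin (2 * h) → M} {a : Fin (2 * h) → ℂ}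
    (hd : ∀ j l, d j (v l) = if j = l then a j else 0) (g : M →ₗ[ℂ] N)
    (s : Equiv.Perm (Fin (2 * h))) :
    berezinMap d g (EvenAlg.val M (pairProd v h s)) =
      (Equiv.Perm.sign s : ℤ) • algebraMap ℂ _ ((-1) ^ h * ∏ j, a j) := by
  rw [val_pairProd, AlternatingMap.map_perm, Units.smul_def, map_zsmul,
    ExteriorAlgebra.ιMulti_apply, berezinMap, LinearMap.comp_apply,
    list_prod_contr_list_prod_ι h d v a hd, AlgHom.toLinearMap_apply, AlgHom.commutes]

theorem sum_fin_pairs {β : Type*} [AddCommMonoid β] (r : ℕ) (F : (Fin (2 * r) → Fin n) → β) :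
    ∑ p : Fin r → Fin n × Fin n,
      F (fun j => if (j : ℕ) % 2 = 0 then (p ⟨j / 2, by omega⟩).2 else (p ⟨j / 2, by omega⟩).1) =
        ∑ t, F t := by
  refine Fintype.sum_bijective _ (Function.bijective_iff_has_inverse.mpr
    ⟨fun (t : Fin (2 * r) → Fin n) (l : Fin r) => (t ⟨2 * l + 1, by omega⟩, t ⟨2 * l, by omega⟩), fun p => ?_, fun t => ?_⟩) _ _
    fun _ => rfl
  · funext l
    have h1 : (2 * (l : ℕ) + 1) % 2 = 1 := by omega
    have h2 : (2 * (l : ℕ)) % 2 = 0 := by omega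
    have h3 : (2 * (l : ℕ) + 1) / 2 = l := by omega
    have h4 : (2 * (l : ℕ)) / 2 = l := by omega
    simp only [h1, h2, h3, h4, one_ne_zero, if_false, if_true, Fin.eta, Prod.mk.eta]
  · funext j
    dsimp only
    split_ifs with hj
    · congr 1; ext; dsimp only; omega
    · congr 1; ext; dsimp only; omega

theorem sum_pow_eq (v : Fin n → M) (m : Matrix (Fin n) (Fin n) (EvenAlg M)) (r : ℕ) :
    (∑ j, ∑ l, m j l * EvenAlg.mul₂ (v l) (v j)) ^ r =
      ∑ t : Fin (2 * r) → Fin n,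
        (∏ l : Fin r, m (t ⟨2 * l + 1, by omega⟩) (t ⟨2 * l, by omega⟩)) * pairProd v r t := by
  rw [← Fintype.sum_prod_type', Fintype.sum_pow, ← sum_fin_pairs]
  refine Finset.sum_congr rfl fun p _ => ?_
  rw [pairProd, ← Finset.prod_mul_distrib]
  refine Finset.prod_congr rfl fun l _ => ?_
  have h1 : (2 * (l : ℕ) + 1) % 2 = 1 := by omega
  have h2 : (2 * (l : ℕ)) % 2 = 0 := by omega
  have h3 : (2 * (l : ℕ) + 1) / 2 = l := by omega
  have h4 : (2 * (l : ℕ)) / 2 = l := by omega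
  simp only [h1, h2, h3, h4, one_ne_zero, if_false, if_true, Fin.eta]

theorem pfaffian_two_mul {R : Type*} [CommRing R] [Algebra ℂ R] {h : ℕ}
    (m : Matrix (Fin (2 * h)) (Fin (2 * h)) R) :
    pfaffian m = ((2 ^ h * h.factorial : ℂ)⁻¹) • ∑ s : Equiv.Perm (Fin (2 * h)),
      ((Equiv.Perm.sign s : ℤˣ) : ℤ) •
        ∏ r : Fin h, m (s ⟨2 * r + 1, by omega⟩) (s ⟨2 * r, by omega⟩) := by
  have e : 2 * h / 2 = h := by omega
  rw [pfaffian, if_pos (even_two_mul h)]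
  simp only [e]
  congr 1
  refine Finset.sum_congr rfl fun s _ => ?_
  congr 1
  exact Fintype.prod_equiv (finCongr e) _ _ fun r => rfl

/-- The Berezin integral of the exponential of a quadratic expression is a Pfaffian. -/
theorem berezinMap_exp [FiniteDimensional ℂ M] {d : Fin n → Module.Dual ℂ M} {v : Fin n → M}
    {a : Fin n → ℂ} (hd : ∀ j l, d j (v l) = if j = l then a j else 0) {g : M →ₗ[ℂ] N}
    {f : N →ₗ[ℂ] M} (hf : ∀ j x, d j (f x) = 0) (hg : g ∘ₗ f = LinearMap.id)
    (m : Matrix (Fin n) (Fin n) (EvenAlg N)) (c : ℂ) :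
    berezinMap d g (EvenAlg.val M (IsNilpotent.exp
      (c • ∑ j, ∑ l, EvenAlg.map f (m j l) * EvenAlg.mul₂ (v l) (v j)))) =
        ((-2 * c) ^ (n / 2) * ∏ j, a j) • EvenAlg.val N (pfaffian m) := by
  have key (r : ℕ) : berezinMap d g (EvenAlg.val M
      ((∑ j, ∑ l, EvenAlg.map f (m j l) * EvenAlg.mul₂ (v l) (v j)) ^ r)) =
      ∑ t : Fin (2 * r) → Fin n,
        EvenAlg.val N (∏ l : Fin r, m (t ⟨2 * l + 1, by omega⟩) (t ⟨2 * l, by omega⟩)) *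
          berezinMap d g (EvenAlg.val M (pairProd v r t)) := by
    have := sum_pow_eq v (fun j l => EvenAlg.map f (m j l)) r
    rw [this, map_sum, map_sum]
    refine Finset.sum_congr rfl fun t _ => ?_
    rw [← map_prod, berezinMap_map_mul hf hg]
  set Q := ∑ j, ∑ l, EvenAlg.map f (m j l) * EvenAlg.mul₂ (v l) (v j) with hQ
  have hQ0 : ExteriorAlgebra.algebraMapInv (EvenAlg.val M Q) = 0 := by
    rw [hQ]
    simp only [map_sum, map_mul, EvenAlg.algebraMapInv_mul₂, mul_zero, Finset.sum_const_zero]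
  -- The exponent is enlarged by `n / 2 + 1` so that the degree `n / 2` surely lies in the range of
  -- summation.
  have hN : (c • Q) ^ (Module.finrank ℂ M + 1 + (n / 2 + 1)) = 0 := by
    rw [smul_pow, pow_add Q, EvenAlg.pow_eq_zero hQ0, zero_mul, smul_zero]
  -- Only the term of top degree survives `n` contractions.
  have hzero (r : ℕ) (hr : 2 * r ≠ n) : berezinMap d g (EvenAlg.val M (Q ^ r)) = 0 := by
    rw [key]
    refine Finset.sum_eq_zero fun t _ => ?_
    rw [berezinMap_pairProd_eq_zero hd, mul_zero]
    intro ht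
    exact hr (by simpa using Fintype.card_of_bijective ht)
  rw [exp_eq_sum_complex hN, map_sum, map_sum]
  simp only [smul_pow, map_smul]
  by_cases hn : Even n
  · obtain ⟨h, rfl⟩ := hn.two_dvd
    have e : 2 * h / 2 = h := by omega
    rw [Finset.sum_eq_single h (fun r _ hr => by rw [hzero r (by omega), smul_zero, smul_zero])
      (fun hh => absurd (Finset.mem_range.mpr (by omega)) hh), key, pfaffian_two_mul, e]
    -- Index functions that are not bijective contribute zero, so the sum runs over permutations.
    rw [← Fintype.sum_of_injective (fun s : Equiv.Perm (Fin (2 * h)) => (s : _ → _))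
      DFunLike.coe_injective (fun s => EvenAlg.val N (∏ l : Fin h,
        m (s ⟨2 * l + 1, by omega⟩) (s ⟨2 * l, by omega⟩)) *
          berezinMap d g (EvenAlg.val M (pairProd v h s))) _ (fun t ht => ?_) fun s => rfl]
    · simp only [berezinMap_pairProd_perm hd, map_smul, map_sum, map_zsmul, Finset.smul_sum]
      refine Finset.sum_congr rfl fun s _ => ?_
      rw [mul_smul_comm, ← Algebra.commutes, ← Algebra.smul_def,
        smul_comm _ (Equiv.Perm.sign s : ℤ), smul_comm _ (Equiv.Perm.sign s : ℤ),
        smul_comm _ (Equiv.Perm.sign s : ℤ), smul_comm _ (Equiv.Perm.sign s : ℤ)]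
      congr 1
      simp only [smul_smul]
      congr 1
      have : (h.factorial : ℂ) ≠ 0 := by exact_mod_cast h.factorial_ne_zero
      -- The constant is the product of `c^h / h!` from the exponential, `(-1)^h` from the
      -- contractions and `2^h h!` from the normalization of the Pfaffian.
      have e2 : (-2 * c) ^ h = (-1) ^ h * 2 ^ h * c ^ h := by
        rw [← mul_pow, ← mul_pow]; congr 1; ring
      rw [e2]
      field_simp
    · rw [berezinMap_pairProd_eq_zero hd, mul_zero]
      exact fun hb => ht ⟨Equiv.ofBijective t hb, rfl⟩
  · rw [pfaffian, if_neg hn, map_zero, smul_zero]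
    refine Finset.sum_eq_zero fun r _ => ?_
    rw [hzero r fun hr => hn (hr ▸ even_two_mul r), smul_zero, smul_zero]

end Berezin

/-! ### Gaussian integrals with nilpotent sources -/

section Gaussian

open MeasureTheory

theorem integrable_gaussian_mul_pow {b : ℂ} (hb : 0 < b.re) (d : ℕ) :
    Integrable fun y : ℝ => Complex.exp (-b * (y : ℂ) ^ 2) * (y : ℂ) ^ d := by
  have h := integrable_rpow_mul_exp_neg_mul_sq hb (s := d)
    (lt_of_lt_of_le neg_one_lt_zero d.cast_nonneg)
  refine h.norm.mono' (by fun_prop) (Filter.Eventually.of_forall fun y => ?_)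
  have e : (-b * (y : ℂ) ^ 2).re = -b.re * y ^ 2 := by
    rw [← Complex.ofReal_pow, Complex.re_mul_ofReal, Complex.neg_re]
  rw [norm_mul, norm_mul, Complex.norm_exp, Real.rpow_natCast, norm_pow, norm_pow,
    Complex.norm_real, e, Real.norm_of_nonneg (Real.exp_nonneg _), mul_comm]

theorem hasDerivAt_gaussian (b : ℂ) (y : ℝ) :
    HasDerivAt (fun y : ℝ => Complex.exp (-b * (y : ℂ) ^ 2))
      (Complex.exp (-b * (y : ℂ) ^ 2) * (-b * (2 * y))) y := by
  have h : HasDerivAt (fun z : ℂ => Complex.exp (-b * z ^ 2))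
      (Complex.exp (-b * (y : ℂ) ^ 2) * (-b * (2 * y))) (y : ℂ) := by
    have := (((hasDerivAt_id (y : ℂ)).pow 2).const_mul (-b)).cexp
    simpa using this
  exact h.comp_ofReal

/-- The moments of a complex Gaussian. -/
def gaussMoment (b : ℂ) (d : ℕ) : ℂ := ∫ y : ℝ, Complex.exp (-b * (y : ℂ) ^ 2) * (y : ℂ) ^ d

theorem gaussMoment_zero {b : ℂ} (hb : 0 < b.re) :
    gaussMoment b 0 = ((Real.pi : ℂ) / b) ^ (1 / 2 : ℂ) := by
  simpa [gaussMoment] using integral_gaussian_complex hb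

theorem gaussMoment_one {b : ℂ} (hb : 0 < b.re) : gaussMoment b 1 = 0 := by
  have hb0 : b ≠ 0 := by rintro rfl; simp at hb
  have h := integral_eq_zero_of_hasDerivAt_of_integrable (hasDerivAt_gaussian b)
    (((integrable_gaussian_mul_pow hb 1).const_mul (-2 * b)).congr
      (Filter.Eventually.of_forall fun y => by ring))
    ((integrable_gaussian_mul_pow hb 0).congr (Filter.Eventually.of_forall fun y => by simp))
  have e : ∀ y : ℝ, Complex.exp (-b * (y : ℂ) ^ 2) * (-b * (2 * y)) =
      (-2 * b) * (Complex.exp (-b * (y : ℂ) ^ 2) * (y : ℂ) ^ 1) := fun y => by ring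
  simp only [e, integral_const_mul] at h
  exact (mul_eq_zero.mp h).resolve_left (by simp [hb0])

/-- Integration by parts: the derivative of `exp(-b y²) y^(d+1)` has integral zero. -/
theorem gaussMoment_add_two {b : ℂ} (hb : 0 < b.re) (d : ℕ) :
    gaussMoment b (d + 2) = (d + 1) / (2 * b) * gaussMoment b d := by
  have hb0 : b ≠ 0 := by rintro rfl; simp at hb
  have h1 := (integrable_gaussian_mul_pow hb d).const_mul ((d : ℂ) + 1)
  have h2 := (integrable_gaussian_mul_pow hb (d + 2)).const_mul (2 * b)
  have e (y : ℝ) : Complex.exp (-b * (y : ℂ) ^ 2) * (-b * (2 * y)) * (y : ℂ) ^ (d + 1) +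
      Complex.exp (-b * (y : ℂ) ^ 2) * (((d + 1 : ℕ) : ℂ) * (y : ℂ) ^ d) =
      ((d : ℂ) + 1) * (Complex.exp (-b * (y : ℂ) ^ 2) * (y : ℂ) ^ d) -
        (2 * b) * (Complex.exp (-b * (y : ℂ) ^ 2) * (y : ℂ) ^ (d + 2)) := by
    push_cast; ring
  have h := integral_eq_zero_of_hasDerivAt_of_integrable
    (f := fun y : ℝ => Complex.exp (-b * (y : ℂ) ^ 2) * (y : ℂ) ^ (d + 1))
    (fun y => (hasDerivAt_gaussian b y).mul
      (by simpa using ((hasDerivAt_id (y : ℂ)).pow (d + 1)).comp_ofReal))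
    ((h1.sub h2).congr (Filter.Eventually.of_forall fun y => (e y).symm))
    (integrable_gaussian_mul_pow hb (d + 1))
  rw [integral_congr_ae (Filter.Eventually.of_forall e), integral_sub h1 h2, integral_const_mul,
    integral_const_mul, sub_eq_zero] at h
  rw [gaussMoment, gaussMoment, div_mul_eq_mul_div, h]
  field_simp

theorem gaussMoment_odd {b : ℂ} (hb : 0 < b.re) (j : ℕ) : gaussMoment b (2 * j + 1) = 0 := by
  induction j with
  | zero => exact gaussMoment_one hb
  | succ j ih => rw [show 2 * (j + 1) + 1 = 2 * j + 1 + 2 by ring, gaussMoment_add_two hb, ih,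
      mul_zero]

theorem gaussMoment_even {b : ℂ} (hb : 0 < b.re) (j : ℕ) :
    gaussMoment b (2 * j) * (j.factorial * (4 * b) ^ j) =
      (2 * j).factorial * gaussMoment b 0 := by
  have hb0 : b ≠ 0 := by rintro rfl; simp at hb
  induction j with
  | zero => simp
  | succ j ih =>
    rw [show 2 * (j + 1) = 2 * j + 2 by ring, gaussMoment_add_two hb]
    simp only [Nat.factorial_succ]
    push_cast
    rw [show ((2 * (j : ℂ) + 1 + 1) * ((2 * j + 1) * (2 * j).factorial)) * gaussMoment b 0 =
      (2 * (j : ℂ) + 1 + 1) * (2 * j + 1) * ((2 * j).factorial * gaussMoment b 0) by ring, ← ih]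
    field_simp
    ring

variable {R : Type*} [CommRing R] [Algebra ℂ R] [Module ℚ R]

/-- Completing the square with a nilpotent source: odd moments vanish, and the even ones turn the
exponential series of `u` into that of `u² / (4b)`. The even truncation order groups the terms by
two. -/
theorem sum_gaussMoment {b : ℂ} (hb : 0 < b.re) {N : ℕ} {u : R} (hu : u ^ (2 * N) = 0) :
    ∑ d ∈ Finset.range (2 * N), gaussMoment b d • ((d.factorial : ℂ)⁻¹ • u ^ d) =
      gaussMoment b 0 • IsNilpotent.exp ((4 * b)⁻¹ • u ^ 2) := by
  have hb0 : b ≠ 0 := by rintro rfl; simp at hb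
  have split (f : ℕ → R) (N : ℕ) : ∑ d ∈ Finset.range (2 * N), f d =
      ∑ j ∈ Finset.range N, (f (2 * j) + f (2 * j + 1)) := by
    induction N with
    | zero => simp
    | succ N ih => rw [Finset.sum_range_succ, ← ih, show 2 * (N + 1) = 2 * N + 1 + 1 by ring,
        Finset.sum_range_succ, Finset.sum_range_succ, add_assoc]
  have hN : ((4 * b)⁻¹ • u ^ 2) ^ N = 0 := by rw [smul_pow, ← pow_mul, hu, smul_zero]
  rw [split, exp_eq_sum_complex hN, Finset.smul_sum]
  refine Finset.sum_congr rfl fun j _ => ?_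
  rw [gaussMoment_odd hb, zero_smul, add_zero, smul_pow, ← pow_mul, smul_smul, smul_smul,
    smul_smul]
  congr 1
  have h1 : (j.factorial : ℂ) ≠ 0 := by exact_mod_cast j.factorial_ne_zero
  have h2 : ((2 * j).factorial : ℂ) ≠ 0 := by exact_mod_cast (2 * j).factorial_ne_zero
  have h := gaussMoment_even hb j
  rw [inv_pow]
  field_simp
  linear_combination h

variable {E : Type*} [NormedAddCommGroup E] [NormedSpace ℂ E] [CompleteSpace E]
  {α : Type*} [Fintype α] [DecidableEq α]

theorem exists_pow_eq_zero {u : α → R} (hu : ∀ j, IsNilpotent (u j)) :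
    ∃ N, ∀ j, u j ^ N = 0 := by
  choose m hm using hu
  exact ⟨∑ j, m j, fun j => pow_eq_zero_of_le (Finset.single_le_sum (f := m)
    (fun _ _ => Nat.zero_le _) (Finset.mem_univ j)) (hm j)⟩

theorem gaussian_smul_exp_eq (b : α → ℂ) {N : ℕ} {u : α → R} (hu : ∀ j, u j ^ N = 0)
    (L : R →ₗ[ℂ] E) (y : α → ℝ) :
    Complex.exp (-∑ j, b j * (y j : ℂ) ^ 2) • L (IsNilpotent.exp (∑ j, (y j : ℂ) • u j)) =
      ∑ δ ∈ Fintype.piFinset fun _ : α => Finset.range N,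
        (∏ j, Complex.exp (-b j * (y j : ℂ) ^ 2) * (y j : ℂ) ^ δ j) •
          L (∏ j, ((δ j).factorial : ℂ)⁻¹ • u j ^ δ j) := by
  rw [exp_sum_smul hu, map_sum, Finset.smul_sum]
  refine Finset.sum_congr rfl fun δ _ => ?_
  rw [map_smul, smul_smul, Finset.prod_mul_distrib, ← Complex.exp_sum, ← Finset.sum_neg_distrib]
  simp only [neg_mul]

/-- The integrand is a finite sum of products of one-variable Gaussian moments, so integration may
be done termwise and variable by variable, after which the exponential is reassembled. -/
theorem integral_gaussian_exp {b : α → ℂ} (hb : ∀ j, 0 < (b j).re) {u : α → R}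
    (hu : ∀ j, IsNilpotent (u j)) (L : R →ₗ[ℂ] E) :
    ∫ y : α → ℝ, Complex.exp (-∑ j, b j * (y j : ℂ) ^ 2) •
      L (IsNilpotent.exp (∑ j, (y j : ℂ) • u j)) =
        (∏ j, ((Real.pi : ℂ) / b j) ^ (1 / 2 : ℂ)) •
          L (IsNilpotent.exp (∑ j, (4 * b j)⁻¹ • u j ^ 2)) := by
  obtain ⟨N, hN⟩ := exists_pow_eq_zero hu
  have hN2 (j : α) : u j ^ (2 * N) = 0 := pow_eq_zero_of_le (by omega) (hN j)
  simp only [gaussian_smul_exp_eq b hN2 L]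
  rw [integral_finsetSum _ fun δ _ => (Integrable.fintype_prod
    (f := fun j (y : ℝ) => Complex.exp (-b j * (y : ℂ) ^ 2) * (y : ℂ) ^ δ j)
    fun j => integrable_gaussian_mul_pow (hb j) _).smul_const _]
  have h (δ : α → ℕ) : ∫ y : α → ℝ, (∏ j, Complex.exp (-b j * (y j : ℂ) ^ 2) * (y j : ℂ) ^ δ j) •
      L (∏ j, ((δ j).factorial : ℂ)⁻¹ • u j ^ δ j) =
      L (∏ j, gaussMoment (b j) (δ j) • (((δ j).factorial : ℂ)⁻¹ • u j ^ δ j)) := by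
    rw [integral_smul_const, integral_fintype_prod_volume_eq_prod
      (fun j (y : ℝ) => Complex.exp (-b j * (y : ℂ) ^ 2) * (y : ℂ) ^ δ j), ← map_smul,
      ← Finset.prod_smul]
    rfl
  simp only [h]
  rw [← map_sum, ← Finset.prod_univ_sum (fun _ => Finset.range (2 * N))
    fun j d => gaussMoment (b j) d • (((d).factorial : ℂ)⁻¹ • u j ^ d)]
  simp only [sum_gaussMoment (hb _) (hN2 _)]
  rw [Finset.prod_smul, map_smul, ← exp_sum]
  · simp only [gaussMoment_zero (hb _)]
  · exact fun j => ⟨N, by rw [smul_pow, ← pow_mul, hN2, smul_zero]⟩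

/-! ### Reduction to principal axes -/

theorem measurePreserving_orthogonal {O : Matrix α α ℝ} (hO : O.transpose * O = 1) :
    MeasurePreserving (Matrix.toLin' O) (volume : Measure (α → ℝ)) volume := by
  have hdet : O.det ^ 2 = 1 := by
    have := congrArg Matrix.det hO
    rwa [Matrix.det_mul, Matrix.det_transpose, Matrix.det_one, ← sq] at this
  have h0 : O.det ≠ 0 := by rintro h; rw [h] at hdet; simp at hdet
  have h1 : |O.det⁻¹| = 1 := by
    rw [abs_inv, inv_eq_one, ← sq_eq_sq₀ (abs_nonneg _) zero_le_one, sq_abs, hdet, one_pow]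
  refine ⟨(LinearMap.continuous_of_finiteDimensional _).measurable, ?_⟩
  rw [Real.map_matrix_volume_pi_eq_smul_volume_pi h0, h1, ENNReal.ofReal_one, one_smul]

theorem measurableEmbedding_orthogonal {O : Matrix α α ℝ} (hO : O.transpose * O = 1) :
    MeasurableEmbedding (Matrix.toLin' O) := by
  refine (LinearMap.continuous_of_finiteDimensional (Matrix.toLin' O)).measurableEmbedding
    (Function.LeftInverse.injective (g := Matrix.toLin' O.transpose) fun y => ?_)
  rw [← Matrix.toLin'_mul_apply, hO, Matrix.toLin'_one, LinearMap.id_apply]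

/-- The quadratic form of a real matrix. -/
def quadSum (S : Matrix α α ℝ) (x : α → ℝ) : ℝ := ∑ r, ∑ s, x r * S r s * x s

theorem quadSum_eq (S : Matrix α α ℝ) (x : α → ℝ) :
    quadSum S x = x ⬝ᵥ S.mulVec x := by
  simp only [quadSum, dotProduct, Matrix.mulVec, Finset.mul_sum, mul_assoc]

theorem quadSum_rotate {S O : Matrix α α ℝ} {l : α → ℝ} (hO : O.transpose * O = 1)
    (hS : S = O * Matrix.diagonal l * O.transpose) (y : α → ℝ) :
    quadSum S (Matrix.toLin' O y) = ∑ j, l j * y j ^ 2 := by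
  rw [quadSum_eq, Matrix.toLin'_apply, hS, Matrix.mulVec_mulVec, Matrix.mul_assoc, hO,
    Matrix.mul_one, ← Matrix.mulVec_mulVec, Matrix.dotProduct_mulVec, ← Matrix.mulVec_transpose,
    Matrix.mulVec_mulVec, hO, Matrix.one_mulVec]
  simp only [dotProduct, Matrix.mulVec_diagonal]
  exact Finset.sum_congr rfl fun j _ => by ring

theorem sum_sq_rotate {O : Matrix α α ℝ} (hO : O.transpose * O = 1) (y : α → ℝ) :
    ∑ r, Matrix.toLin' O y r ^ 2 = ∑ j, y j ^ 2 := by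
  have h := quadSum_rotate (S := 1) (l := 1) hO
    (by rw [Matrix.diagonal_one', Matrix.mul_one, mul_eq_one_comm.mp hO]) y
  simpa [quadSum_eq, dotProduct, sq] using h

/-- The complex symmetric matrix of the regularized quadratic form. -/
def regMatrix (i : ℂ) (S : Matrix α α ℝ) (ε : ℝ) : Matrix α α ℂ :=
  (2 * ε : ℂ) • 1 + i • S.map Complex.ofReal

/-- The regularized exponent is `-½ xᵀ(2ε + iS)x`, whence the coefficient 2 of `ε`. The orthogonal
matrix that diagonalizes `S` also diagonalizes this matrix. -/
theorem regMatrix_eq {i : ℂ} {S O : Matrix α α ℝ} {l : α → ℝ} (hO : O.transpose * O = 1)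
    (hS : S = O * Matrix.diagonal l * O.transpose) (ε : ℝ) :
    regMatrix i S ε = O.map Complex.ofReal *
      Matrix.diagonal (fun j => (2 * ε + i * l j : ℂ)) * (O.map Complex.ofReal).transpose := by
  have hO' : O * O.transpose = 1 := mul_eq_one_comm.mp hO
  have h1 : O.map Complex.ofReal * (O.map Complex.ofReal).transpose = 1 := by
    have := congrArg (fun M : Matrix α α ℝ => M.map Complex.ofRealHom) hO'
    simp only [Matrix.map_mul, Matrix.map_one, map_zero, map_one] at this
    exact this
  have h2 : S.map Complex.ofReal = O.map Complex.ofReal *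
      Matrix.diagonal (fun j => (l j : ℂ)) * (O.map Complex.ofReal).transpose := by
    have := congrArg (fun M : Matrix α α ℝ => M.map Complex.ofRealHom) hS
    simp only [Matrix.map_mul, Matrix.diagonal_map, map_zero] at this
    exact this
  have h3 : Matrix.diagonal (fun j => (2 * ε + i * l j : ℂ)) =
      (2 * ε : ℂ) • 1 + i • Matrix.diagonal (fun j => (l j : ℂ)) := by
    ext r s
    by_cases h : r = s
    · subst h; simp
    · simp [h]
  rw [regMatrix, h2, h3, Matrix.mul_add, Matrix.add_mul, Matrix.mul_smul, Matrix.mul_smul,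
    Matrix.smul_mul, Matrix.smul_mul, Matrix.mul_one, h1]

theorem regMatrix_inv {i : ℂ} {S O : Matrix α α ℝ} {l : α → ℝ} (hO : O.transpose * O = 1)
    (hS : S = O * Matrix.diagonal l * O.transpose) {ε : ℝ}
    (h0 : ∀ j, (2 * ε + i * l j : ℂ) ≠ 0) :
    (regMatrix i S ε)⁻¹ = O.map Complex.ofReal *
      Matrix.diagonal (fun j => (2 * ε + i * l j : ℂ)⁻¹) * (O.map Complex.ofReal).transpose := by
  have h1 : (O.map Complex.ofReal).transpose * O.map Complex.ofReal = 1 := by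
    have := congrArg (fun M : Matrix α α ℝ => M.map Complex.ofRealHom) hO
    simp only [Matrix.map_mul, Matrix.map_one, map_zero, map_one] at this
    exact this
  have h2 := mul_eq_one_comm.mp h1
  refine Matrix.inv_eq_left_inv ?_
  rw [regMatrix_eq hO hS]
  have h3 : Matrix.diagonal (fun j => (2 * ε + i * l j : ℂ)⁻¹) *
      Matrix.diagonal (fun j => (2 * ε + i * l j : ℂ)) = 1 := by
    rw [Matrix.diagonal_mul_diagonal, ← Matrix.diagonal_one]
    congr 1
    funext j
    exact inv_mul_cancel₀ (h0 j)
  calc _ = O.map Complex.ofReal * (Matrix.diagonal (fun j => (2 * ε + i * l j : ℂ)⁻¹) *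
        (((O.map Complex.ofReal).transpose * O.map Complex.ofReal) *
        Matrix.diagonal (fun j => (2 * ε + i * l j : ℂ)))) * (O.map Complex.ofReal).transpose := by
        simp only [Matrix.mul_assoc]
    _ = 1 := by rw [h1, Matrix.one_mul, h3, Matrix.mul_one, h2]

theorem det_regMatrix {i : ℂ} {S O : Matrix α α ℝ} {l : α → ℝ} (hO : O.transpose * O = 1)
    (hS : S = O * Matrix.diagonal l * O.transpose) (ε : ℝ) :
    (regMatrix i S ε).det = ∏ j, (2 * ε + i * l j : ℂ) := by
  have h1 : (O.map Complex.ofReal).transpose * O.map Complex.ofReal = 1 := by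
    have := congrArg (fun M : Matrix α α ℝ => M.map Complex.ofRealHom) hO
    simp only [Matrix.map_mul, Matrix.map_one, map_zero, map_one] at this
    exact this
  rw [regMatrix_eq hO hS, Matrix.det_mul_comm, ← Matrix.mul_assoc, h1, Matrix.one_mul,
    Matrix.det_diagonal]

theorem exists_diagonalization {S : Matrix α α ℝ} (hS : S.transpose = S) :
    ∃ (O : Matrix α α ℝ) (l : α → ℝ), O.transpose * O = 1 ∧
      S = O * Matrix.diagonal l * O.transpose := by
  have hH : S.IsHermitian := by
    rw [Matrix.IsHermitian, Matrix.conjTranspose_eq_transpose_of_trivial, hS]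
  refine ⟨hH.eigenvectorUnitary, hH.eigenvalues, ?_, ?_⟩
  · have := Matrix.mem_unitaryGroup_iff'.mp hH.eigenvectorUnitary.2
    rwa [Matrix.star_eq_conjTranspose, Matrix.conjTranspose_eq_transpose_of_trivial] at this
  · have := hH.spectral_theorem
    rw [Unitary.conjStarAlgAut_apply] at this
    simpa [Matrix.star_eq_conjTranspose, Matrix.conjTranspose_eq_transpose_of_trivial,
      Function.comp_def] using this

variable {i : ℂ} {S O : Matrix α α ℝ} {l : α → ℝ} {u : α → R}

theorem re_eq_zero_of_sq (hi : i ^ 2 = -1) : i.re = 0 := by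
  have h1 := congrArg Complex.re hi
  have h2 := congrArg Complex.im hi
  simp only [sq, Complex.mul_re, Complex.mul_im, Complex.neg_re, Complex.one_re, Complex.neg_im,
    Complex.one_im, neg_zero] at h1 h2
  have : i.re * i.im = 0 := by linarith
  rcases mul_eq_zero.mp this with h | h
  · exact h
  · rw [h] at h1; nlinarith [sq_nonneg i.re]

/-- `i` is purely imaginary, so the oscillating part does not affect the damping. -/
theorem regularized_re_pos (hi : i ^ 2 = -1) {ε : ℝ} (hε : 0 < ε) (t : ℝ) :
    0 < (ε + i / 2 * t : ℂ).re := by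
  have : (i / 2 * t : ℂ).re = 0 := by
    rw [show (i / 2 * t : ℂ) = i * ((t / 2 : ℝ) : ℂ) by push_cast; ring, Complex.re_mul_ofReal,
      re_eq_zero_of_sq hi, zero_mul]
  rw [Complex.add_re, this, Complex.ofReal_re, add_zero]
  exact hε

/-- Under `x = Oy` the damping term is unchanged, the phase becomes diagonal, and the sources are
combined along the columns of `O`. -/
theorem gaussian_form_rotate (hO : O.transpose * O = 1)
    (hS : S = O * Matrix.diagonal l * O.transpose) (ε : ℝ) (L : R →ₗ[ℂ] E) (y : α → ℝ) :
    Complex.exp (-(ε * ∑ r, (Matrix.toLin' O y r : ℂ) ^ 2) -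
        i / 2 * quadSum S (Matrix.toLin' O y)) •
      L (IsNilpotent.exp (∑ r, (Matrix.toLin' O y r : ℂ) • u r)) =
    Complex.exp (-∑ j, (ε + i / 2 * l j : ℂ) * (y j : ℂ) ^ 2) •
      L (IsNilpotent.exp (∑ j, (y j : ℂ) • ∑ r, (O r j : ℂ) • u r)) := by
  have h1 : ∑ r, (Matrix.toLin' O y r : ℂ) ^ 2 = ∑ j, (y j : ℂ) ^ 2 := by
    exact_mod_cast congrArg (Complex.ofReal) (sum_sq_rotate hO y)
  have h2 : ∑ r, (Matrix.toLin' O y r : ℂ) • u r =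
      ∑ j, (y j : ℂ) • ∑ r, (O r j : ℂ) • u r := by
    simp only [Matrix.toLin'_apply, Matrix.mulVec, dotProduct, Complex.ofReal_sum,
      Complex.ofReal_mul, Finset.sum_smul, Finset.smul_sum, smul_smul]
    rw [Finset.sum_comm]
    exact Finset.sum_congr rfl fun _ _ => Finset.sum_congr rfl fun _ _ => by rw [mul_comm]
  rw [h1, h2, quadSum_rotate hO hS]
  congr 2
  push_cast
  simp only [add_mul, Finset.sum_add_distrib, Finset.mul_sum, mul_assoc]
  ring

theorem isNilpotent_combination (hu : ∀ j, IsNilpotent (u j)) (c : α → ℂ) :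
    IsNilpotent (∑ r, c r • u r) :=
  isNilpotent_sum fun r _ => (hu r).smul (c r)

/-- The regularized Gaussian integral with nilpotent sources. -/
theorem integral_gaussian_form (hi : i ^ 2 = -1) (hO : O.transpose * O = 1)
    (hS : S = O * Matrix.diagonal l * O.transpose)
    (hu : ∀ j, IsNilpotent (u j)) {ε : ℝ} (hε : 0 < ε) (L : R →ₗ[ℂ] E) :
    ∫ x : α → ℝ, Complex.exp (-(ε * ∑ r, (x r : ℂ) ^ 2) - i / 2 * quadSum S x) •
      L (IsNilpotent.exp (∑ r, (x r : ℂ) • u r)) =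
    (∏ j, ((Real.pi : ℂ) / (ε + i / 2 * l j)) ^ (1 / 2 : ℂ)) •
      L (IsNilpotent.exp (∑ r, ∑ s, ((1 / 2 : ℂ) * (regMatrix i S ε)⁻¹ r s) • (u r * u s))) := by
  rw [← (measurePreserving_orthogonal hO).integral_comp (measurableEmbedding_orthogonal hO)]
  simp only [gaussian_form_rotate hO hS]
  rw [integral_gaussian_exp (fun j => regularized_re_pos hi hε (l j))
    (fun j => isNilpotent_combination hu _) L]
  have h0 (j : α) : (2 * ε + i * l j : ℂ) ≠ 0 := fun h => by
    have h' := regularized_re_pos hi hε (l j)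
    rw [show (ε + i / 2 * l j : ℂ) = (2 * ε + i * l j) / 2 by ring, h] at h'
    simp at h'
  congr 3
  rw [regMatrix_inv hO hS h0]
  -- The one-variable factor `1/(4(ε + iλ/2))` is half of `1/(2ε + iλ)`; the sum over the axes then
  -- rebuilds the entries of the inverse matrix.
  have h1 (j : α) : (4 * (ε + i / 2 * l j : ℂ))⁻¹ • (∑ r, (O r j : ℂ) • u r) ^ 2 =
      ∑ r, ∑ s, ((1 / 2 : ℂ) * (O r j * (2 * ε + i * l j : ℂ)⁻¹ * O s j)) • (u r * u s) := by
    rw [sq, Finset.sum_mul_sum, Finset.smul_sum]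
    refine Finset.sum_congr rfl fun r _ => ?_
    rw [Finset.smul_sum]
    refine Finset.sum_congr rfl fun s _ => ?_
    rw [smul_mul_smul_comm, smul_smul,
      show (4 * (ε + i / 2 * l j) : ℂ) = 2 * (2 * ε + i * l j) by ring, mul_inv]
    congr 1
    ring
  have h2 (r s : α) : (O.map Complex.ofReal * Matrix.diagonal (fun j => (2 * ε + i * l j : ℂ)⁻¹) *
      (O.map Complex.ofReal).transpose) r s = ∑ j, O r j * (2 * ε + i * l j : ℂ)⁻¹ * O s j := by
    rw [Matrix.mul_apply]
    simp only [Matrix.mul_diagonal, Matrix.map_apply, Matrix.transpose_apply]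
  simp only [h1, h2, Finset.mul_sum, Finset.sum_smul]
  rw [Finset.sum_comm]
  exact Finset.sum_congr rfl fun r _ => Finset.sum_comm

end Gaussian

/-! ### Oscillatory integrals with quadratic phase -/

section Oscillatory

open MeasureTheory

variable {α : Type*} [Fintype α] [DecidableEq α]
  {W : Type*} [NormedAddCommGroup W] [NormedSpace ℝ W] [FiniteDimensional ℝ W]
  [MeasurableSpace W] [BorelSpace W]
  {E : Type*} [NormedAddCommGroup E] [NormedSpace ℂ E]

theorem eq_im_mul_I {i : ℂ} (hi : i ^ 2 = -1) : i = i.im * Complex.I := by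
  apply Complex.ext <;> simp [re_eq_zero_of_sq hi]

theorem abs_im_eq_one {i : ℂ} (hi : i ^ 2 = -1) : |i.im| = 1 := by
  have h1 := congrArg Complex.re hi
  simp only [sq, Complex.mul_re, re_eq_zero_of_sq hi, Complex.neg_re, Complex.one_re, mul_zero,
    zero_sub, neg_inj] at h1
  have : i.im ^ 2 = 1 := by rw [sq, h1]
  rw [← sq_eq_sq₀ (abs_nonneg _) zero_le_one, sq_abs, this, one_pow]

theorem norm_cexp_phase {i : ℂ} (hi : i ^ 2 = -1) (t : ℝ) : ‖Complex.exp (-(i / 2) * t)‖ = 1 := by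
  rw [eq_im_mul_I hi, show (-(i.im * Complex.I / 2) * t : ℂ) = ((-(i.im / 2 * t) : ℝ) : ℂ) *
    Complex.I by push_cast; ring, Complex.norm_exp_ofReal_mul_I]

/-- The Fourier integral `∫ exp(-(i/2) ∑ x_r S_{rs}(X) x_s) φ(X) dν(X)`. -/
def oscIntegral (i : ℂ) (ν : Measure W) (S : α → α → W →L[ℝ] ℝ) (φ : W → E) (x : α → ℝ) : E :=
  ∫ X, Complex.exp (-(i / 2) * (quadSum (fun r s => S r s X) x : ℝ)) • φ X ∂ν

/-- The frequency at which `oscIntegral` is a Fourier transform. -/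
def oscFrequency (i : ℂ) (S : α → α → W →L[ℝ] ℝ) (x : α → ℝ) : W →L[ℝ] ℝ :=
  (i.im / (4 * Real.pi)) • ∑ r, ∑ s, (x r * x s) • S r s

theorem oscFrequency_apply (i : ℂ) (S : α → α → W →L[ℝ] ℝ) (x : α → ℝ) (X : W) :
    oscFrequency i S x X = i.im / (4 * Real.pi) * quadSum (fun r s => S r s X) x := by
  simp only [oscFrequency, quadSum, smul_apply, sum_apply,
    smul_eq_mul]
  congr 1
  exact Finset.sum_congr rfl fun _ _ => Finset.sum_congr rfl fun _ _ => by ring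

theorem continuous_oscFrequency (i : ℂ) (S : α → α → W →L[ℝ] ℝ) :
    Continuous (oscFrequency i S) := by
  unfold oscFrequency
  fun_prop

variable (W) in
/-- The evaluation pairing of a space with its dual. -/
def evalPairing : W →L[ℝ] (W →L[ℝ] ℝ) →L[ℝ] ℝ :=
  ContinuousLinearMap.flip (.id ℝ (W →L[ℝ] ℝ))

/-- `i` is `±I`, with sign `i.im`, and the Fourier character carries `2π`; so `i/2` becomes the
factor `i.im / (4π)` in the frequency. -/
theorem oscIntegral_eq_fourierIntegral {i : ℂ} (hi : i ^ 2 = -1) (ν : Measure W)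
    (S : α → α → W →L[ℝ] ℝ) (φ : W → E) (x : α → ℝ) :
    oscIntegral i ν S φ x = VectorFourier.fourierIntegral Real.fourierChar ν
      (evalPairing W).toLinearMap₁₂ φ (oscFrequency i S x) := by
  refine integral_congr_ae (Filter.Eventually.of_forall fun X => ?_)
  change _ = Real.fourierChar (-(oscFrequency i S x X)) • φ X
  rw [oscFrequency_apply, Circle.smul_def, Real.fourierChar_apply]
  dsimp only
  congr 2
  rw [eq_im_mul_I hi]
  push_cast
  have : (Real.pi : ℂ) ≠ 0 := by exact_mod_cast Real.pi_ne_zero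
  simp only [Complex.mul_im, Complex.ofReal_im, Complex.ofReal_re, Complex.I_re, Complex.I_im]
  field_simp
  push_cast
  ring

variable {i : ℂ} {ν : Measure W} [ν.IsAddHaarMeasure] {S : α → α → W →L[ℝ] ℝ} {φ : W → E}

theorem continuous_oscIntegral (hi : i ^ 2 = -1) (hφ : Integrable φ ν) :
    Continuous (oscIntegral i ν S φ) := by
  simp only [funext (oscIntegral_eq_fourierIntegral hi ν S φ)]
  refine (VectorFourier.fourierIntegral_continuous Real.continuous_fourierChar ?_ hφ).comp
    (continuous_oscFrequency i S)
  exact (evalPairing W).continuous₂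

/-- Differentiating `φ` in the direction `Y` multiplies the Fourier transform by the frequency at
`Y`, up to a constant. By the choice of `Y` this frequency is `±|x|²/(4π)`, so one direction
controls all of `x`-space. -/
theorem exists_pow_mul_norm_oscIntegral_le (hi : i ^ 2 = -1) (hφ : ContDiff ℝ ∞ φ)
    (hc : HasCompactSupport φ) {Y : W} (hY : ∀ r s, S r s Y = if r = s then 1 else 0) (N : ℕ) :
    ∃ C, ∀ x, (∑ r, x r ^ 2) ^ N * ‖oscIntegral i ν S φ x‖ ≤ C := by
  have hint (a m : ℕ) (ha : (a : ℕ∞) ≤ ⊤) (hm : (m : ℕ∞) ≤ ⊤) :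
      Integrable (fun v => ‖v‖ ^ a * ‖iteratedFDeriv ℝ m φ v‖) ν := by
    refine Continuous.integrable_of_hasCompactSupport ?_ ?_
    · exact (continuous_norm.pow a).mul (hφ.continuous_iteratedFDeriv (by exact_mod_cast hm)).norm
    · exact (hc.iteratedFDeriv (𝕜 := ℝ) m).norm.mul_left
  have h := VectorFourier.pow_mul_norm_iteratedFDeriv_fourierIntegral_le
    (evalPairing W) (μ := ν) (K := ⊤) (N := ⊤) hφ hint (k := 0) (n := N) le_top le_top Y
  obtain ⟨C, hC⟩ : ∃ C, ∀ w, |evalPairing W Y w| ^ N * ‖iteratedFDeriv ℝ 0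
      (VectorFourier.fourierIntegral Real.fourierChar ν (evalPairing W).toLinearMap₁₂ φ) w‖ ≤ C :=
    ⟨_, h⟩
  refine ⟨(4 * Real.pi) ^ N * C, fun x => ?_⟩
  have h := hC (oscFrequency i S x)
  rw [norm_iteratedFDeriv_zero, ← oscIntegral_eq_fourierIntegral hi] at h
  have e : |evalPairing W Y (oscFrequency i S x)| =
      (4 * Real.pi)⁻¹ * ∑ r, x r ^ 2 := by
    change |oscFrequency i S x Y| = _
    have h1 : quadSum (fun r s => S r s Y) x = ∑ r, x r ^ 2 := by
      simp [quadSum, hY, sq]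
    rw [oscFrequency_apply, h1, abs_mul, abs_div, abs_im_eq_one hi,
      abs_of_nonneg (Finset.sum_nonneg fun r _ => sq_nonneg (x r)),
      abs_of_pos (by positivity : (0 : ℝ) < 4 * Real.pi), one_div]
  rw [e, mul_pow, inv_pow, mul_assoc] at h
  exact (inv_mul_le_iff₀ (by positivity)).mp h

theorem integrable_monomial_smul_oscIntegral (hi : i ^ 2 = -1) (hφ : ContDiff ℝ ∞ φ)
    (hc : HasCompactSupport φ) {Y : W} (hY : ∀ r s, S r s Y = if r = s then 1 else 0)
    (δ : α → ℕ) :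
    Integrable fun x : α → ℝ => (∏ j, (x j : ℂ) ^ δ j) • oscIntegral i ν S φ x := by
  set D := ∑ j, δ j
  -- `D` powers absorb the monomial, and `dim + 1` powers make the bound integrable.
  set N := D + (Module.finrank ℝ (α → ℝ) + 1)
  obtain ⟨C₀, h₀⟩ := exists_pow_mul_norm_oscIntegral_le (ν := ν) hi hφ hc hY 0
  obtain ⟨C, h⟩ := exists_pow_mul_norm_oscIntegral_le (ν := ν) hi hφ hc hY N
  have hcont := continuous_oscIntegral (S := S) hi
    (hφ.continuous.integrable_of_hasCompactSupport (μ := ν) hc)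
  refine ((integrable_one_add_norm (μ := (volume : Measure (α → ℝ)))
    (r := ((Module.finrank ℝ (α → ℝ) + 1 : ℕ) : ℝ)) (by exact_mod_cast Nat.lt_succ_self _)).const_mul
    (2 ^ N * (C₀ + C))).mono' (by fun_prop) (Filter.Eventually.of_forall fun x => ?_)
  have h1 : ‖∏ j, (x j : ℂ) ^ δ j‖ ≤ (1 + ‖x‖) ^ D := by
    rw [norm_prod, ← Finset.prod_pow_eq_pow_sum]
    refine Finset.prod_le_prod (fun _ _ => norm_nonneg _) fun j _ => ?_
    rw [norm_pow, Complex.norm_real]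
    exact pow_le_pow_left₀ (norm_nonneg _) (by linarith [norm_le_pi_norm x j, norm_nonneg x]) _
  have h2 : ‖x‖ ^ 2 ≤ ∑ r, x r ^ 2 := by
    have : ‖x‖ ≤ Real.sqrt (∑ r, x r ^ 2) := by
      refine (pi_norm_le_iff_of_nonneg (Real.sqrt_nonneg _)).mpr fun r => ?_
      refine Real.le_sqrt_of_sq_le ?_
      rw [Real.norm_eq_abs, sq_abs]
      exact Finset.single_le_sum (f := fun r => x r ^ 2) (fun _ _ => sq_nonneg _)
        (Finset.mem_univ r)
    calc ‖x‖ ^ 2 ≤ Real.sqrt (∑ r, x r ^ 2) ^ 2 := pow_le_pow_left₀ (norm_nonneg _) this 2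
      _ = _ := Real.sq_sqrt (Finset.sum_nonneg fun r _ => sq_nonneg _)
  -- For `‖x‖ ≤ 1` the constant 1 suffices; otherwise `1 + ‖x‖ ≤ 2‖x‖ ≤ 2‖x‖²`.
  have h3 : (1 + ‖x‖) ^ N ≤ 2 ^ N * (1 + (∑ r, x r ^ 2) ^ N) := by
    have hn := norm_nonneg x
    rcases le_total ‖x‖ 1 with hx | hx
    · calc (1 + ‖x‖) ^ N ≤ 2 ^ N := pow_le_pow_left₀ (by positivity) (by linarith) N
        _ ≤ _ := le_mul_of_one_le_right (by positivity) (by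
          have := pow_nonneg (Finset.sum_nonneg fun r (_ : r ∈ Finset.univ) => sq_nonneg (x r)) N
          linarith)
    · calc (1 + ‖x‖) ^ N ≤ (2 * ∑ r, x r ^ 2) ^ N :=
            pow_le_pow_left₀ (by positivity) (by nlinarith) N
        _ ≤ _ := by rw [mul_pow]; gcongr; linarith
  have hpos : 0 < (1 + ‖x‖) ^ (Module.finrank ℝ (α → ℝ) + 1) := by positivity
  rw [norm_smul, Real.rpow_neg (by positivity), Real.rpow_natCast, ← div_eq_mul_inv,
    le_div_iff₀ hpos]
  calc ‖∏ j, (x j : ℂ) ^ δ j‖ * ‖oscIntegral i ν S φ x‖ *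
        (1 + ‖x‖) ^ (Module.finrank ℝ (α → ℝ) + 1)
      ≤ (1 + ‖x‖) ^ D * ‖oscIntegral i ν S φ x‖ *
        (1 + ‖x‖) ^ (Module.finrank ℝ (α → ℝ) + 1) := by gcongr
    _ = (1 + ‖x‖) ^ N * ‖oscIntegral i ν S φ x‖ := by simp only [N]; rw [pow_add]; ring
    _ ≤ 2 ^ N * (1 + (∑ r, x r ^ 2) ^ N) * ‖oscIntegral i ν S φ x‖ := by gcongr
    _ = 2 ^ N * ((∑ r, x r ^ 2) ^ 0 * ‖oscIntegral i ν S φ x‖ +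
        (∑ r, x r ^ 2) ^ N * ‖oscIntegral i ν S φ x‖) := by ring
    _ ≤ 2 ^ N * (C₀ + C) := by gcongr; exacts [h₀ x, h x]

end Oscillatory

/-! ### Convergence of the integral over `V₀` -/

section Convergence

open MeasureTheory

variable {V₀ V₁ : Type*} [NormedAddCommGroup V₀] [NormedSpace ℝ V₀] [FiniteDimensional ℝ V₀]
  [NormedAddCommGroup V₁] [NormedSpace ℝ V₁] [FiniteDimensional ℝ V₁]
  {B : SymplecticForm V₀ V₁} {k n : ℕ}

/-- The entries of the Gram matrix as linear forms. -/
def gramCLM (b : SymplecticBasis B k n) (r s : Fin k × Fin 2) : spoEven B →L[ℝ] ℝ :=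
  LinearMap.toContinuousLinearMap
    { toFun := fun X => gram b X r s
      map_add' := fun X Y => by simp [gram]
      map_smul' := fun c X => by simp [gram] }

theorem gramCLM_apply (b : SymplecticBasis B k n) (r s : Fin k × Fin 2) (X : spoEven B) :
    gramCLM b r s X = gram b X r s := rfl

/-- Invariance of the alternating form under `X` makes `B(v, Xw)` symmetric; hence the spectral
theorem applies. -/
theorem gram_transpose (b : SymplecticBasis B k n) (X : spoEven B) :
    (gram b X).transpose = gram b X := by
  ext r s
  have h := X.2.1 (b.e r) (b.e s)
  have h' := B.isAlt.neg_eq (X.1.1 (b.e r)) (b.e s)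
  simp only [Matrix.transpose_apply, gram, Matrix.of_apply]
  linarith

/-- The standard complex structure of the symplectic basis is an element of `𝔰𝔭(V₀)` for which `B(v,
Yv)` is the sum of the squares of the coordinates. It is the direction used for the decay estimate.
-/
theorem exists_gram_eq_one (b : SymplecticBasis B k n) :
    ∃ Y : spoEven B, ∀ r s, gramCLM b r s Y = if r = s then 1 else 0 := by
  let T : V₀ →ₗ[ℝ] V₀ := b.e.constr ℝ fun s => if s.2 = 0 then b.e (s.1, 1) else -b.e (s.1, 0)
  have hT (r s : Fin k × Fin 2) : B.form₀ (b.e r) (T (b.e s)) = if r = s then 1 else 0 := by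
    obtain ⟨r, a⟩ := r
    obtain ⟨s, c⟩ := s
    simp only [T, Module.Basis.constr_basis, Prod.mk.injEq]
    fin_cases a <;> fin_cases c <;> by_cases h : r = s <;> simp [b.form_e, h]
  -- Infinitesimal invariance is bilinear, so it is enough to test it on basis vectors.
  have hB : B.form₀.compl₁₂ T LinearMap.id + B.form₀.compl₁₂ LinearMap.id T = 0 := by
    refine b.e.ext fun r => b.e.ext fun s => ?_
    simp only [LinearMap.add_apply, LinearMap.compl₁₂_apply, LinearMap.id_apply,
      LinearMap.zero_apply]
    rw [← B.isAlt.neg_eq, hT, hT]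
    by_cases h : r = s
    · simp [h]
    · simp [h, Ne.symm h]
  refine ⟨⟨(LinearMap.toContinuousLinearMap T, 0), fun v w => ?_, by simp⟩, fun r s => ?_⟩
  · exact LinearMap.congr_fun₂ hB v w
  · rw [← hT r s]
    rfl

/-- The coefficients of the powers of the even coordinates of `V` in `exp(-(i/2) B(v, Xv))`. -/
def srcMonomial (b : SymplecticBasis B k n) (i : ℂ) (δ : Fin k × Fin 2 → ℕ) : JointEven B :=
  ∏ r, ((δ r).factorial : ℂ)⁻¹ • ((-i) • oddSrc b r) ^ δ r

theorem berezinExp_eq_sum (b : SymplecticBasis B k n) (i : ℂ) (X : spoEven B) (z : JointEven B) :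
    berezinExp b i X z = ∑ d ∈ Finset.range (jointOrder B), ((d.factorial : ℂ)⁻¹) •
      berezin b i (((-(i / 2)) • jointVal B (oddSq b X)) ^ d * jointVal B z) := by
  rw [berezinExp_apply, exp_eq_sum_complex (oddSq_pow_eq_zero b _ X)]
  simp only [map_mul, map_sum, map_smul, map_pow, Finset.sum_mul, smul_mul_assoc]

/-- `oddSq` as a linear map. -/
def oddSqCLM (b : SymplecticBasis B k n) : spoEven B →L[ℝ] JointAlgebra B :=
  LinearMap.toContinuousLinearMap
    { toFun := fun X => jointVal B (oddSq b X)
      map_add' := fun X Y => by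
        simp only [coe_oddSq, ← Finset.sum_add_distrib, ← add_smul, ← Complex.ofReal_add,
          ← map_add]
        rfl
      map_smul' := fun c X => by
        simp only [coe_oddSq, Finset.smul_sum, RingHom.id_apply]
        refine Finset.sum_congr rfl fun _ _ => Finset.sum_congr rfl fun _ _ => ?_
        change ((B.form₁ _ (c • X.1.2 _) : ℝ) : ℂ) • _ = _
        rw [map_smul, smul_eq_mul, Complex.ofReal_mul, mul_smul]
        rfl }

variable (B) in
/-- The continuous linear map underlying a linear map on the joint Grassmann algebra. -/
abbrev jointCLM (L : JointAlgebra B →ₗ[ℂ] OddAlgebra B) : JointAlgebra B →L[ℂ] OddAlgebra B :=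
  LinearMap.toContinuousLinearMap L

theorem contDiff_berezinExp (b : SymplecticBasis B k n) (i : ℂ) (z : JointEven B) :
    ContDiff ℝ ∞ fun X => berezinExp b i X z := by
  refine AnalyticOnNhd.contDiff fun X _ => ?_
  simp only [berezinExp_eq_sum]
  refine Finset.analyticAt_fun_sum _ fun d _ => AnalyticAt.fun_const_smul ?_
  have h1 : AnalyticAt ℝ (fun X => (-(i / 2)) • jointVal B (oddSq b X)) X :=
    AnalyticAt.fun_const_smul (f := fun X => jointVal B (oddSq b X))
      (ContinuousLinearMap.analyticAt (𝕜 := ℝ) (F := JointAlgebra B) (oddSqCLM b) X)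
  have h := analyticAt_exterior_mul (analyticAt_exterior_pow h1 d)
    (analyticAt_const (v := jointVal B z))
  exact ((jointCLM B (berezin b i)).restrictScalars ℝ).analyticAt _ |>.comp h

theorem continuous_berezinExp_exp (b : SymplecticBasis B k n) (i : ℂ) :
    Continuous fun p : Matrix (Fin k × Fin 2) (Fin k × Fin 2) ℂ × spoEven B =>
      berezinExp b i p.2 (IsNilpotent.exp (∑ r, ∑ s,
        p.1 r s • ((-i) • oddSrc b r * (-i) • oddSrc b s))) := by
  have hN (M : Matrix (Fin k × Fin 2) (Fin k × Fin 2) ℂ) :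
      (∑ r, ∑ s, M r s • ((-i) • oddSrc b r * (-i) • oddSrc b s)) ^ jointOrder B = 0 :=
    EvenAlg.pow_eq_zero (by
      simp only [map_sum, map_smul, map_mul, algebraMapInv_oddSrc, smul_zero, mul_zero,
        Finset.sum_const_zero])
  have hE (M : Matrix (Fin k × Fin 2) (Fin k × Fin 2) ℂ) : jointVal B (IsNilpotent.exp
      (∑ r, ∑ s, M r s • ((-i) • oddSrc b r * (-i) • oddSrc b s))) =
      ∑ d ∈ Finset.range (jointOrder B), ((d.factorial : ℂ)⁻¹) • (∑ r, ∑ s, M r s •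
        (((-i) • jointVal B (oddSrc b r)) * ((-i) • jointVal B (oddSrc b s)))) ^ d := by
    simp only [exp_eq_sum_complex (hN _), map_sum, map_smul, map_pow, map_mul]
  simp only [berezinExp_eq_sum, hE]
  refine continuous_finsetSum _ fun d _ => Continuous.fun_const_smul ?_ _
  refine (jointCLM B (berezin b i)).continuous.comp ?_
  refine (((((oddSqCLM b).continuous.comp continuous_snd).const_smul (-(i / 2))).pow d)).mul ?_
  fun_prop

variable {i : ℂ} {ν : Measure (spoEven B)} [ν.IsAddHaarMeasure] {ρ : spoEven B → ℂ}

/-- A finite sum in which the powers of `x`, the phase and the dependence on `X` are separated; each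
term yields an `oscIntegral`. -/
theorem spfInner_integrand_eq (b : SymplecticBasis B k n) (i : ℂ) (X : spoEven B)
    (x : Fin k × Fin 2 → ℝ) :
    berezin b i (grassmannExp ((-(i / 2)) • superForm b X x)) =
      ∑ δ ∈ Fintype.piFinset fun _ => Finset.range (jointOrder B), (∏ r, (x r : ℂ) ^ δ r) •
        Complex.exp (-(i / 2) * (quadSum (gram b X) x : ℝ)) •
          berezinExp b i X (srcMonomial b i δ) := by
  rw [berezin_grassmannExp, exp_sum_smul (oddSrc_pow_eq_zero b (-i)), map_sum, Finset.smul_sum]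
  refine Finset.sum_congr rfl fun δ _ => ?_
  rw [map_smul, smul_comm]
  rfl

theorem contDiff_smul_berezinExp (hρ : ContDiff ℝ ∞ ρ) (b : SymplecticBasis B k n)
    (z : JointEven B) : ContDiff ℝ ∞ fun X => ρ X • berezinExp b i X z :=
  hρ.smul (contDiff_berezinExp b i z)

theorem continuous_quadSum_gram (b : SymplecticBasis B k n) :
    Continuous fun p : (Fin k × Fin 2 → ℝ) × spoEven B => quadSum (gram b p.2) p.1 := by
  simp only [quadSum, ← gramCLM_apply]
  fun_prop

theorem spfInner_eq (b : SymplecticBasis B k n) (hρ : ContDiff ℝ ∞ ρ)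
    (hc : HasCompactSupport ρ) (x : Fin k × Fin 2 → ℝ) :
    spfInner b i ν ρ x = ∑ δ ∈ Fintype.piFinset fun _ => Finset.range (jointOrder B),
      (∏ r, (x r : ℂ) ^ δ r) •
        oscIntegral i ν (gramCLM b) (fun X => ρ X • berezinExp b i X (srcMonomial b i δ)) x := by
  simp only [spfInner, spfInner_integrand_eq, Finset.smul_sum, oscIntegral]
  rw [integral_finsetSum]
  · refine Finset.sum_congr rfl fun δ _ => ?_
    rw [← integral_smul]
    refine integral_congr_ae (Filter.Eventually.of_forall fun X => ?_)
    dsimp only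
    rw [smul_comm, smul_comm (ρ X)]
    rfl
  · intro δ _
    refine Continuous.integrable_of_hasCompactSupport ?_ hc.smul_right
    have h1 := (continuous_quadSum_gram b).comp (Continuous.prodMk_right x)
    have h2 := (contDiff_berezinExp b i (srcMonomial b i δ)).continuous
    have h3 := hρ.continuous
    simp only [Function.comp_def] at h1
    fun_prop

/-- Each term is a monomial times a rapidly decreasing function. No condition on the support of `ρ`
is needed beyond compactness. -/
theorem integrable_spfInner (hi : i ^ 2 = -1) (b : SymplecticBasis B k n) (hρ : ContDiff ℝ ∞ ρ)
    (hc : HasCompactSupport ρ) : Integrable (spfInner b i ν ρ) := by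
  obtain ⟨Y, hY⟩ := exists_gram_eq_one b
  simp only [funext (spfInner_eq (ν := ν) (i := i) b hρ hc)]
  exact integrable_finsetSum _ fun δ _ => integrable_monomial_smul_oscIntegral hi
    (contDiff_smul_berezinExp hρ b _) hc.smul_right hY δ

end Convergence

/-! ### Gaussian regularization -/

section Regularization

open MeasureTheory Filter Topology

variable {V₀ V₁ : Type*} [NormedAddCommGroup V₀] [NormedSpace ℝ V₀] [FiniteDimensional ℝ V₀]
  [NormedAddCommGroup V₁] [NormedSpace ℝ V₁] [FiniteDimensional ℝ V₁]
  {B : SymplecticForm V₀ V₁} {k n : ℕ}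

theorem mem_regularSet_iff (b : SymplecticBasis B k n) (X : spoEven B) :
    X ∈ regularSet B ↔ (gram b X).det ≠ 0 := by
  have h : gram b X = LinearMap.BilinForm.toMatrix b.e (evenForm X) := by
    ext r s
    rw [LinearMap.BilinForm.toMatrix_apply]
    rfl
  rw [h, ← LinearMap.BilinForm.nondegenerate_iff_det_ne_zero b.e]
  rfl

/-- The exponential of a quadratic form in the sources, integrated along `V₁`. -/
def gaussValue (b : SymplecticBasis B k n) (i : ℂ) (M : Matrix (Fin k × Fin 2) (Fin k × Fin 2) ℂ)
    (X : spoEven B) : OddAlgebra B :=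
  berezinExp b i X (IsNilpotent.exp (∑ r, ∑ s,
    M r s • ((-i) • oddSrc b r * (-i) • oddSrc b s)))

variable {i : ℂ} {ν : Measure (spoEven B)} [ν.IsAddHaarMeasure] {ρ : spoEven B → ℂ}

/-- The regularized integrand. -/
def regIntegrand (b : SymplecticBasis B k n) (i : ℂ) (ρ : spoEven B → ℂ) (ε : ℝ)
    (p : (Fin k × Fin 2 → ℝ) × spoEven B) : OddAlgebra B :=
  Complex.exp (-(ε * ∑ r, (p.1 r : ℂ) ^ 2)) •
    ρ p.2 • berezin b i (grassmannExp ((-(i / 2)) • superForm b p.2 p.1))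

theorem regIntegrand_eq_sum (b : SymplecticBasis B k n) (i : ℂ) (ρ : spoEven B → ℂ) (ε : ℝ)
    (p : (Fin k × Fin 2 → ℝ) × spoEven B) : regIntegrand b i ρ ε p =
      ∑ δ ∈ Fintype.piFinset fun _ => Finset.range (jointOrder B),
        Complex.exp (-(i / 2) * (quadSum (gram b p.2) p.1 : ℝ)) •
          (∏ r, Complex.exp (-(ε : ℂ) * (p.1 r : ℂ) ^ 2) * (p.1 r : ℂ) ^ δ r) •
            ρ p.2 • berezinExp b i p.2 (srcMonomial b i δ) := by
  rw [regIntegrand, spfInner_integrand_eq, Finset.smul_sum, Finset.smul_sum]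
  refine Finset.sum_congr rfl fun δ _ => ?_
  rw [Finset.prod_mul_distrib, ← Complex.exp_sum, Finset.mul_sum, ← Finset.sum_neg_distrib]
  simp only [neg_mul, smul_smul]
  congr 1
  ring

theorem integrable_unimodular_smul {Ω : Type*} [MeasurableSpace Ω] {E : Type*}
    [NormedAddCommGroup E] [NormedSpace ℂ E] {μ : Measure Ω} {c : Ω → ℂ} {g : Ω → E}
    (hc : AEStronglyMeasurable c μ) (h1 : ∀ p, ‖c p‖ = 1) (hg : Integrable g μ) :
    Integrable (fun p => c p • g p) μ :=
  hg.mono (hc.smul hg.aestronglyMeasurable)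
    (Eventually.of_forall fun p => by rw [norm_smul, h1, one_mul])

/-- The phase has modulus one; what remains is a Gaussian times a monomial in `x`, multiplied by a
compactly supported function of `X`. This is what permits Fubini. -/
theorem integrable_regIntegrand (hi : i ^ 2 = -1) (b : SymplecticBasis B k n)
    (hρ : ContDiff ℝ ∞ ρ) (hc : HasCompactSupport ρ) {ε : ℝ} (hε : 0 < ε) :
    Integrable (regIntegrand b i ρ ε) ((volume : Measure (Fin k × Fin 2 → ℝ)).prod ν) := by
  simp only [funext (regIntegrand_eq_sum b i ρ ε)]
  refine integrable_finsetSum _ fun δ _ => ?_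
  have h1 : Integrable (fun x : Fin k × Fin 2 → ℝ =>
      ∏ r, Complex.exp (-(ε : ℂ) * (x r : ℂ) ^ 2) * (x r : ℂ) ^ δ r) :=
    Integrable.fintype_prod
      (f := fun r (y : ℝ) => Complex.exp (-(ε : ℂ) * (y : ℂ) ^ 2) * (y : ℂ) ^ δ r)
      fun r => integrable_gaussian_mul_pow (by simpa using hε) _
  have h2 : Integrable (fun X => ρ X • berezinExp b i X (srcMonomial b i δ)) ν :=
    (contDiff_smul_berezinExp hρ b _).continuous.integrable_of_hasCompactSupport hc.smul_right
  have h3 : Continuous fun p : (Fin k × Fin 2 → ℝ) × spoEven B =>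
      Complex.exp (-(i / 2) * (quadSum (gram b p.2) p.1 : ℝ)) := by
    have := continuous_quadSum_gram b
    fun_prop
  exact integrable_unimodular_smul h3.aestronglyMeasurable (fun p => norm_cexp_phase hi _)
    (h1.smul_prod h2)

theorem integral_regIntegrand_right (b : SymplecticBasis B k n) (ε : ℝ)
    (x : Fin k × Fin 2 → ℝ) : ∫ X, regIntegrand b i ρ ε (x, X) ∂ν =
      Complex.exp (-(ε * ∑ r, (x r : ℂ) ^ 2)) • spfInner b i ν ρ x := by
  simp only [regIntegrand, integral_smul, spfInner]

theorem integral_regIntegrand_left (hi : i ^ 2 = -1) (b : SymplecticBasis B k n)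
    {ε : ℝ} (hε : 0 < ε) (X : spoEven B) {O : Matrix (Fin k × Fin 2) (Fin k × Fin 2) ℝ}
    {l : Fin k × Fin 2 → ℝ} (hO : O.transpose * O = 1)
    (hS : gram b X = O * Matrix.diagonal l * O.transpose) :
    ∫ x, regIntegrand b i ρ ε (x, X) =
      ρ X • (∏ j, ((Real.pi : ℂ) / (ε + i / 2 * l j)) ^ (1 / 2 : ℂ)) •
        gaussValue b i ((1 / 2 : ℂ) • (regMatrix i (gram b X) ε)⁻¹) X := by
  have h := integral_gaussian_form hi hO hS
    (u := fun r => (-i) • oddSrc b r) (fun r => ⟨_, oddSrc_pow_eq_zero b (-i) r⟩) hε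
    (berezinExp b i X)
  rw [gaussValue]
  simp only [Matrix.smul_apply, smul_eq_mul]
  rw [← h, ← integral_smul]
  refine integral_congr_ae (Eventually.of_forall fun x => ?_)
  simp only [regIntegrand, berezin_grassmannExp]
  rw [smul_comm, smul_smul (Complex.exp _), ← Complex.exp_add]
  simp only [sub_eq_add_neg, neg_mul, quadSum]

/-- Squaring removes the branches of the roots: the modulus depends only on the product. With
`prod_gaussian_eq`, the prefactor is bounded through a determinant that is continuous in `X`,
although a diagonalization is chosen separately for each `X`. -/
theorem norm_prod_cpow_half {α : Type*} (s : Finset α) (z : α → ℂ) :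
    ‖∏ j ∈ s, z j ^ (1 / 2 : ℂ)‖ = √‖∏ j ∈ s, z j‖ := by
  have h : (∏ j ∈ s, z j ^ (1 / 2 : ℂ)) ^ 2 = ∏ j ∈ s, z j := by
    rw [← Finset.prod_pow]
    refine Finset.prod_congr rfl fun j _ => ?_
    simp
  rw [← h, norm_pow, Real.sqrt_sq (norm_nonneg _)]

variable {S O : Matrix (Fin k × Fin 2) (Fin k × Fin 2) ℝ} {l : Fin k × Fin 2 → ℝ}

theorem diagonal_ne_zero (hO : O.transpose * O = 1) (hS : S = O * Matrix.diagonal l * O.transpose)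
    (h : S.det ≠ 0) (j : Fin k × Fin 2) : l j ≠ 0 := by
  rw [hS, Matrix.det_mul_comm, ← Matrix.mul_assoc, hO, Matrix.one_mul, Matrix.det_diagonal] at h
  exact Finset.prod_ne_zero_iff.mp h j (Finset.mem_univ j)

/-- The imaginary part is `±t`, so nothing degenerates in the limit `ε = 0`. -/
theorem regularized_ne_zero (hi : i ^ 2 = -1) {t : ℝ} (ht : t ≠ 0) (ε : ℝ) :
    (2 * ε + i * t : ℂ) ≠ 0 := fun h => by
  have h1 := congrArg Complex.im h
  simp only [Complex.add_im, Complex.mul_im, Complex.ofReal_im, Complex.ofReal_re,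
    re_eq_zero_of_sq hi, Complex.im_ofNat, Complex.zero_im, Complex.re_ofNat] at h1
  have h2 := abs_im_eq_one hi
  have : i.im * t = 0 := by linarith
  rcases mul_eq_zero.mp this with h | h
  · rw [h] at h2; simp at h2
  · exact ht h

theorem det_regMatrix_ne_zero (hi : i ^ 2 = -1) (b : SymplecticBasis B k n) {X : spoEven B}
    (hX : X ∈ regularSet B) (ε : ℝ) : (regMatrix i (gram b X) ε).det ≠ 0 := by
  obtain ⟨O, l, hO, hS⟩ := exists_diagonalization (gram_transpose b X)
  rw [det_regMatrix hO hS]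
  exact Finset.prod_ne_zero_iff.mpr fun j _ => regularized_ne_zero hi
    (diagonal_ne_zero hO hS ((mem_regularSet_iff b X).mp hX) j) ε

theorem continuous_regMatrix (b : SymplecticBasis B k n) (i : ℂ) :
    Continuous fun p : ℝ × spoEven B => regMatrix i (gram b p.2) p.1 := by
  refine continuous_matrix fun r s => ?_
  simp only [regMatrix, Matrix.add_apply, Matrix.smul_apply, Matrix.map_apply, ← gramCLM_apply]
  fun_prop

theorem continuous_gaussValue (b : SymplecticBasis B k n) (i : ℂ) :
    Continuous fun p : Matrix (Fin k × Fin 2) (Fin k × Fin 2) ℂ × spoEven B =>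
      gaussValue b i p.1 p.2 :=
  continuous_berezinExp_exp b i

theorem continuousOn_matrix_inv {Ω α : Type*} [TopologicalSpace Ω] [Fintype α] [DecidableEq α]
    {A : Ω → Matrix α α ℂ} {s : Set Ω} (hA : Continuous A) (h : ∀ x ∈ s, (A x).det ≠ 0) :
    ContinuousOn (fun x => (A x)⁻¹) s := by
  simp only [Matrix.inv_def, Ring.inverse_eq_inv']
  exact (hA.matrix_det.continuousOn.inv₀ h).smul hA.matrix_adjugate.continuousOn

theorem continuousOn_gaussValue (hi : i ^ 2 = -1) (b : SymplecticBasis B k n) :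
    ContinuousOn (fun p : ℝ × spoEven B =>
      gaussValue b i ((1 / 2 : ℂ) • (regMatrix i (gram b p.2) p.1)⁻¹) p.2)
      {p | p.2 ∈ regularSet B} := by
  have h1 : ContinuousOn (fun p : ℝ × spoEven B => (regMatrix i (gram b p.2) p.1)⁻¹)
      {p | p.2 ∈ regularSet B} :=
    continuousOn_matrix_inv (continuous_regMatrix b i)
      fun p hp => det_regMatrix_ne_zero hi b hp p.1
  have h2 : ContinuousOn (fun p : ℝ × spoEven B =>
      ((1 / 2 : ℂ) • (regMatrix i (gram b p.2) p.1)⁻¹, p.2)) {p | p.2 ∈ regularSet B} :=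
    (h1.const_smul (1 / 2 : ℂ)).prodMk continuous_snd.continuousOn
  have h3 := continuous_gaussValue b i
  have h4 := h3.comp_continuousOn h2
  simp only [Function.comp_def] at h4
  exact h4

theorem prod_gaussian_eq (hO : O.transpose * O = 1)
    (hS : S = O * Matrix.diagonal l * O.transpose) (ε : ℝ) :
    ∏ j, ((Real.pi : ℂ) / (ε + i / 2 * l j)) =
      (2 * Real.pi) ^ Fintype.card (Fin k × Fin 2) / (regMatrix i S ε).det := by
  rw [det_regMatrix hO hS, ← Finset.card_univ, ← Finset.prod_const, ← Finset.prod_div_distrib]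
  refine Finset.prod_congr rfl fun j _ => ?_
  rw [show (2 * ε + i * l j : ℂ) = 2 * (ε + i / 2 * l j) by ring,
    mul_div_mul_left _ _ two_ne_zero]

/-- At `ε = 0` the base is purely imaginary and nonzero, hence off the branch cut of the principal
root. -/
theorem continuous_cpow_gaussian (hi : i ^ 2 = -1) {t : ℝ} (ht : t ≠ 0) :
    ContinuousAt (fun ε : ℝ => ((Real.pi : ℂ) / (ε + i / 2 * t)) ^ (1 / 2 : ℂ)) 0 := by
  have h0 : ((0 : ℝ) + i / 2 * t : ℂ) ≠ 0 := by
    have := regularized_ne_zero hi ht 0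
    intro h
    apply this
    rw [show (2 * (0 : ℝ) + i * t : ℂ) = 2 * ((0 : ℝ) + i / 2 * t) by push_cast; ring, h, mul_zero]
  have h1 : ContinuousAt (fun ε : ℝ => (Real.pi : ℂ) / (ε + i / 2 * t)) 0 :=
    ContinuousAt.div (by fun_prop) (by fun_prop) h0
  refine h1.cpow continuousAt_const (Or.inr fun h => ?_)
  rw [Complex.div_im] at h
  have hi0 := re_eq_zero_of_sq hi
  have hi1 := abs_im_eq_one hi
  have h2 : ((0 : ℝ) + i / 2 * t : ℂ).re = 0 := by
    simp [hi0]
  have h3 : ((0 : ℝ) + i / 2 * t : ℂ).im ≠ 0 := fun h3 => h0 (Complex.ext h2 h3)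
  have h4 : Complex.normSq ((0 : ℝ) + i / 2 * t : ℂ) ≠ 0 := by
    rwa [Ne, Complex.normSq_eq_zero]
  rw [Complex.ofReal_im, Complex.ofReal_re, zero_mul, zero_div, zero_sub, neg_eq_zero,
    div_eq_zero_iff] at h
  rcases h with h | h
  · exact (mul_ne_zero Real.pi_ne_zero h3) h
  · exact h4 h

theorem tendsto_regularized (hi : i ^ 2 = -1) (b : SymplecticBasis B k n) {X : spoEven B}
    (hX : X ∈ regularSet B) (hO : O.transpose * O = 1)
    (hS : gram b X = O * Matrix.diagonal l * O.transpose) :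
    Tendsto (fun ε : ℝ => (∏ j, ((Real.pi : ℂ) / (ε + i / 2 * l j)) ^ (1 / 2 : ℂ)) •
        gaussValue b i ((1 / 2 : ℂ) • (regMatrix i (gram b X) ε)⁻¹) X) (𝓝[>] 0)
      (𝓝 ((∏ j, ((Real.pi : ℂ) / ((0 : ℝ) + i / 2 * l j)) ^ (1 / 2 : ℂ)) •
        gaussValue b i ((1 / 2 : ℂ) • (regMatrix i (gram b X) 0)⁻¹) X)) := by
  have h1 (j) : Tendsto (fun ε : ℝ => ((Real.pi : ℂ) / (ε + i / 2 * l j)) ^ (1 / 2 : ℂ)) (𝓝[>] 0)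
      (𝓝 (((Real.pi : ℂ) / ((0 : ℝ) + i / 2 * l j)) ^ (1 / 2 : ℂ))) :=
    (continuous_cpow_gaussian hi (diagonal_ne_zero hO hS
      ((mem_regularSet_iff b X).mp hX) j)).tendsto.mono_left nhdsWithin_le_nhds
  have h2 := (continuousOn_gaussValue hi b).comp_continuous (Continuous.prodMk_left X)
    fun _ => hX
  have h3 := (h2.tendsto 0).mono_left (nhdsWithin_le_nhds (s := Set.Ioi 0))
  exact (tendsto_finsetProd _ fun j _ => h1 j).smul h3

/-- The superPfaffian is computed by the limit of the regularized Gaussian integrals. -/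
theorem spf_eq_integral (hi : i ^ 2 = -1) (b : SymplecticBasis B k n) (hρ : ContDiff ℝ ∞ ρ)
    (hc : HasCompactSupport ρ) (hs : tsupport ρ ⊆ regularSet B) {F : spoEven B → OddAlgebra B}
    (hF : ∀ X ∈ regularSet B, ∀ (O : Matrix (Fin k × Fin 2) (Fin k × Fin 2) ℝ)
      (l : Fin k × Fin 2 → ℝ), O.transpose * O = 1 →
      gram b X = O * Matrix.diagonal l * O.transpose →
      F X = (∏ j, ((Real.pi : ℂ) / ((0 : ℝ) + i / 2 * l j)) ^ (1 / 2 : ℂ)) •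
        gaussValue b i ((1 / 2 : ℂ) • (regMatrix i (gram b X) 0)⁻¹) X) :
    ∫ x : Fin k × Fin 2 → ℝ, spfInner b i ν ρ x = ∫ X : spoEven B, ρ X • F X ∂ν := by
  have hint := integrable_spfInner (ν := ν) hi b hρ hc
  have hswap (ε : ℝ) (hε : 0 < ε) :
      ∫ x : Fin k × Fin 2 → ℝ, Complex.exp (-(ε * ∑ r, (x r : ℂ) ^ 2)) • spfInner b i ν ρ x =
        ∫ X, (∫ x, regIntegrand b i ρ ε (x, X)) ∂ν := by
    simp only [← integral_regIntegrand_right]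
    exact integral_integral_swap (f := fun x X => regIntegrand b i ρ ε (x, X))
      (integrable_regIntegrand hi b hρ hc hε)
  -- On the side of `V₀` the damping factor is at most 1, so the absolutely integrable undamped
  -- integrand dominates.
  have h1 : Tendsto (fun ε : ℝ => ∫ x : Fin k × Fin 2 → ℝ,
      Complex.exp (-(ε * ∑ r, (x r : ℂ) ^ 2)) • spfInner b i ν ρ x) (𝓝[>] 0)
      (𝓝 (∫ x, spfInner b i ν ρ x)) := by
    refine tendsto_integral_filter_of_dominated_convergence (fun x => ‖spfInner b i ν ρ x‖)
      (Eventually.of_forall fun ε => ?_) ?_ hint.norm (Eventually.of_forall fun x => ?_)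
    · have : Continuous fun x : Fin k × Fin 2 → ℝ =>
          Complex.exp (-(ε * ∑ r, (x r : ℂ) ^ 2)) := by fun_prop
      exact this.aestronglyMeasurable.smul hint.aestronglyMeasurable
    · filter_upwards [self_mem_nhdsWithin] with ε hε
      refine Eventually.of_forall fun x => ?_
      rw [norm_smul]
      refine mul_le_of_le_one_left (norm_nonneg _) ?_
      have : (-(ε * ∑ r, (x r : ℂ) ^ 2)) = ((-(ε * ∑ r, x r ^ 2) : ℝ) : ℂ) := by push_cast; rfl
      rw [this, Complex.norm_exp_ofReal, Real.exp_le_one_iff, neg_nonpos]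
      exact mul_nonneg (le_of_lt hε) (Finset.sum_nonneg fun r _ => sq_nonneg _)
    · have : Continuous fun ε : ℝ =>
          Complex.exp (-(ε * ∑ r, (x r : ℂ) ^ 2)) • spfInner b i ν ρ x := by fun_prop
      have := this.tendsto 0
      simp only [Complex.ofReal_zero, zero_mul, neg_zero, Complex.exp_zero, one_smul] at this
      exact this.mono_left nhdsWithin_le_nhds
  have hK : IsCompact (Set.Icc (0 : ℝ) 1 ×ˢ tsupport ρ) := isCompact_Icc.prod hc
  have hKs : Set.Icc (0 : ℝ) 1 ×ˢ tsupport ρ ⊆ {p | p.2 ∈ regularSet B} := fun p hp => hs hp.2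
  have hdet : ContinuousOn (fun p : ℝ × spoEven B => ((2 * Real.pi : ℂ) ^
      Fintype.card (Fin k × Fin 2) / (regMatrix i (gram b p.2) p.1).det)) {p | p.2 ∈ regularSet B} :=
    continuousOn_const.div (continuous_regMatrix b i).matrix_det.continuousOn
      fun p hp => det_regMatrix_ne_zero hi b hp p.1
  -- A bound uniform in `ε` and `X`, by compactness of `[0, 1]` times the support of `ρ`, where the
  -- form stays nondegenerate.
  obtain ⟨C, hC⟩ := hK.exists_bound_of_continuousOn
    (((Real.continuous_sqrt.comp_continuousOn hdet.norm).mul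
      (continuousOn_gaussValue hi b).norm).mono hKs)
  -- On the side of the Lie algebra, the computed Gaussian integral converges pointwise and is
  -- dominated by `‖ρ‖ C`.
  have h2 : Tendsto (fun ε : ℝ => ∫ X, (∫ x, regIntegrand b i ρ ε (x, X)) ∂ν) (𝓝[>] 0)
      (𝓝 (∫ X, ρ X • F X ∂ν)) := by
    refine tendsto_integral_filter_of_dominated_convergence (fun X => ‖ρ X‖ * C) ?_ ?_
      ((hρ.continuous.integrable_of_hasCompactSupport hc).norm.mul_const C)
      (Eventually.of_forall fun X => ?_)
    · filter_upwards [self_mem_nhdsWithin] with ε hε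
      exact (integrable_regIntegrand hi b hρ hc hε).integral_prod_right.aestronglyMeasurable
    · filter_upwards [Ioc_mem_nhdsGT one_pos] with ε hε
      refine Eventually.of_forall fun X => ?_
      obtain ⟨O, l, hO, hS⟩ := exists_diagonalization (gram_transpose b X)
      rw [integral_regIntegrand_left hi b hε.1 X hO hS, norm_smul]
      by_cases hX : X ∈ tsupport ρ
      · refine mul_le_mul_of_nonneg_left ?_ (norm_nonneg _)
        have := hC (ε, X) ⟨⟨hε.1.le, hε.2⟩, hX⟩
        rw [Pi.mul_apply, norm_mul, norm_norm, Function.comp_apply,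
          Real.norm_of_nonneg (Real.sqrt_nonneg _)] at this
        rw [norm_smul, norm_prod_cpow_half, prod_gaussian_eq hO hS]
        exact this
      · rw [image_eq_zero_of_notMem_tsupport hX, norm_zero, zero_mul, zero_mul]
    · obtain ⟨O, l, hO, hS⟩ := exists_diagonalization (gram_transpose b X)
      by_cases hX : X ∈ tsupport ρ
      · have hXr := hs hX
        rw [hF X hXr O l hO hS]
        refine Tendsto.congr' (f₁ := fun ε : ℝ => ρ X •
          (∏ j, ((Real.pi : ℂ) / (ε + i / 2 * l j)) ^ (1 / 2 : ℂ)) •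
          gaussValue b i ((1 / 2 : ℂ) • (regMatrix i (gram b X) ε)⁻¹) X) ?_ ?_
        · filter_upwards [self_mem_nhdsWithin] with ε hε
          exact (integral_regIntegrand_left hi b hε X hO hS).symm
        · exact (tendsto_regularized hi b hXr hO hS).const_smul _
      · simp only [regIntegrand, image_eq_zero_of_notMem_tsupport hX, zero_smul, smul_zero,
          integral_zero]
        exact tendsto_const_nhds
  exact tendsto_nhds_unique h1 (h2.congr' (by
    filter_upwards [self_mem_nhdsWithin] with ε hε using (hswap ε hε).symm))

end Regularization

/-! ### The function representing the superPfaffian -/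

section Representative

variable {V₀ V₁ : Type*} [NormedAddCommGroup V₀] [NormedSpace ℝ V₀] [FiniteDimensional ℝ V₀]
  [NormedAddCommGroup V₁] [NormedSpace ℝ V₁] [FiniteDimensional ℝ V₁]
  {B : SymplecticForm V₀ V₁} {k n : ℕ}

/-- The entries of the block `A`, as linear forms. -/
def coordA (b : SymplecticBasis B k n) (r s : Fin k × Fin 2) : spoEven B →ₗ[ℝ] ℝ where
  toFun G := b.e.coord r (G.1.1 (b.e s))
  map_add' G G' := by simp
  map_smul' c G := by simp

/-- The entries of the block `D`, as linear forms. -/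
def coordD (b : SymplecticBasis B k n) (j l : Fin n) : spoEven B →ₗ[ℝ] ℝ where
  toFun G := b.g.coord j (G.1.2 (b.g l))
  map_add' G G' := by simp
  map_smul' c G := by simp

/-- The entries of the block `C`, as linear forms. -/
def coordC (b : SymplecticBasis B k n) (j : Fin n) (s : Fin k × Fin 2) : spoOdd B →ₗ[ℝ] ℝ where
  toFun G := b.g.coord j (G.1.2 (b.e s))
  map_add' G G' := by simp
  map_smul' c G := by simp

/-- The entries of the block `B` up to sign, as linear forms. -/
def coordB (b : SymplecticBasis B k n) (r : Fin k × Fin 2) (l : Fin n) : spoOdd B →ₗ[ℝ] ℝ where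
  toFun G := b.e.coord r (G.1.1 (b.g l))
  map_add' G G' := by simp
  map_smul' c G := by simp

/-- The complexification of a real linear form. -/
def complexForm {W : Type*} [AddCommGroup W] [Module ℝ W] : (W →ₗ[ℝ] ℝ) →ₗ[ℝ] (W →ₗ[ℝ] ℂ) :=
  LinearMap.compRight ℝ Complex.ofRealCLM.toLinearMap

theorem complexForm_apply {W : Type*} [AddCommGroup W] [Module ℝ W] (l : W →ₗ[ℝ] ℝ) (w : W) :
    complexForm l w = (l w : ℂ) := rfl

/-- The block `A` of an even element. -/
def realA (b : SymplecticBasis B k n) (X : spoEven B) :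
    Matrix (Fin k × Fin 2) (Fin k × Fin 2) ℝ := Matrix.of fun r s => coordA b r s X

/-- The matrix `D - C A⁻¹ B` at an even point of `𝔰𝔭𝔬(V)`, in the orthonormal basis `f`. -/
def spfMatrix (b : SymplecticBasis B k n) (i : ℂ) (X : spoEven B) :
    Matrix (Fin n) (Fin n) (EvenAlg (spoOdd B →ₗ[ℝ] ℂ)) := fun j l =>
  ((b.phase i j)⁻¹ * b.phase i l) • ((coordD b j l X : ℂ) • 1 + ∑ r, ∑ s,
    ((realA b X)⁻¹ r s : ℂ) •
      EvenAlg.mul₂ (complexForm (coordC b j r)) (complexForm (coordB b s l)))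

/-- The function representing the superPfaffian. -/
def spfFun (b : SymplecticBasis B k n) (i : ℂ) (X : spoEven B) : OddAlgebra B :=
  (i ^ sigNeg (quadForm X) * ((√|(realA b X).det|)⁻¹ : ℝ)) •
    EvenAlg.val (spoOdd B →ₗ[ℝ] ℂ) (pfaffian (spfMatrix b i X))

/-- The Gram matrix of the basis `e`. -/
def sympMatrix (k : ℕ) : Matrix (Fin k × Fin 2) (Fin k × Fin 2) ℝ :=
  Matrix.of fun r s => if r.1 = s.1 then !![(0 : ℝ), 1; -1, 0] r.2 s.2 else 0

theorem form_e_eq (b : SymplecticBasis B k n) (r s : Fin k × Fin 2) :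
    B.form₀ (b.e r) (b.e s) = sympMatrix k r s := b.form_e r s

theorem sympMatrix_eq_kronecker (k : ℕ) : sympMatrix k =
    Matrix.kroneckerMap (· * ·) (1 : Matrix (Fin k) (Fin k) ℝ) !![(0 : ℝ), 1; -1, 0] := by
  ext r s
  simp [sympMatrix, Matrix.one_apply]

theorem det_sympMatrix (k : ℕ) : (sympMatrix k).det = 1 := by
  rw [sympMatrix_eq_kronecker, Matrix.det_kronecker, Matrix.det_fin_two]
  simp

theorem sympMatrix_transpose (k : ℕ) : (sympMatrix k).transpose = -sympMatrix k := by
  ext ⟨r, a⟩ ⟨s, c⟩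
  simp only [sympMatrix, Matrix.transpose_apply, Matrix.of_apply, Matrix.neg_apply,
    eq_comm (a := s)]
  fin_cases a <;> fin_cases c <;> by_cases h : r = s <;> simp [h]

theorem gram_eq_mul (b : SymplecticBasis B k n) (X : spoEven B) :
    gram b X = sympMatrix k * realA b X := by
  ext r s
  have h : X.1.1 (b.e s) = ∑ t, coordA b t s X • b.e t :=
    (b.e.sum_repr (X.1.1 (b.e s))).symm
  rw [gram, Matrix.of_apply, h, map_sum, Matrix.mul_apply]
  refine Finset.sum_congr rfl fun t _ => ?_
  rw [map_smul, form_e_eq, smul_eq_mul, mul_comm]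
  rfl

theorem det_gram (b : SymplecticBasis B k n) (X : spoEven B) :
    (gram b X).det = (realA b X).det := by
  rw [gram_eq_mul, Matrix.det_mul, det_sympMatrix, one_mul]

theorem gram_inv_mul (b : SymplecticBasis B k n) (X : spoEven B) :
    (gram b X)⁻¹ * (sympMatrix k).transpose = -(realA b X)⁻¹ := by
  have h : IsUnit (sympMatrix k).det := by rw [det_sympMatrix]; exact isUnit_one
  rw [gram_eq_mul, Matrix.mul_inv_rev, sympMatrix_transpose, Matrix.mul_neg, Matrix.mul_assoc,
    Matrix.nonsing_inv_mul _ h, Matrix.mul_one]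

/-- The square of the length of `g_j`. -/
def lengthSq (b : SymplecticBasis B k n) (j : Fin n) : ℝ := if j ∈ b.neg then -1 else 1

theorem form_g_left (b : SymplecticBasis B k n) (j : Fin n) (w : V₁) :
    B.form₁ (b.g j) w = lengthSq b j * b.g.coord j w := by
  conv_lhs => rw [← b.g.sum_repr w, map_sum]
  simp only [map_smul, b.form_g, smul_eq_mul, Finset.sum_ite_eq, Finset.mem_univ, if_true, lengthSq,
    Module.Basis.coord_apply, mul_comm, ite_mul, neg_mul, one_mul, zero_mul]

theorem phase_ne_zero (b : SymplecticBasis B k n) {i : ℂ} (hi : i ^ 2 = -1) (j : Fin n) :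
    b.phase i j ≠ 0 := by
  have : i ≠ 0 := by rintro rfl; norm_num at hi
  rw [SymplecticBasis.phase]
  split_ifs
  exacts [this, one_ne_zero]

theorem phase_inv_mul_inv (b : SymplecticBasis B k n) {i : ℂ} (hi : i ^ 2 = -1) (j : Fin n) :
    (b.phase i j)⁻¹ * (b.phase i j)⁻¹ = lengthSq b j := by
  rw [SymplecticBasis.phase, lengthSq, ← mul_inv, ← sq]
  split_ifs
  · rw [hi]; norm_num
  · norm_num

variable (B) in
/-- The inclusion of the odd coordinates on `𝔰𝔭𝔬(V)` in all the odd coordinates. -/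
abbrev oddInr : (spoOdd B →ₗ[ℝ] ℂ) →ₗ[ℂ] (V₁ →ₗ[ℝ] ℂ) × (spoOdd B →ₗ[ℝ] ℂ) :=
  LinearMap.inr ℂ _ _

theorem pairVec_eq_coordC (b : SymplecticBasis B k n) (j : Fin n) (r : Fin k × Fin 2) :
    pairVec b j r = (lengthSq b j : ℂ) • oddInr B (complexForm (coordC b j r)) := by
  rw [← map_smul, pairVec, LinearMap.inr_apply, Prod.mk.injEq]
  refine ⟨rfl, ?_⟩
  ext G
  simp only [LinearMap.smul_apply, complexForm_apply, smul_eq_mul]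
  rw [← Complex.ofReal_mul]
  exact congrArg Complex.ofReal (form_g_left b j _)

/-- Odd invariance gives `B(g_l, G e_s) = B(G g_l, e_s)`. The same source can thus be written with
the entries of `C` or with those of `B`; using each form once turns `sᵀS⁻¹s` into an expression in
`C A⁻¹ B`. -/
theorem pairVec_eq_coordB (b : SymplecticBasis B k n) (l : Fin n) (s : Fin k × Fin 2) :
    pairVec b l s = ∑ t, (sympMatrix k t s : ℂ) • oddInr B (complexForm (coordB b t l)) := by
  simp only [← map_smul, ← map_sum]
  rw [pairVec, LinearMap.inr_apply, Prod.mk.injEq]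
  refine ⟨rfl, ?_⟩
  ext G
  simp only [LinearMap.sum_apply, LinearMap.smul_apply, complexForm_apply, smul_eq_mul,
    ← Complex.ofReal_mul, ← Complex.ofReal_sum]
  refine congrArg Complex.ofReal ?_
  have h1 : B.form₁ (b.g l) (G.1.2 (b.e s)) = B.form₀ (G.1.1 (b.g l)) (b.e s) :=
    (sub_eq_zero.mp (G.2.2 (b.g l) (b.e s))).symm
  have h : G.1.1 (b.g l) = ∑ t, coordB b t l G • b.e t := (b.e.sum_repr _).symm
  change B.form₁ (b.g l) (G.1.2 (b.e s)) = _
  rw [h1, h, map_sum, LinearMap.sum_apply]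
  refine Finset.sum_congr rfl fun t _ => ?_
  rw [map_smul, LinearMap.smul_apply, form_e_eq, smul_eq_mul, mul_comm]

/-- The pair `zw` is central, so it may be moved in front of `y`. -/
theorem EvenAlg.mul₂_mul_mul₂ {M : Type*} [AddCommGroup M] [Module ℂ M] (x y z w : M) :
    EvenAlg.mul₂ x y * EvenAlg.mul₂ z w = EvenAlg.mul₂ x z * EvenAlg.mul₂ w y := by
  apply EvenAlg.val_injective
  have h := (EvenAlg.commute (EvenAlg.mul₂ z w) (ExteriorAlgebra.ι ℂ y)).eq
  simp only [map_mul, EvenAlg.val_mul₂] at h ⊢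
  rw [mul_assoc, ← h]
  simp only [mul_assoc]

theorem oddSrc_mul_oddSrc (b : SymplecticBasis B k n) (r s : Fin k × Fin 2) :
    oddSrc b r * oddSrc b s = ∑ j, ∑ l, EvenAlg.mul₂ (pairVec b j r) (pairVec b l s) *
      EvenAlg.mul₂ (coordVec b l) (coordVec b j) := by
  rw [oddSrc, oddSrc, Finset.sum_mul_sum]
  exact Finset.sum_congr rfl fun j _ => Finset.sum_congr rfl fun l _ =>
    EvenAlg.mul₂_mul_mul₂ _ _ _ _

theorem sum_gram_inv_pairVec (b : SymplecticBasis B k n) (X : spoEven B) (j l : Fin n) :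
    ∑ r, ∑ s, ((gram b X)⁻¹ r s : ℂ) • EvenAlg.mul₂ (pairVec b j r) (pairVec b l s) =
      -((lengthSq b j : ℂ) • ∑ r, ∑ s, ((realA b X)⁻¹ r s : ℂ) •
        EvenAlg.mul₂ (oddInr B (complexForm (coordC b j r)))
          (oddInr B (complexForm (coordB b s l)))) := by
  have h (r t : Fin k × Fin 2) : ((realA b X)⁻¹ r t : ℂ) =
      -∑ s, ((gram b X)⁻¹ r s : ℂ) * (sympMatrix k t s : ℂ) := by
    have := congrFun (congrFun (gram_inv_mul b X) r) t
    rw [Matrix.mul_apply, Matrix.neg_apply] at this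
    rw [← neg_eq_iff_eq_neg, ← Complex.ofReal_neg, ← this]
    push_cast
    rfl
  rw [Finset.smul_sum, ← Finset.sum_neg_distrib]
  refine Finset.sum_congr rfl fun r _ => ?_
  have e (s : Fin k × Fin 2) : EvenAlg.mul₂ (pairVec b j r) (pairVec b l s) =
      (lengthSq b j : ℂ) • ∑ t, (sympMatrix k t s : ℂ) •
        EvenAlg.mul₂ (oddInr B (complexForm (coordC b j r)))
          (oddInr B (complexForm (coordB b t l))) := by
    rw [pairVec_eq_coordC, pairVec_eq_coordB, ← EvenAlg.mul₂ₗ_apply, map_smul, map_sum,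
      Finset.smul_sum]
    refine Finset.sum_congr rfl fun t _ => ?_
    rw [map_smul, LinearMap.smul_apply, smul_comm]
    rfl
  simp only [e, h, neg_smul, Finset.sum_smul, Finset.smul_sum, Finset.sum_neg_distrib, smul_neg,
    neg_neg, smul_smul]
  rw [Finset.sum_comm]
  refine Finset.sum_congr rfl fun t _ => Finset.sum_congr rfl fun s _ => ?_
  congr 1
  ring

theorem regMatrix_zero_inv {i : ℂ} (hi : i ^ 2 = -1) (b : SymplecticBasis B k n) {X : spoEven B}
    (hX : X ∈ regularSet B) :
    (regMatrix i (gram b X) 0)⁻¹ = (-i) • ((gram b X)⁻¹).map Complex.ofReal := by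
  have h : (gram b X).map Complex.ofReal * ((gram b X)⁻¹).map Complex.ofReal = 1 := by
    have := congrArg (fun M : Matrix _ _ ℝ => M.map Complex.ofRealHom)
      (Matrix.mul_nonsing_inv (gram b X) (isUnit_iff_ne_zero.mpr ((mem_regularSet_iff b X).mp hX)))
    simp only [Matrix.map_mul, Matrix.map_one, map_zero, map_one] at this
    exact this
  refine Matrix.inv_eq_right_inv ?_
  rw [regMatrix, Complex.ofReal_zero, mul_zero, zero_smul, zero_add, Matrix.smul_mul,
    Matrix.mul_smul, h, smul_smul, mul_neg, ← sq, hi, neg_neg, one_smul]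

/-- The linear forms underlying the coordinates dual to `f`. -/
def orthoVec (b : SymplecticBasis B k n) (i : ℂ) (j : Fin n) :
    (V₁ →ₗ[ℝ] ℂ) × (spoOdd B →ₗ[ℝ] ℂ) := (b.phase i j)⁻¹ • coordVec b j

theorem smul_neg_smul {E : Type*} [AddCommGroup E] [Module ℂ E] (a c : ℂ) (z : E) :
    a • -(c • z) = (-(a * c)) • z := by
  rw [smul_neg, smul_smul, neg_smul]

theorem smul_smul_add {E : Type*} [AddCommGroup E] [Module ℂ E] (a c : ℂ) (x z : E) :
    a • (c • x + z) = (a * c) • x + a • z := by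
  rw [smul_add, smul_smul]

/-- Passing from `g` to `f` divides each coordinate by its phase. The phases of `l` cancel, those of
`j` leave `phase⁻² = B(g_j, g_j)`, which converts the matrix entry into a value of the form. -/
theorem map_spfMatrix_mul {i : ℂ} (hi : i ^ 2 = -1) (b : SymplecticBasis B k n) (X : spoEven B)
    (j l : Fin n) :
    EvenAlg.map (oddInr B) (spfMatrix b i X j l) *
      EvenAlg.mul₂ (orthoVec b i l) (orthoVec b i j) =
    (((B.form₁ (b.g j) (X.1.2 (b.g l)) : ℝ) : ℂ) • 1 -
      ∑ r, ∑ s, ((gram b X)⁻¹ r s : ℂ) • EvenAlg.mul₂ (pairVec b j r) (pairVec b l s)) *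
        EvenAlg.mul₂ (coordVec b l) (coordVec b j) := by
  have h1 : EvenAlg.mul₂ (orthoVec b i l) (orthoVec b i j) =
      ((b.phase i l)⁻¹ * (b.phase i j)⁻¹) • EvenAlg.mul₂ (coordVec b l) (coordVec b j) := by
    rw [← EvenAlg.mul₂ₗ_apply, orthoVec, orthoVec, map_smul, map_smul, LinearMap.smul_apply,
      smul_smul, mul_comm]
    rfl
  have h2 : ((b.phase i j)⁻¹ * b.phase i l) * ((b.phase i l)⁻¹ * (b.phase i j)⁻¹) =
      lengthSq b j := by
    rw [← phase_inv_mul_inv b hi]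
    have := phase_ne_zero b hi l
    field_simp
  have h3 : EvenAlg.map (oddInr B) ((coordD b j l X : ℂ) • 1 + ∑ r, ∑ s,
      ((realA b X)⁻¹ r s : ℂ) •
        EvenAlg.mul₂ (complexForm (coordC b j r)) (complexForm (coordB b s l))) =
      (coordD b j l X : ℂ) • 1 + ∑ r, ∑ s, ((realA b X)⁻¹ r s : ℂ) •
        EvenAlg.mul₂ (oddInr B (complexForm (coordC b j r)))
          (oddInr B (complexForm (coordB b s l))) := by
    simp only [map_add, map_smul, map_one, map_sum, EvenAlg.map_mul₂]
  have h4 : (B.form₁ (b.g j) (X.1.2 (b.g l)) : ℂ) = lengthSq b j * coordD b j l X := by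
    rw [← Complex.ofReal_mul]
    exact congrArg Complex.ofReal (form_g_left b j _)
  rw [h1, spfMatrix, map_smul, h3, smul_mul_smul_comm, h2, ← smul_mul_assoc,
    sum_gram_inv_pairVec, h4, sub_neg_eq_add]
  congr 1
  exact smul_smul_add _ _ _ _

/-- The odd part of `B(v, Xv)` after completing the square in the even coordinates. -/
theorem exponent_eq {i : ℂ} (hi : i ^ 2 = -1) (b : SymplecticBasis B k n) {X : spoEven B}
    (hX : X ∈ regularSet B) :
    (-(i / 2)) • oddSq b X + ∑ r, ∑ s, ((1 / 2 : ℂ) • (regMatrix i (gram b X) 0)⁻¹) r s •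
        ((-i) • oddSrc b r * (-i) • oddSrc b s) =
      (-(i / 2)) • ∑ j, ∑ l, EvenAlg.map (oddInr B) (spfMatrix b i X j l) *
        EvenAlg.mul₂ (orthoVec b i l) (orthoVec b i j) := by
  -- The scalars agree because `½ · (-i) · (-i)² = i/2`, by `i² = -1`.
  have h1 (r s : Fin k × Fin 2) : ((1 / 2 : ℂ) • (regMatrix i (gram b X) 0)⁻¹) r s •
      ((-i) • oddSrc b r * (-i) • oddSrc b s) =
      (-(i / 2)) • -(((gram b X)⁻¹ r s : ℂ) • (oddSrc b r * oddSrc b s)) := by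
    rw [regMatrix_zero_inv hi b hX, smul_mul_smul_comm, smul_smul, smul_neg_smul]
    congr 1
    simp only [Matrix.smul_apply, Matrix.map_apply, smul_eq_mul]
    linear_combination (-(i / 2) * ((gram b X)⁻¹ r s : ℂ)) * hi
  simp only [h1, ← Finset.smul_sum, ← smul_add, Finset.sum_neg_distrib]
  congr 1
  have h2 : ∑ r, ∑ s, ((gram b X)⁻¹ r s : ℂ) • (oddSrc b r * oddSrc b s) =
      ∑ j, ∑ l, (∑ r, ∑ s, ((gram b X)⁻¹ r s : ℂ) •
        EvenAlg.mul₂ (pairVec b j r) (pairVec b l s)) *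
          EvenAlg.mul₂ (coordVec b l) (coordVec b j) := by
    simp only [oddSrc_mul_oddSrc, Finset.smul_sum, Finset.sum_mul, smul_mul_assoc]
    rw [Finset.sum_congr rfl fun r _ => Finset.sum_comm, Finset.sum_comm]
    refine Finset.sum_congr rfl fun j _ => ?_
    rw [Finset.sum_congr rfl fun r _ => Finset.sum_comm, Finset.sum_comm]
  simp only [map_spfMatrix_mul hi, sub_mul, Finset.sum_sub_distrib, h2, smul_mul_assoc, one_mul]
  rw [oddSq, sub_eq_add_neg]

/-- After the two exponentials are merged, the contractions are dual to the coordinates of `f`, so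
all `a j` equal 1, and the constant of `berezinMap_exp` is `(-2 · (-i/2))^(n/2)`. -/
theorem gaussValue_eq {i : ℂ} (hi : i ^ 2 = -1) (b : SymplecticBasis B k n) {X : spoEven B}
    (hX : X ∈ regularSet B) :
    gaussValue b i ((1 / 2 : ℂ) • (regMatrix i (gram b X) 0)⁻¹) X =
      i ^ (n / 2) • EvenAlg.val (spoOdd B →ₗ[ℝ] ℂ) (pfaffian (spfMatrix b i X)) := by
  have hN : IsNilpotent (∑ r, ∑ s, ((1 / 2 : ℂ) • (regMatrix i (gram b X) 0)⁻¹) r s •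
      ((-i) • oddSrc b r * (-i) • oddSrc b s)) :=
    ⟨_, EvenAlg.pow_eq_zero (by
      simp only [map_sum, map_smul, map_mul, algebraMapInv_oddSrc, smul_zero, mul_zero,
        Finset.sum_const_zero])⟩
  rw [gaussValue, berezinExp_apply, ← IsNilpotent.exp_add_of_commute (Commute.all _ _)
    ⟨_, oddSq_pow_eq_zero b _ X⟩ hN, exponent_eq hi b hX]
  let d (j : Fin n) : Module.Dual ℂ ((V₁ →ₗ[ℝ] ℂ) × (spoOdd B →ₗ[ℝ] ℂ)) :=
    { toFun := fun φ => b.phase i j * φ.1 (b.g j)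
      map_add' := fun φ ψ => by simp [mul_add]
      map_smul' := fun c φ => by simp [mul_left_comm] }
  have hd (j l : Fin n) : d j (orthoVec b i l) = if j = l then 1 else 0 := by
    change b.phase i j * ((b.phase i l)⁻¹ * ((b.g.coord l (b.g j) : ℝ) : ℂ)) = _
    rw [Module.Basis.coord_apply, Module.Basis.repr_self, Finsupp.single_apply]
    split_ifs with h
    · subst h
      simp [phase_ne_zero b hi]
    · simp
  have hb : berezin b i = berezinMap d (LinearMap.snd ℂ (V₁ →ₗ[ℝ] ℂ) (spoOdd B →ₗ[ℝ] ℂ)) := by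
    rw [berezin, berezinMap, List.map_ofFn]
    rfl
  rw [hb, berezinMap_exp (a := fun _ => 1) hd (fun j x => by simp [d])
    (LinearMap.snd_comp_inr ℂ _ _)]
  simp only [Finset.prod_const_one, mul_one]
  congr 2
  ring

end Representative

/-! ### The integral of the superPfaffian -/

section IntegralFormula

open MeasureTheory

theorem cpow_half_ofReal_mul {t : ℝ} (ht : 0 < t) {z : ℂ} (hz : z ≠ 0) :
    ((t : ℂ) * z) ^ (1 / 2 : ℂ) = (√t : ℂ) * z ^ (1 / 2 : ℂ) := by
  have ht0 : (t : ℂ) ≠ 0 := by exact_mod_cast ht.ne'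
  have h : (t : ℂ) ^ (1 / 2 : ℂ) = (√t : ℂ) := by
    rw [Real.sqrt_eq_rpow, Complex.ofReal_cpow ht.le]
    norm_num
  rw [← h, Complex.cpow_def_of_ne_zero (mul_ne_zero ht0 hz), Complex.cpow_def_of_ne_zero ht0,
    Complex.cpow_def_of_ne_zero hz, Complex.log_ofReal_mul ht hz, ← Complex.ofReal_log ht.le,
    ← Complex.exp_add, add_mul]

theorem ne_zero_of_sq_eq_neg_one {i : ℂ} (hi : i ^ 2 = -1) : i ≠ 0 := by
  rintro rfl
  norm_num at hi

theorem eq_I_or_eq_neg_I {i : ℂ} (hi : i ^ 2 = -1) : i = Complex.I ∨ i = -Complex.I := by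
  rw [← Complex.I_sq, sq_eq_sq_iff_eq_or_eq_neg] at hi
  exact hi

/-- For both square roots of `-1`, the principal logarithms of `i` and `-i` are opposite. -/
theorem cpow_half_mul_cpow_half_neg {i : ℂ} (hi : i ^ 2 = -1) :
    i ^ (1 / 2 : ℂ) * (-i) ^ (1 / 2 : ℂ) = 1 := by
  have h0 := ne_zero_of_sq_eq_neg_one hi
  rw [Complex.cpow_def_of_ne_zero h0, Complex.cpow_def_of_ne_zero (neg_ne_zero.mpr h0),
    ← Complex.exp_add, ← add_mul]
  have : Complex.log i + Complex.log (-i) = 0 := by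
    rcases eq_I_or_eq_neg_I hi with rfl | rfl
    · rw [Complex.log_I, Complex.log_neg_I]; ring
    · rw [neg_neg, Complex.log_I, Complex.log_neg_I]; ring
  rw [this, zero_mul, Complex.exp_zero]

/-- `π / (it/2)` is `2π/|t|` times `i` or `-i` according to the sign of `t`, and positive factors
leave the principal root. -/
theorem cpow_half_gaussian {i : ℂ} (hi : i ^ 2 = -1) {t : ℝ} (ht : t ≠ 0) :
    ((Real.pi : ℂ) / ((0 : ℝ) + i / 2 * t)) ^ (1 / 2 : ℂ) =
      (√(2 * Real.pi / |t|) : ℂ) *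
        if t < 0 then i ^ (1 / 2 : ℂ) else (-i) ^ (1 / 2 : ℂ) := by
  have h0 := ne_zero_of_sq_eq_neg_one hi
  have ht' : (t : ℂ) ≠ 0 := by exact_mod_cast ht
  have hp : 0 < 2 * Real.pi / |t| := by positivity
  rw [Complex.ofReal_zero, zero_add]
  split_ifs with h
  · rw [← cpow_half_ofReal_mul hp h0, abs_of_neg h]
    congr 1
    push_cast
    field_simp
    linear_combination hi
  · rw [← cpow_half_ofReal_mul hp (neg_ne_zero.mpr h0), abs_of_nonneg (not_lt.mp h)]
    congr 1
    push_cast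
    field_simp
    linear_combination hi

/-- Write `i^k` as `2k` half powers, one for each eigenvalue. A positive eigenvalue cancels its half
power, a negative one completes it to a factor `i`. -/
theorem prod_cpow_half_gaussian {i : ℂ} (hi : i ^ 2 = -1) {k : ℕ} {l : Fin k × Fin 2 → ℝ}
    (hl : ∀ j, l j ≠ 0) :
    i ^ k * ((2 * Real.pi : ℝ) : ℂ)⁻¹ ^ k *
        ∏ j, ((Real.pi : ℂ) / ((0 : ℝ) + i / 2 * l j)) ^ (1 / 2 : ℂ) =
      i ^ {j | l j < 0}.ncard * ((√|∏ j, l j|)⁻¹ : ℝ) := by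
  have hpi : 0 < 2 * Real.pi := by positivity
  have h1 : ∏ j, (√(2 * Real.pi / |l j|) : ℂ) =
      ((2 * Real.pi : ℝ) : ℂ) ^ k * ((√|∏ j, l j|)⁻¹ : ℝ) := by
    rw [← Complex.ofReal_prod, ← Complex.ofReal_pow, ← Complex.ofReal_mul]
    congr 1
    have h (j : Fin k × Fin 2) : √(2 * Real.pi / |l j|) = √(2 * Real.pi) / √|l j| :=
      Real.sqrt_div hpi.le _
    simp only [h, Finset.prod_div_distrib, Finset.prod_const, Finset.card_univ,
      Fintype.card_prod, Fintype.card_fin]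
    rw [Finset.abs_prod, Real.sqrt_prod _ fun j _ => abs_nonneg _, mul_comm k 2, pow_mul,
      Real.sq_sqrt hpi.le, div_eq_mul_inv]
  have h2 : i ^ k * ∏ j, (if l j < 0 then i ^ (1 / 2 : ℂ) else (-i) ^ (1 / 2 : ℂ)) =
      i ^ {j | l j < 0}.ncard := by
    have hsq : (i ^ (1 / 2 : ℂ)) ^ 2 = i := by simp
    have hc : (2 * k : ℕ) = (Finset.univ.filter fun j => l j < 0).card +
        (Finset.univ.filter fun j => ¬ l j < 0).card := by
      rw [Finset.card_filter_add_card_filter_not, Finset.card_univ, Fintype.card_prod,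
        Fintype.card_fin, Fintype.card_fin, mul_comm]
    have hn : {j | l j < 0}.ncard = (Finset.univ.filter fun j => l j < 0).card := by
      rw [← Set.ncard_coe_finset]
      simp
    rw [Finset.prod_ite, Finset.prod_const, Finset.prod_const, hn]
    conv_lhs => rw [← hsq, ← pow_mul, hc]
    conv_rhs => rw [← hsq, ← pow_mul]
    rw [hsq]
    generalize (Finset.univ.filter fun j => l j < 0).card = p
    generalize (Finset.univ.filter fun j => ¬ l j < 0).card = q
    have := cpow_half_mul_cpow_half_neg hi
    generalize i ^ (1 / 2 : ℂ) = u at *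
    generalize (-i) ^ (1 / 2 : ℂ) = v at *
    calc u ^ (p + q) * (u ^ p * v ^ q) = u ^ (2 * p) * (u * v) ^ q := by rw [mul_pow]; ring
      _ = _ := by rw [this, one_pow, mul_one]
  simp only [cpow_half_gaussian hi (hl _), Finset.prod_mul_distrib]
  rw [h1, ← h2, inv_pow]
  have : ((2 * Real.pi : ℝ) : ℂ) ^ k ≠ 0 := pow_ne_zero _ (by exact_mod_cast hpi.ne')
  field_simp

variable {V₀ V₁ : Type*} [NormedAddCommGroup V₀] [NormedSpace ℝ V₀] [FiniteDimensional ℝ V₀]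
  [NormedAddCommGroup V₁] [NormedSpace ℝ V₁] [FiniteDimensional ℝ V₁]
  {B : SymplecticForm V₀ V₁} {k n : ℕ}

theorem quadForm_evenPoint (b : SymplecticBasis B k n) (X : spoEven B)
    (x : Fin k × Fin 2 → ℝ) : quadForm X (evenPoint b x) = quadSum (gram b X) x :=
  form_evenPoint b X x

/-- Principal axes identify the signature with the count of signs of the eigenvalues. -/
theorem quadForm_equivalent (b : SymplecticBasis B k n) {X : spoEven B}
    {O : Matrix (Fin k × Fin 2) (Fin k × Fin 2) ℝ} {l : Fin k × Fin 2 → ℝ}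
    (hO : O.transpose * O = 1) (hS : gram b X = O * Matrix.diagonal l * O.transpose) :
    QuadraticMap.Equivalent (quadForm X) (QuadraticMap.weightedSumSquares ℝ l) := by
  refine ⟨QuadraticMap.IsometryEquiv.symm
    { toLinearEquiv := (Matrix.toLin'OfInv hO (mul_eq_one_comm.mp hO)).trans b.e.equivFun.symm
      map_app' := fun y => ?_ }⟩
  have h : ((Matrix.toLin'OfInv hO (mul_eq_one_comm.mp hO)).trans b.e.equivFun.symm) y =
      evenPoint b (Matrix.toLin' O y) := by
    rw [LinearEquiv.trans_apply, Module.Basis.equivFun_symm_apply]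
    rfl
  change quadForm X (((Matrix.toLin'OfInv hO (mul_eq_one_comm.mp hO)).trans
    b.e.equivFun.symm) y) = _
  rw [h, quadForm_evenPoint, quadSum_rotate hO hS, QuadraticMap.weightedSumSquares_apply]
  simp only [smul_eq_mul, sq]

/-- For odd `n` both sides vanish, so the half-integral power of `i` plays no role; for even `n` its
exponent is the integer `k - n/2`, and `n/2` cancels against the Berezin integral. -/
theorem spfFun_eq {i : ℂ} (hi : i ^ 2 = -1) (b : SymplecticBasis B k n) {X : spoEven B}
    (hX : X ∈ regularSet B) {O : Matrix (Fin k × Fin 2) (Fin k × Fin 2) ℝ}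
    {l : Fin k × Fin 2 → ℝ} (hO : O.transpose * O = 1)
    (hS : gram b X = O * Matrix.diagonal l * O.transpose) :
    spfFun b i X = (i ^ (((2 * k : ℂ) - n) / 2) * ((2 * Real.pi : ℝ) : ℂ)⁻¹ ^ k) •
      (∏ j, ((Real.pi : ℂ) / ((0 : ℝ) + i / 2 * l j)) ^ (1 / 2 : ℂ)) •
        gaussValue b i ((1 / 2 : ℂ) • (regMatrix i (gram b X) 0)⁻¹) X := by
  rw [gaussValue_eq hi b hX, spfFun]
  by_cases hn : Even n
  · have hdet : (realA b X).det = ∏ j, l j := by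
      rw [← det_gram, hS, Matrix.det_mul_comm, ← Matrix.mul_assoc, hO, Matrix.one_mul,
        Matrix.det_diagonal]
    have hi0 := ne_zero_of_sq_eq_neg_one hi
    rw [QuadraticForm.sigNeg_of_equiv_weightedSumSquares (quadForm_equivalent b hO hS), hdet,
      ← prod_cpow_half_gaussian hi
        (diagonal_ne_zero hO hS ((mem_regularSet_iff b X).mp hX)), smul_smul, smul_smul]
    congr 1
    obtain ⟨h, rfl⟩ := hn
    have e1 : (((2 * k : ℂ) - (h + h : ℕ)) / 2) = (k : ℂ) - (h : ℂ) := by push_cast; ring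
    rw [e1, Complex.cpow_sub _ _ hi0, Complex.cpow_natCast, Complex.cpow_natCast,
      show (h + h) / 2 = h by omega]
    field_simp
  · rw [pfaffian, if_neg hn, map_zero, smul_zero, smul_zero, smul_zero, smul_zero]

theorem spf_eq_integral_spfFun {i : ℂ} (hi : i ^ 2 = -1) (b : SymplecticBasis B k n)
    {ν : Measure (spoEven B)} [ν.IsAddHaarMeasure] {ρ : spoEven B → ℂ} (hρ : ContDiff ℝ ∞ ρ)
    (hc : HasCompactSupport ρ) (hs : tsupport ρ ⊆ regularSet B) :
    spf b i ν ρ = ∫ X, ρ X • spfFun b i X ∂ν := by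
  have hc0 : i ^ (((2 * k : ℂ) - n) / 2) * ((2 * Real.pi : ℝ) : ℂ)⁻¹ ^ k ≠ 0 := by
    have : ((2 * Real.pi : ℝ) : ℂ) ≠ 0 := by exact_mod_cast (by positivity : (2 * Real.pi) ≠ 0)
    refine mul_ne_zero ?_ (pow_ne_zero _ (inv_ne_zero this))
    rw [Complex.cpow_def_of_ne_zero (ne_zero_of_sq_eq_neg_one hi)]
    exact Complex.exp_ne_zero _
  rw [spf, spf_eq_integral hi b hρ hc hs (F := fun X =>
    (i ^ (((2 * k : ℂ) - n) / 2) * ((2 * Real.pi : ℝ) : ℂ)⁻¹ ^ k)⁻¹ • spfFun b i X)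
    (fun X hX O l hO hS => by rw [spfFun_eq hi b hX hO hS, inv_smul_smul₀ hc0]), ← integral_smul]
  refine integral_congr_ae (Filter.Eventually.of_forall fun X => ?_)
  dsimp only
  rw [smul_comm, smul_inv_smul₀ hc0]

end IntegralFormula

/-! ### Analyticity -/

section Analyticity

open Filter Topology

variable {V₀ V₁ : Type*} [NormedAddCommGroup V₀] [NormedSpace ℝ V₀] [FiniteDimensional ℝ V₀]
  [NormedAddCommGroup V₁] [NormedSpace ℝ V₁] [FiniteDimensional ℝ V₁]
  {B : SymplecticForm V₀ V₁} {k n : ℕ}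

theorem sigPos_add_sigNeg_eq_iff (b : SymplecticBasis B k n) (X : spoEven B) :
    sigPos (quadForm X) + sigNeg (quadForm X) = 2 * k ↔ X ∈ regularSet B := by
  obtain ⟨O, l, hO, hS⟩ := exists_diagonalization (gram_transpose b X)
  have h := quadForm_equivalent b hO hS
  have hdet : (gram b X).det = ∏ j, l j := by
    rw [hS, Matrix.det_mul_comm, ← Matrix.mul_assoc, hO, Matrix.one_mul, Matrix.det_diagonal]
  have hcard : {j | l j ≠ 0}.ncard = {j | 0 < l j}.ncard + {j | l j < 0}.ncard := by
    rw [← Set.ncard_union_eq]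
    · congr 1
      ext j
      simp [lt_or_lt_iff_ne, ne_comm]
    · exact Set.disjoint_left.mpr fun j (h1 : 0 < l j) (h2 : l j < 0) => lt_asymm h1 h2
  have huniv : 2 * k = (Set.univ : Set (Fin k × Fin 2)).ncard := by
    rw [Set.ncard_univ, Nat.card_eq_fintype_card, Fintype.card_prod, Fintype.card_fin,
      Fintype.card_fin, mul_comm]
  rw [QuadraticForm.sigPos_of_equiv_weightedSumSquares h,
    QuadraticForm.sigNeg_of_equiv_weightedSumSquares h, ← hcard, mem_regularSet_iff b, hdet,
    Finset.prod_ne_zero_iff, huniv]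
  constructor
  · intro h j _
    have := Set.eq_of_subset_of_ncard_le (Set.subset_univ {j | l j ≠ 0}) h.ge
    exact this.symm.subset (Set.mem_univ j)
  · intro h
    congr 1
    exact Set.eq_univ_of_forall fun j => h j (Finset.mem_univ j)

/-- The sign of `det A = det S` is given by the number of negative eigenvalues. -/
theorem neg_one_pow_sigNeg_mul (b : SymplecticBasis B k n) (X : spoEven B) :
    (-1) ^ sigNeg (quadForm X) * |(realA b X).det| = (realA b X).det := by
  obtain ⟨O, l, hO, hS⟩ := exists_diagonalization (gram_transpose b X)
  have hdet : (realA b X).det = ∏ j, l j := by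
    rw [← det_gram, hS, Matrix.det_mul_comm, ← Matrix.mul_assoc, hO, Matrix.one_mul,
      Matrix.det_diagonal]
  have h1 : (-1 : ℝ) ^ {j | l j < 0}.ncard = ∏ j, if l j < 0 then -1 else 1 := by
    have : {j | l j < 0}.ncard = (Finset.univ.filter fun j => l j < 0).card := by
      rw [← Set.ncard_coe_finset]
      simp
    rw [Finset.prod_ite, Finset.prod_const, Finset.prod_const_one, mul_one, this]
  rw [QuadraticForm.sigNeg_of_equiv_weightedSumSquares (quadForm_equivalent b hO hS), hdet, h1,
    Finset.abs_prod, ← Finset.prod_mul_distrib]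
  refine Finset.prod_congr rfl fun j _ => ?_
  split_ifs with h
  · rw [abs_of_neg h]; ring
  · rw [abs_of_nonneg (not_lt.mp h), one_mul]

theorem quadForm_apply (X : spoEven B) (v : V₀) : quadForm X v = B.form₀ v (X.1.1 v) := rfl

theorem quadForm_neg (X : spoEven B) : quadForm (-X) = -quadForm X := by
  ext v
  rw [neg_apply, quadForm_apply, quadForm_apply]
  exact map_neg (B.form₀ v) _

theorem continuous_quadForm :
    Continuous fun p : spoEven B × V₀ => quadForm p.1 p.2 := by
  have h : Continuous fun q : V₀ × V₀ => B.form₀ q.1 q.2 :=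
    (LinearMap.toContinuousBilinearMap B.form₀).continuous₂
  have h1 : Continuous fun p : spoEven B × V₀ => p.1.1.1 p.2 :=
    (continuous_fst.comp (continuous_subtype_val.comp continuous_fst)).clm_apply continuous_snd
  exact h.comp (continuous_snd.prodMk h1)

/-- The form is positive on the compact unit sphere of a maximal positive definite subspace, and
remains so for nearby elements: the positive index is lower semicontinuous. -/
theorem eventually_sigPos_le (X : spoEven B) :
    ∀ᶠ Y in 𝓝 X, sigPos (quadForm X) ≤ sigPos (quadForm Y) := by
  obtain ⟨W, hW, hpos⟩ := exists_finrank_eq_sigPos_and_posDef (quadForm X)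
  have hK : IsCompact (Metric.sphere (0 : V₀) 1 ∩ (W : Set V₀)) :=
    (isCompact_sphere 0 1).inter_right W.closed_of_finiteDimensional
  have hev : ∀ᶠ Y in 𝓝 X, ∀ v ∈ Metric.sphere (0 : V₀) 1 ∩ (W : Set V₀), 0 < quadForm Y v := by
    refine hK.eventually_forall_of_forall_eventually fun v hv => ?_
    have hv0 : (⟨v, hv.2⟩ : W) ≠ 0 := fun h => by
      have h0 : v = 0 := congrArg Subtype.val h
      have h1 := hv.1
      rw [h0] at h1
      simp at h1
    have h1 : 0 < quadForm X v := hpos ⟨v, hv.2⟩ hv0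
    exact continuous_quadForm.continuousAt.eventually (lt_mem_nhds h1)
  filter_upwards [hev] with Y hY
  rw [← hW]
  refine le_sigPos_of_posDef _ fun w hw => ?_
  have hn : ‖(w : V₀)‖ ≠ 0 := by simpa using hw
  have h1 := hY (‖(w : V₀)‖⁻¹ • (w : V₀)) ⟨by simp [norm_smul, hn], W.smul_mem _ w.2⟩
  rw [QuadraticMap.map_smul, smul_eq_mul] at h1
  exact pos_of_mul_pos_right h1 (mul_self_nonneg _)

theorem isOpen_regularSet (b : SymplecticBasis B k n) : IsOpen (regularSet B) := by
  have h : Continuous fun X : spoEven B => (gram b X).det := by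
    refine Continuous.matrix_det (continuous_matrix fun r s => ?_)
    exact (gramCLM b r s).continuous
  have h1 : regularSet B = (fun X : spoEven B => (gram b X).det) ⁻¹' {0}ᶜ := by
    ext X
    exact mem_regularSet_iff b X
  rw [h1]
  exact isOpen_compl_singleton.preimage h

/-- Semicontinuity at `X` and at `-X` bounds both indices from below; their sum is `2k` near a
regular element, so neither can increase. -/
theorem eventually_sigNeg_eq (b : SymplecticBasis B k n) {X : spoEven B}
    (hX : X ∈ regularSet B) : ∀ᶠ Y in 𝓝 X, sigNeg (quadForm Y) = sigNeg (quadForm X) := by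
  have h := (continuous_neg.tendsto X).eventually (eventually_sigPos_le (-X))
  filter_upwards [eventually_sigPos_le X, h, (isOpen_regularSet b).mem_nhds hX] with Y h1 h2 h3
  rw [quadForm_neg, quadForm_neg, sigPos_neg, sigPos_neg] at h2
  have h4 := (sigPos_add_sigNeg_eq_iff b X).mpr hX
  have h5 := (sigPos_add_sigNeg_eq_iff b Y).mpr h3
  omega

theorem analyticAt_linear {W E : Type*} [NormedAddCommGroup W] [NormedSpace ℝ W]
    [FiniteDimensional ℝ W] [NormedAddCommGroup E] [NormedSpace ℝ E] (f : W →ₗ[ℝ] E) (x : W) :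
    AnalyticAt ℝ f x :=
  (LinearMap.toContinuousLinearMap f).analyticAt x

theorem analyticAt_det {W α : Type*} [NormedAddCommGroup W] [NormedSpace ℝ W] [Fintype α]
    [DecidableEq α] {A : W → Matrix α α ℝ} {x : W} (h : ∀ r s, AnalyticAt ℝ (fun y => A y r s) x) :
    AnalyticAt ℝ (fun y => (A y).det) x := by
  simp only [Matrix.det_apply']
  refine Finset.analyticAt_fun_sum _ fun σ _ => analyticAt_const.fun_mul ?_
  exact Finset.analyticAt_fun_prod _ fun r _ => h _ _

theorem analyticAt_inv_apply {W α : Type*} [NormedAddCommGroup W] [NormedSpace ℝ W] [Fintype α]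
    [DecidableEq α] {A : W → Matrix α α ℝ} {x : W} (h : ∀ r s, AnalyticAt ℝ (fun y => A y r s) x)
    (h0 : (A x).det ≠ 0) (r s : α) : AnalyticAt ℝ (fun y => (A y)⁻¹ r s) x := by
  simp only [Matrix.inv_def, Ring.inverse_eq_inv', Matrix.smul_apply, smul_eq_mul,
    Matrix.adjugate_apply]
  refine ((analyticAt_det h).inv h0).mul (analyticAt_det fun r' s' => ?_)
  simp only [Matrix.updateRow_apply]
  split_ifs
  exacts [analyticAt_const, h _ _]

theorem analyticAt_inv_sqrt_abs {W : Type*} [NormedAddCommGroup W] [NormedSpace ℝ W] {f : W → ℝ}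
    {x : W} (hf : AnalyticAt ℝ f x) (h0 : f x ≠ 0) :
    AnalyticAt ℝ (fun y => (√|f y|)⁻¹) x := by
  -- Near a nonzero value, `1/√|f|` equals `exp(-log(f²)/4)`, which avoids the absolute value.
  have h1 : AnalyticAt ℝ (fun y => Real.exp (-(Real.log (f y ^ 2) / 4))) x := by
    have h3 : AnalyticAt ℝ Real.log (f x ^ 2) := analyticAt_log (by positivity)
    have h2 : AnalyticAt ℝ (fun y => Real.log (f y ^ 2)) x :=
      AnalyticAt.comp (f := fun y => f y ^ 2) h3 (hf.fun_pow 2)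
    exact AnalyticAt.comp (f := fun y => -(Real.log (f y ^ 2) / 4)) analyticAt_rexp
      h2.div_const.neg
  refine h1.congr ?_
  filter_upwards [hf.continuousAt.eventually_ne h0] with y hy
  have hpos : 0 < |f y| := abs_pos.mpr hy
  rw [Real.exp_neg, Real.sqrt_eq_rpow, Real.rpow_def_of_pos hpos, ← sq_abs, Real.log_pow]
  congr 2
  push_cast
  ring

variable (b : SymplecticBasis B k n) {i : ℂ} {X : spoEven B}

theorem realA_det_ne_zero (hX : X ∈ regularSet B) : (realA b X).det ≠ 0 := by
  rw [← det_gram]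
  exact (mem_regularSet_iff b X).mp hX

theorem analyticAt_realA (r s : Fin k × Fin 2) : AnalyticAt ℝ (fun Y => realA b Y r s) X :=
  analyticAt_linear (coordA b r s) X

theorem analyticAt_val_prod {W M β : Type*} [NormedAddCommGroup W] [NormedSpace ℝ W]
    [AddCommGroup M] [Module ℂ M] [FiniteDimensional ℂ M] {x : W} (s : Finset β)
    {f : β → W → EvenAlg M} (hf : ∀ r, AnalyticAt ℝ (fun y => EvenAlg.val M (f r y)) x) :
    AnalyticAt ℝ (fun y => EvenAlg.val M (∏ r ∈ s, f r y)) x := by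
  classical
  induction s using Finset.induction_on with
  | empty => simpa using analyticAt_const
  | insert a s ha ih =>
    simp only [Finset.prod_insert ha, map_mul]
    exact analyticAt_exterior_mul (hf a) ih

theorem analyticAt_ofReal {W : Type*} [NormedAddCommGroup W] [NormedSpace ℝ W] {f : W → ℝ}
    {x : W} (hf : AnalyticAt ℝ f x) : AnalyticAt ℝ (fun y => (f y : ℂ)) x :=
  (Complex.ofRealCLM.analyticAt _).comp hf

theorem val_spfMatrix (j l : Fin n) : EvenAlg.val (spoOdd B →ₗ[ℝ] ℂ) (spfMatrix b i X j l) =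
    ((b.phase i j)⁻¹ * b.phase i l) • ((coordD b j l X : ℂ) • 1 + ∑ r, ∑ s,
      ((realA b X)⁻¹ r s : ℂ) • (ExteriorAlgebra.ι ℂ (complexForm (coordC b j r)) *
        ExteriorAlgebra.ι ℂ (complexForm (coordB b s l)))) := by
  simp only [spfMatrix, map_smul, map_add, map_one, map_sum, EvenAlg.val_mul₂]

theorem analyticAt_val_spfMatrix (hX : X ∈ regularSet B) (j l : Fin n) :
    AnalyticAt ℝ (fun Y => EvenAlg.val (spoOdd B →ₗ[ℝ] ℂ) (spfMatrix b i Y j l)) X := by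
  simp only [val_spfMatrix]
  refine AnalyticAt.fun_const_smul (AnalyticAt.fun_add ?_ ?_)
  · have h : AnalyticAt ℝ (fun Y => ((coordD b j l Y : ℝ) : ℂ)) X :=
      analyticAt_ofReal (analyticAt_linear (coordD b j l) X)
    exact h.fun_smul analyticAt_const
  · refine Finset.analyticAt_fun_sum _ fun r _ => Finset.analyticAt_fun_sum _ fun s _ => ?_
    have h : AnalyticAt ℝ (fun Y => (((realA b Y)⁻¹ r s : ℝ) : ℂ)) X :=
      analyticAt_ofReal (analyticAt_inv_apply (analyticAt_realA b)
        (realA_det_ne_zero b hX) r s)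
    exact h.fun_smul analyticAt_const

theorem val_pfaffian {M : Type*} [AddCommGroup M] [Module ℂ M] {n : ℕ}
    (m : Matrix (Fin n) (Fin n) (EvenAlg M)) (hn : Even n) : EvenAlg.val M (pfaffian m) =
      ((2 ^ (n / 2) * (n / 2).factorial : ℂ)⁻¹) • ∑ s : Equiv.Perm (Fin n),
        (((Equiv.Perm.sign s : ℤˣ) : ℤ) : ℂ) • EvenAlg.val M
          (∏ r : Fin (n / 2), m (s ⟨2 * r + 1, by omega⟩) (s ⟨2 * r, by omega⟩)) := by
  rw [pfaffian, if_pos hn, map_smul, map_sum]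
  simp only [zsmul_eq_mul, map_mul, map_intCast, Int.cast_smul_eq_zsmul]

/-- The power of `i` is locally constant and may be frozen at its value at `X`; the other factors
are analytic. -/
theorem analyticAt_spfFun (hX : X ∈ regularSet B) : AnalyticAt ℝ (spfFun b i) X := by
  have h1 : AnalyticAt ℝ (fun Y => (i ^ sigNeg (quadForm X) *
      ((√|(realA b Y).det|)⁻¹ : ℝ)) •
        EvenAlg.val (spoOdd B →ₗ[ℝ] ℂ) (pfaffian (spfMatrix b i Y))) X := by
    have h2 : AnalyticAt ℝ (fun Y => i ^ sigNeg (quadForm X) *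
        (((√|(realA b Y).det|)⁻¹ : ℝ) : ℂ)) X :=
      analyticAt_const.fun_mul (analyticAt_ofReal (analyticAt_inv_sqrt_abs
        (analyticAt_det (analyticAt_realA b)) (realA_det_ne_zero b hX)))
    refine h2.fun_smul ?_
    by_cases hn : Even n
    · simp only [val_pfaffian _ hn]
      refine AnalyticAt.fun_const_smul (Finset.analyticAt_fun_sum _ fun s _ =>
        AnalyticAt.fun_const_smul ?_)
      exact analyticAt_val_prod _ fun r => analyticAt_val_spfMatrix b hX _ _
    · simp only [pfaffian, if_neg hn, map_zero]
      exact analyticAt_const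
  refine h1.congr ?_
  filter_upwards [eventually_sigNeg_eq b hX] with Y hY
  rw [spfFun, hY]

end Analyticity

/-! ### Taylor's formula with nilpotent increments -/

/-- Cauchy product of two finite series. The hypothesis `hw` discards the degrees from `N` on, so
all three sums can have the same length. -/
theorem sum_range_mul_sum_range {S : Type*} [Ring S] {N : ℕ} {u v : ℕ → S} (hu : ∀ d, N ≤ d → u d = 0)
    (hv : ∀ d, N ≤ d → v d = 0) (hw : ∀ d, N ≤ d → ∑ p ∈ Finset.HasAntidiagonal.antidiagonal d, u p.1 * v p.2 = 0) :
    ∑ d ∈ Finset.range N, ∑ p ∈ Finset.HasAntidiagonal.antidiagonal d, u p.1 * v p.2 =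
      (∑ d ∈ Finset.range N, u d) * ∑ d ∈ Finset.range N, v d := by
  have h : ∑ d ∈ Finset.range N, ∑ p ∈ Finset.HasAntidiagonal.antidiagonal d, u p.1 * v p.2 =
      ∑ d ∈ Finset.range (N + N), ∑ p ∈ Finset.HasAntidiagonal.antidiagonal d, u p.1 * v p.2 := by
    refine Finset.sum_subset (Finset.range_subset_range.mpr (Nat.le_add_left _ _)) fun d _ hd => ?_
    exact hw d (by simpa using hd)
  rw [h, Finset.sum_mul_sum, ← Finset.sum_product', ← Finset.sum_fiberwise_of_maps_to
    (s := Finset.range N ×ˢ Finset.range N) (t := Finset.range (N + N)) (g := fun p => p.1 + p.2)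
    (fun p hp => by simp only [Finset.mem_product, Finset.mem_range] at hp ⊢; omega)]
  refine Finset.sum_congr rfl fun d _ => ?_
  symm
  refine Finset.sum_subset (fun p hp => ?_) fun p hp hp' => ?_
  · simp only [Finset.mem_filter] at hp
    exact Finset.HasAntidiagonal.mem_antidiagonal.mpr hp.2
  · simp only [Finset.mem_filter, Finset.mem_product, Finset.mem_range, not_and] at hp'
    by_cases h1 : N ≤ p.1
    · rw [hu _ h1, zero_mul]
    · by_cases h2 : N ≤ p.2
      · rw [hv _ h2, mul_zero]
      · exact absurd (Finset.HasAntidiagonal.mem_antidiagonal.mp hp) (hp' ⟨not_le.mp h1, not_le.mp h2⟩)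

section Taylor

variable {M : Type*} [AddCommGroup M] [Module ℂ M] [FiniteDimensional ℂ M]
  {S A : Type*} [Ring S] [Algebra ℂ S] [CommRing A] (φ : ExteriorAlgebra ℂ M →ₐ[ℂ] S) (j : A →+* S)
  {W : Type*} [NormedAddCommGroup W] [NormedSpace ℝ W] {κ : Type*} [Fintype κ]
  (β : κ → W) (σ : κ → A)

/-- The `d`-th derivative of `φ ∘ f` in the direction `∑ βₗ σₗ`. -/
def jet : ℕ → (W → ExteriorAlgebra ℂ M) → W → S
  | 0, f, x => φ (f x)
  | d + 1, f, x => ∑ l, jet d (fun y => fderiv ℝ f y (β l)) x * j (σ l)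

variable {φ j β σ}

theorem analyticAt_fderiv_apply {f : W → ExteriorAlgebra ℂ M} {x : W} (hf : AnalyticAt ℝ f x)
    (v : W) : AnalyticAt ℝ (fun y => fderiv ℝ f y v) x := by
  have : FiniteDimensional ℝ (ExteriorAlgebra ℂ M) := FiniteDimensional.complexToReal _
  have : CompleteSpace (ExteriorAlgebra ℂ M) := FiniteDimensional.complete ℝ _
  have h := hf.fderiv
  exact ((ContinuousLinearMap.apply ℝ (ExteriorAlgebra ℂ M) v).analyticAt _).comp h

theorem jet_congr (d : ℕ) {f g : W → ExteriorAlgebra ℂ M} {x : W} (h : f =ᶠ[nhds x] g) :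
    jet φ j β σ d f x = jet φ j β σ d g x := by
  induction d generalizing f g with
  | zero => rw [jet, jet, h.eq_of_nhds]
  | succ d ih =>
    rw [jet, jet]
    refine Finset.sum_congr rfl fun l _ => ?_
    rw [ih (f := fun y => fderiv ℝ f y (β l)) (g := fun y => fderiv ℝ g y (β l))]
    exact h.fderiv.fun_comp fun L : W →L[ℝ] ExteriorAlgebra ℂ M => L (β l)

theorem jet_add (d : ℕ) {f g : W → ExteriorAlgebra ℂ M} {x : W} (hf : AnalyticAt ℝ f x)
    (hg : AnalyticAt ℝ g x) :
    jet φ j β σ d (fun y => f y + g y) x = jet φ j β σ d f x + jet φ j β σ d g x := by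
  induction d generalizing f g with
  | zero => exact map_add φ _ _
  | succ d ih =>
    simp only [jet, ← Finset.sum_add_distrib, ← add_mul]
    refine Finset.sum_congr rfl fun l _ => ?_
    rw [← ih (analyticAt_fderiv_apply hf _) (analyticAt_fderiv_apply hg _)]
    congr 1
    refine jet_congr d ?_
    filter_upwards [hf.eventually_analyticAt, hg.eventually_analyticAt] with y h1 h2
    rw [fderiv_fun_add h1.differentiableAt h2.differentiableAt]
    rfl

/-- Leibniz's rule, by Pascal's recursion on binomial coefficients. Centrality of the increments is
needed to move them across the second derivative factor. -/
theorem jet_mul (hj : ∀ a z, Commute (j a) z) (d : ℕ) {f g : W → ExteriorAlgebra ℂ M} {x : W}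
    (hf : AnalyticAt ℝ f x) (hg : AnalyticAt ℝ g x) :
    jet φ j β σ d (fun y => f y * g y) x = ∑ p ∈ Finset.HasAntidiagonal.antidiagonal d,
      d.choose p.1 • (jet φ j β σ p.1 f x * jet φ j β σ p.2 g x) := by
  induction d generalizing f g with
  | zero => simp [jet]
  | succ d ih =>
    rw [Finset.sum_antidiagonal_choose_succ_nsmul
      (fun a c => jet φ j β σ a f x * jet φ j β σ c g x) d]
    have h (l : κ) : jet φ j β σ d (fun y => fderiv ℝ (fun y => f y * g y) y (β l)) x =
        ∑ p ∈ Finset.HasAntidiagonal.antidiagonal d, d.choose p.1 •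
          (jet φ j β σ p.1 f x * jet φ j β σ p.2 (fun y => fderiv ℝ g y (β l)) x) +
        ∑ p ∈ Finset.HasAntidiagonal.antidiagonal d, d.choose p.1 •
          (jet φ j β σ p.1 (fun y => fderiv ℝ f y (β l)) x * jet φ j β σ p.2 g x) := by
      have hf' := analyticAt_fderiv_apply hf (β l)
      have hg' := analyticAt_fderiv_apply hg (β l)
      rw [← ih hf hg', ← ih hf' hg,
        ← jet_add d (analyticAt_exterior_mul hf hg') (analyticAt_exterior_mul hf' hg)]
      refine jet_congr d ?_
      filter_upwards [hf.eventually_analyticAt, hg.eventually_analyticAt] with y h1 h2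
      have := (mulCLM M).fderiv_of_bilinear h1.differentiableAt h2.differentiableAt
      simp only [mulCLM_apply] at this
      rw [this]
      rfl
    rw [jet]
    simp only [h, add_mul, Finset.sum_mul, Finset.sum_add_distrib]
    congr 1
    · rw [Finset.sum_comm]
      refine Finset.sum_congr rfl fun p _ => ?_
      simp only [jet, Finset.mul_sum, Finset.smul_sum, smul_mul_assoc, mul_assoc]
    · rw [Finset.sum_comm]
      refine Finset.sum_congr rfl fun p hp => ?_
      rw [show d.choose p.2 = d.choose p.1 from
        Nat.choose_symm_of_eq_add (Finset.HasAntidiagonal.mem_antidiagonal.mp hp ▸ add_comm _ _)]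
      simp only [jet, Finset.sum_mul, Finset.smul_sum, smul_mul_assoc, mul_assoc]
      exact Finset.sum_congr rfl fun l _ => by rw [(hj (σ l) _).eq]

/-- The recursive definition suits Leibniz's rule; this identifies it with the iterated derivative
of `value`. Each recursion step adds the last direction, hence `Fin.snocEquiv`. -/
theorem jet_eq_sum (d : ℕ) {f : W → ExteriorAlgebra ℂ M} {x : W}
    (hf : AnalyticAt ℝ f x) :
    jet φ j β σ d f x = ∑ s : Fin d → κ,
      φ (iteratedFDeriv ℝ d f x fun r => β (s r)) * j (∏ r, σ (s r)) := by
  induction d generalizing f with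
  | zero => simp [jet]
  | succ d ih =>
    have : FiniteDimensional ℝ (ExteriorAlgebra ℂ M) := FiniteDimensional.complexToReal _
    have : CompleteSpace (ExteriorAlgebra ℂ M) := FiniteDimensional.complete ℝ _
    rw [jet, ← Equiv.sum_comp (Fin.snocEquiv fun _ => κ), Fintype.sum_prod_type]
    refine Finset.sum_congr rfl fun l _ => ?_
    rw [ih (analyticAt_fderiv_apply hf _), Finset.sum_mul]
    refine Finset.sum_congr rfl fun s _ => ?_
    have h := ((ContinuousLinearMap.apply ℝ (ExteriorAlgebra ℂ M) (β l))).iteratedFDeriv_comp_left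
      (hf.fderiv.contDiffAt (n := d)) le_rfl
    have h2 : iteratedFDeriv ℝ d (fun y => fderiv ℝ f y (β l)) x =
      (ContinuousLinearMap.apply ℝ (ExteriorAlgebra ℂ M) (β l)).compContinuousMultilinearMap
        (iteratedFDeriv ℝ d (fderiv ℝ f) x) := h
    rw [h2, iteratedFDeriv_succ_apply_right, Fin.prod_univ_castSucc, map_mul, ← mul_assoc]
    simp [Fin.snocEquiv, Fin.init_def]

variable (φ j β σ) in
/-- The value of `φ ∘ f` at the point `x + ∑ βₗ σₗ`, by Taylor's formula of order `N`. -/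
def taylor (N : ℕ) (f : W → ExteriorAlgebra ℂ M) (x : W) : S :=
  ∑ d ∈ Finset.range N, ((d.factorial : ℂ)⁻¹) • jet φ j β σ d f x

theorem jet_eq_zero {N : ℕ}
    (hσ : ∀ s : Fin N → κ, ∏ r, σ (s r) = 0) {d : ℕ} (hd : N ≤ d) {f : W → ExteriorAlgebra ℂ M}
    {x : W} (hf : AnalyticAt ℝ f x) : jet φ j β σ d f x = 0 := by
  rw [jet_eq_sum d hf]
  refine Finset.sum_eq_zero fun s _ => ?_
  obtain ⟨c, rfl⟩ := Nat.exists_eq_add_of_le hd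
  rw [Fin.prod_univ_add, hσ fun r => s (Fin.castAdd c r), zero_mul, map_zero, mul_zero]

theorem taylor_congr (N : ℕ) {f g : W → ExteriorAlgebra ℂ M} {x : W} (h : f =ᶠ[nhds x] g) :
    taylor φ j β σ N f x = taylor φ j β σ N g x :=
  Finset.sum_congr rfl fun d _ => by rw [jet_congr d h]

theorem taylor_add (N : ℕ) {f g : W → ExteriorAlgebra ℂ M} {x : W} (hf : AnalyticAt ℝ f x)
    (hg : AnalyticAt ℝ g x) :
    taylor φ j β σ N (fun y => f y + g y) x = taylor φ j β σ N f x + taylor φ j β σ N g x := by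
  simp only [taylor, ← Finset.sum_add_distrib, ← smul_add]
  exact Finset.sum_congr rfl fun d _ => by rw [jet_add d hf hg]

/-- Dividing by factorials turns Leibniz's rule into a Cauchy product; nilpotency of the increments
removes the terms beyond the truncation. -/
theorem taylor_mul (hj : ∀ a z, Commute (j a) z) {N : ℕ}
    (hσ : ∀ s : Fin N → κ, ∏ r, σ (s r) = 0) {f g : W → ExteriorAlgebra ℂ M} {x : W}
    (hf : AnalyticAt ℝ f x) (hg : AnalyticAt ℝ g x) :
    taylor φ j β σ N (fun y => f y * g y) x = taylor φ j β σ N f x * taylor φ j β σ N g x := by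
  have h (d : ℕ) : ((d.factorial : ℂ)⁻¹) • jet φ j β σ d (fun y => f y * g y) x =
      ∑ p ∈ Finset.HasAntidiagonal.antidiagonal d, (((p.1.factorial : ℂ)⁻¹) • jet φ j β σ p.1 f x) *
        (((p.2.factorial : ℂ)⁻¹) • jet φ j β σ p.2 g x) := by
    rw [jet_mul hj d hf hg, Finset.smul_sum]
    refine Finset.sum_congr rfl fun p hp => ?_
    obtain rfl := Finset.HasAntidiagonal.mem_antidiagonal.mp hp
    rw [smul_mul_smul_comm, ← Nat.cast_smul_eq_nsmul ℂ, smul_smul, Nat.cast_add_choose]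
    congr 1
    have h1 : ((p.1 + p.2).factorial : ℂ) ≠ 0 := Nat.cast_ne_zero.mpr (Nat.factorial_ne_zero _)
    have h2 : (p.1.factorial : ℂ) ≠ 0 := Nat.cast_ne_zero.mpr (Nat.factorial_ne_zero _)
    have h3 : (p.2.factorial : ℂ) ≠ 0 := Nat.cast_ne_zero.mpr (Nat.factorial_ne_zero _)
    field_simp
  rw [taylor, taylor, taylor, ← sum_range_mul_sum_range]
  · exact Finset.sum_congr rfl fun d _ => h d
  · exact fun d hd => by rw [jet_eq_zero hσ hd hf, smul_zero]
  · exact fun d hd => by rw [jet_eq_zero hσ hd hg, smul_zero]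
  · exact fun d hd => by rw [← h, jet_eq_zero hσ hd (analyticAt_exterior_mul hf hg), smul_zero]

theorem jet_const (d : ℕ) (a : ExteriorAlgebra ℂ M) (x : W) :
    jet φ j β σ d (fun _ => a) x = if d = 0 then φ a else 0 := by
  have h0 (d : ℕ) : jet φ j β σ d (fun _ => (0 : ExteriorAlgebra ℂ M)) x = 0 := by
    induction d with
    | zero => simp [jet]
    | succ d ih => simp [jet, ih]
  cases d with
  | zero => simp [jet]
  | succ d => simp [jet, h0]

theorem taylor_const {N : ℕ} (hN : 0 < N) (a : ExteriorAlgebra ℂ M) (x : W) :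
    taylor φ j β σ N (fun _ => a) x = φ a := by
  simp only [taylor, jet_const, smul_ite, smul_zero]
  rw [Finset.sum_ite_eq' (Finset.range N) 0 fun d => ((d.factorial : ℂ)⁻¹) • φ a]
  simp [hN]

theorem taylor_linear {N : ℕ} (hN : 1 < N) (L : W →L[ℝ] ExteriorAlgebra ℂ M) (x : W) :
    taylor φ j β σ N L x = φ (L x) + ∑ l, φ (L (β l)) * j (σ l) := by
  have h (d : ℕ) : jet φ j β σ d L x = if d = 0 then φ (L x) else
      if d = 1 then ∑ l, φ (L (β l)) * j (σ l) else 0 := by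
    cases d with
    | zero => simp [jet]
    | succ d =>
      simp only [jet, ContinuousLinearMap.fderiv, jet_const]
      by_cases hd : d = 0 <;> simp [hd]
  obtain ⟨N, rfl⟩ := Nat.exists_eq_add_of_lt hN
  rw [taylor, add_comm 1 N, Finset.sum_range_succ', Finset.sum_range_succ']
  simp [h, add_comm]

end Taylor

/-! ### The binomial series of the square root -/

/-- The coefficients of the binomial series `√(1 + X)`. -/
def sqrtCoeff (d : ℕ) : ℝ := (∏ l ∈ Finset.range d, ((1 / 2 : ℝ) - l)) / (d.factorial : ℝ)

theorem sqrtCoeff_eq_choose (d : ℕ) : sqrtCoeff d = Ring.choose (1 / 2 : ℝ) d := by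
  rw [Ring.choose_eq_smul, ← Polynomial.aeval_eq_smeval, Polynomial.aeval_def,
    Polynomial.eval₂_eq_eval_map, descPochhammer_map, descPochhammer_eval_eq_prod_range, sqrtCoeff,
    smul_eq_mul, div_eq_inv_mul]

theorem sqrtCoeff_zero : sqrtCoeff 0 = 1 := by simp [sqrtCoeff]

/-- The Chu–Vandermonde identity with exponents `1/2 + 1/2 = 1`, i.e. the square of the binomial
series is `1 + X`. -/
theorem sum_sqrtCoeff_mul (d : ℕ) :
    ∑ p ∈ Finset.HasAntidiagonal.antidiagonal d, sqrtCoeff p.1 * sqrtCoeff p.2 =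
      (Nat.choose 1 d : ℝ) := by
  simp only [sqrtCoeff_eq_choose]
  rw [← Ring.add_choose_eq d (Commute.all _ _), show (1 / 2 : ℝ) + 1 / 2 = (1 : ℕ) by norm_num,
    Ring.choose_natCast]

/-! ### Even elements of a near superalgebra -/

section Near

variable {P : Type*} [Ring P] [Algebra ℝ P] {𝒢 : ZMod 2 → Submodule ℝ P} [GradedAlgebra 𝒢]
  [NearSuperalgebra 𝒢]

variable (𝒢) in
/-- The body, as a morphism of algebras. -/
def evenBodyHom : 𝒢 0 →ₐ[ℝ] ℝ where
  toFun := evenBody 𝒢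
  map_one' := map_one (NearSuperalgebra.body (𝒢 := 𝒢))
  map_mul' _ _ := map_mul (NearSuperalgebra.body (𝒢 := 𝒢)) _ _
  map_zero' := map_zero _
  map_add' := map_add _
  commutes' r := (NearSuperalgebra.body (𝒢 := 𝒢)).commutes r

theorem evenBody_mul (a c : 𝒢 0) : evenBody 𝒢 (a * c) = evenBody 𝒢 a * evenBody 𝒢 c :=
  map_mul (evenBodyHom 𝒢) a c

theorem evenBody_one : evenBody 𝒢 1 = 1 := map_one (evenBodyHom 𝒢)

theorem eq_zero_of_mul_eq_zero_of_evenBody_ne_zero {p a : 𝒢 0} (h : p * a = 0)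
    (ha : evenBody 𝒢 a ≠ 0) : p = 0 :=
  Subtype.ext ((NearSuperalgebra.isUnit_of_body_ne_zero (𝒢 := 𝒢) (a : P) ha).mul_left_eq_zero.mp
    (congrArg Subtype.val h))

/-- As in Nakayama's lemma: each further factor with zero body strictly shrinks the principal ideal
of the product. If it did not, `p = p a x` would hold with `1 - a x` invertible, so that `p = 0`. -/
theorem finrank_range_mulLeft_add_le (l : ℕ) (a : Fin l → 𝒢 0) (ha : ∀ r, evenBody 𝒢 (a r) = 0)
    (h : ∏ r, a r ≠ 0) : Module.finrank ℝ (LinearMap.range (LinearMap.mulLeft ℝ (∏ r, a r))) + l ≤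
      Module.finrank ℝ (𝒢 0) := by
  have := NearSuperalgebra.finite (𝒢 := 𝒢)
  induction l with
  | zero => exact Submodule.finrank_le _
  | succ l ih =>
    have h' : ∏ r, a (Fin.castSucc r) ≠ 0 := fun h0 => h (by rw [Fin.prod_univ_castSucc, h0, zero_mul])
    refine le_trans ?_ (ih (fun r => a (Fin.castSucc r)) (fun r => ha _) h')
    rw [← add_assoc, add_right_comm, add_le_add_iff_right]
    refine Submodule.finrank_lt_finrank_of_lt (lt_of_le_of_ne ?_ fun he => h' ?_)
    · rintro _ ⟨x, rfl⟩
      exact ⟨a (Fin.last l) * x, by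
        simp only [LinearMap.mulLeft_apply, Fin.prod_univ_castSucc, mul_assoc]⟩
    · have h1 : ∏ r, a (Fin.castSucc r) ∈
          LinearMap.range (LinearMap.mulLeft ℝ (∏ r, a (Fin.castSucc r))) := ⟨1, mul_one _⟩
      rw [← he] at h1
      obtain ⟨x, hx⟩ := h1
      refine eq_zero_of_mul_eq_zero_of_evenBody_ne_zero (a := 1 - a (Fin.last l) * x) ?_ ?_
      · rw [LinearMap.mulLeft_apply, Fin.prod_univ_castSucc, mul_assoc] at hx
        rw [mul_sub, mul_one, hx, sub_self]
      · rw [map_sub, evenBody_one, evenBody_mul, ha, zero_mul, sub_zero]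
        exact one_ne_zero

theorem prod_eq_zero_of_evenBody_eq_zero (a : Fin (Module.finrank ℝ P + 1) → 𝒢 0)
    (ha : ∀ r, evenBody 𝒢 (a r) = 0) : ∏ r, a r = 0 := by
  have := NearSuperalgebra.finite (𝒢 := 𝒢)
  by_contra h
  have h1 := finrank_range_mulLeft_add_le _ a ha h
  have h2 := Submodule.finrank_le (𝒢 0)
  omega

theorem pow_eq_zero_of_evenBody_eq_zero {a : 𝒢 0} (ha : evenBody 𝒢 a = 0) :
    a ^ (Module.finrank ℝ P + 1) = 0 := by
  have h := prod_eq_zero_of_evenBody_eq_zero (fun _ => a) fun _ => ha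
  rwa [Fin.prod_const] at h

/-- Locality provides an inverse in `P`; an inverse in the even part comes from the nilpotency of `1
- a / b(a)`. -/
theorem isUnit_of_evenBody_ne_zero {a : 𝒢 0} (ha : evenBody 𝒢 a ≠ 0) : IsUnit a := by
  have h0 : evenBody 𝒢 (1 - (evenBody 𝒢 a)⁻¹ • a) = 0 := by
    rw [map_sub, map_smul, evenBody_one, smul_eq_mul, inv_mul_cancel₀ ha, sub_self]
  have h := IsNilpotent.isUnit_one_sub ⟨_, pow_eq_zero_of_evenBody_eq_zero h0⟩
  rw [sub_sub_cancel] at h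
  have h2 : a = algebraMap ℝ (𝒢 0) (evenBody 𝒢 a) * ((evenBody 𝒢 a)⁻¹ • a) := by
    rw [← Algebra.smul_def, smul_smul, mul_inv_cancel₀ ha, one_smul]
  rw [h2]
  exact ((isUnit_iff_ne_zero.mpr ha).map (algebraMap ℝ (𝒢 0))).mul h

theorem sum_sqrtCoeff_mul_sum_sqrtCoeff {R : Type*} [CommRing R] [Algebra ℝ R] {N : ℕ}
    {x : R} (hx : x ^ N = 0) :
    (∑ d ∈ Finset.range N, sqrtCoeff d • x ^ d) * (∑ d ∈ Finset.range N, sqrtCoeff d • x ^ d) =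
      1 + x := by
  have hp {d : ℕ} (hd : N ≤ d) : x ^ d = 0 := pow_eq_zero_of_le hd hx
  have h (d : ℕ) : ∑ p ∈ Finset.HasAntidiagonal.antidiagonal d,
      (sqrtCoeff p.1 • x ^ p.1) * (sqrtCoeff p.2 • x ^ p.2) = (Nat.choose 1 d : ℝ) • x ^ d := by
    rw [← sum_sqrtCoeff_mul, Finset.sum_smul]
    refine Finset.sum_congr rfl fun p hp => ?_
    rw [smul_mul_smul_comm, ← pow_add, Finset.HasAntidiagonal.mem_antidiagonal.mp hp]
  rw [← sum_range_mul_sum_range (fun d hd => by rw [hp hd, smul_zero])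
    (fun d hd => by rw [hp hd, smul_zero]) (fun d hd => by rw [h, hp hd, smul_zero])]
  simp only [h]
  have h2 : ∑ d ∈ Finset.range N, (Nat.choose 1 d : ℝ) • x ^ d =
      ∑ d ∈ Finset.range (N + 2), (Nat.choose 1 d : ℝ) • x ^ d := by
    refine Finset.sum_subset (Finset.range_subset_range.mpr (Nat.le_add_right _ _)) fun d _ hd => ?_
    rw [hp (by simpa using hd), smul_zero]
  rw [h2, add_comm N 2, Finset.sum_range_add]
  have h3 (d : ℕ) : Nat.choose 1 (2 + d) = 0 := Nat.choose_eq_zero_of_lt (by omega)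
  simp [Finset.sum_range_succ, h3]

theorem nearSqrt_eq (α : 𝒢 0) : nearSqrt α = √(evenBody 𝒢 α) •
    ∑ d ∈ Finset.range (Module.finrank ℝ P + 1),
      sqrtCoeff d • ((evenBody 𝒢 α)⁻¹ • α - 1) ^ d := rfl

theorem evenBody_inv_smul_sub_one {α : 𝒢 0} (hα : evenBody 𝒢 α ≠ 0) :
    evenBody 𝒢 ((evenBody 𝒢 α)⁻¹ • α - 1) = 0 := by
  rw [map_sub, map_smul, evenBody_one, smul_eq_mul, inv_mul_cancel₀ hα, sub_self]

theorem nearSqrt_mul_self {α : 𝒢 0} (hα : 0 < evenBody 𝒢 α) : nearSqrt α * nearSqrt α = α := by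
  rw [nearSqrt_eq, smul_mul_smul_comm, Real.mul_self_sqrt hα.le, sum_sqrtCoeff_mul_sum_sqrtCoeff
    (pow_eq_zero_of_evenBody_eq_zero (evenBody_inv_smul_sub_one hα.ne')),
    add_sub_cancel, smul_smul, mul_inv_cancel₀ hα.ne', one_smul]

theorem evenBody_nearSqrt {α : 𝒢 0} (hα : 0 < evenBody 𝒢 α) :
    evenBody 𝒢 (nearSqrt α) = √(evenBody 𝒢 α) := by
  rw [nearSqrt_eq, map_smul, map_sum, Finset.sum_range_succ', Finset.sum_eq_zero]
  · rw [map_smul, pow_zero, evenBody_one, sqrtCoeff_zero, smul_eq_mul, smul_eq_mul, mul_one,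
      zero_add, mul_one]
  · intro d _
    rw [map_smul, pow_succ, evenBody_mul, evenBody_inv_smul_sub_one hα.ne', mul_zero, smul_zero]

theorem evenBody_nearAbs {α : 𝒢 0} (hα : evenBody 𝒢 α ≠ 0) :
    evenBody 𝒢 (nearAbs α) = |evenBody 𝒢 α| := by
  rw [nearAbs, map_smul, smul_eq_mul, div_mul_cancel₀ _ hα]

/-- The inverse square root with positive body is unique. -/
theorem eq_inverse_nearSqrt_nearAbs {α y : 𝒢 0} (hα : evenBody 𝒢 α ≠ 0) (hy : 0 < evenBody 𝒢 y)
    (h : y * y * nearAbs α = 1) : y = Ring.inverse (nearSqrt (nearAbs α)) := by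
  have h0 : 0 < evenBody 𝒢 (nearAbs α) := by rw [evenBody_nearAbs hα]; exact abs_pos.mpr hα
  have h1 : 0 < evenBody 𝒢 (nearSqrt (nearAbs α)) := by
    rw [evenBody_nearSqrt h0]; exact Real.sqrt_pos.mpr h0
  set s := nearSqrt (nearAbs α) with hs
  have h2 : y * s = 1 := by
    -- `(ys)² = 1`, and `ys + 1` is not a zero divisor because its body is positive. This singles
    -- out the root `ys = 1`.
    have e : (y * s - 1) * (y * s + 1) = 0 := by
      have : (y * s - 1) * (y * s + 1) = y * y * (s * s) - 1 := by ring
      rw [this, hs, nearSqrt_mul_self h0, h, sub_self]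
    refine sub_eq_zero.mp (eq_zero_of_mul_eq_zero_of_evenBody_ne_zero e ?_)
    rw [map_add, evenBody_one, evenBody_mul]
    positivity
  have hu : IsUnit s := isUnit_of_evenBody_ne_zero h1.ne'
  rw [← mul_one y, ← Ring.mul_inverse_cancel s hu, ← mul_assoc, h2, one_mul]

end Near

/-! ### Values at points -/

section Values

variable {P : Type*} [Ring P] [Algebra ℝ P] {𝒢 : ZMod 2 → Submodule ℝ P} [GradedAlgebra 𝒢]
  [NearSuperalgebra 𝒢]

theorem one_tmul_smul {N : Type*} [AddCommGroup N] [Module ℝ N] (r : ℝ) (a : N) :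
    (1 : ℂ) ⊗ₜ[ℝ] (r • a) = (r : ℂ) • ((1 : ℂ) ⊗ₜ[ℝ] a) := by
  rw [TensorProduct.tmul_smul, TensorProduct.smul_tmul', TensorProduct.smul_tmul',
    Complex.real_smul, smul_eq_mul]

variable (𝒢) in
/-- The even part as a subalgebra. -/
def evenSubtype : 𝒢 0 →ₐ[ℝ] P where
  toFun := Subtype.val
  map_one' := rfl
  map_mul' _ _ := rfl
  map_zero' := rfl
  map_add' _ _ := rfl
  commutes' _ := rfl

variable (𝒢) in
/-- The inclusion of the complexified even part, as a morphism of algebras. -/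
def evenInclHom : (ℂ ⊗[ℝ] 𝒢 0) →ₐ[ℂ] (ℂ ⊗[ℝ] P) :=
  Algebra.TensorProduct.map (AlgHom.id ℂ ℂ) (evenSubtype 𝒢)

theorem evenInclHom_apply (z : ℂ ⊗[ℝ] 𝒢 0) : evenInclHom 𝒢 z = evenIncl 𝒢 z := rfl

/-- Flatness of `ℂ` over `ℝ`. It makes the value of an even function unique. -/
theorem evenInclHom_injective : Function.Injective (evenInclHom 𝒢) :=
  Module.Flat.lTensor_preserves_injective_linearMap (M := ℂ) (𝒢 0).subtype
    (Submodule.injective_subtype _)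

theorem evenInclHom_commute (z : ℂ ⊗[ℝ] 𝒢 0) (w : ℂ ⊗[ℝ] P) : Commute (evenInclHom 𝒢 z) w := by
  change evenInclHom 𝒢 z * w = w * evenInclHom 𝒢 z
  induction z using TensorProduct.induction_on with
  | zero => simp
  | add x y hx hy => rw [map_add, add_mul, mul_add, hx, hy]
  | tmul c a =>
    induction w using TensorProduct.induction_on with
    | zero => simp
    | add x y hx hy => rw [add_mul, mul_add, hx, hy]
    | tmul d p =>
      have h : (a : P) * p = p * a := by
        have h0 (t : ZMod 2) (q : P) (hq : q ∈ 𝒢 t) : (a : P) * q = q * a := by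
          have := NearSuperalgebra.supercomm (𝒢 := 𝒢) 0 t (a : P) q a.2 hq
          simpa using this
        refine DirectSum.Decomposition.inductionOn 𝒢 (by simp) (fun {t} q => h0 t q q.2)
          (fun q q' h1 h2 => by rw [mul_add, add_mul, h1, h2]) p
      change (c ⊗ₜ[ℝ] (a : P)) * (d ⊗ₜ[ℝ] p) = (d ⊗ₜ[ℝ] p) * (c ⊗ₜ[ℝ] (a : P))
      rw [Algebra.TensorProduct.tmul_mul_tmul, Algebra.TensorProduct.tmul_mul_tmul, mul_comm c, h]

variable (𝒢) in
/-- The inclusion of the even part in the complexified superalgebra. -/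
def evenOne : 𝒢 0 →+* ℂ ⊗[ℝ] P :=
  (evenInclHom 𝒢 : (ℂ ⊗[ℝ] 𝒢 0) →+* (ℂ ⊗[ℝ] P)).comp
    (Algebra.TensorProduct.includeRight : 𝒢 0 →ₐ[ℝ] ℂ ⊗[ℝ] 𝒢 0).toRingHom

theorem evenInclHom_one_tmul_smul (r : ℝ) (a : 𝒢 0) :
    evenInclHom 𝒢 ((1 : ℂ) ⊗ₜ[ℝ] (r • a)) = algebraMap ℂ _ (r : ℂ) * evenOne 𝒢 a := by
  rw [one_tmul_smul, map_smul]
  exact Algebra.smul_def (r : ℂ) (evenOne 𝒢 a)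

theorem one_tmul_injective : Function.Injective fun a : 𝒢 0 => (1 : ℂ) ⊗ₜ[ℝ] a :=
  Algebra.TensorProduct.includeRight_injective (algebraMap ℝ ℂ).injective

variable {V₀ V₁ : Type*} [NormedAddCommGroup V₀] [NormedSpace ℝ V₀] [FiniteDimensional ℝ V₀]
  [NormedAddCommGroup V₁] [NormedSpace ℝ V₁] [FiniteDimensional ℝ V₁]
  {B : SymplecticForm V₀ V₁} {k n : ℕ}

/-- The Taylor expansion at the body of a point. -/
abbrev pointTaylor (X : SpoPoint B 𝒢) (F : spoEven B → OddAlgebra B) : ℂ ⊗[ℝ] P :=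
  taylor (evalOdd X.2) (evenOne 𝒢) (Module.finBasis ℝ (spoEven B)) (soulCoord X)
    (Module.finrank ℝ P + 1) F (pointBody X)

theorem evenBody_applyPt {W : Type*} [AddCommGroup W] [Module ℝ W] (l : W →ₗ[ℝ] ℝ)
    (w : W ⊗[ℝ] 𝒢 0) : evenBody 𝒢 (applyPt l w) =
      l (TensorProduct.rid ℝ W (LinearMap.lTensor W (evenBody 𝒢) w)) := by
  induction w using TensorProduct.induction_on with
  | zero => simp [applyPt]
  | tmul Y a => simp [applyPt, mul_comm]
  | add x y hx hy =>
    simp only [applyPt, map_add] at hx hy ⊢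
    rw [hx, hy]

theorem linear_eq_sum {W κ : Type*} [AddCommGroup W] [Module ℝ W] [Fintype κ]
    (β : Module.Basis κ ℝ W) (l : W →ₗ[ℝ] ℝ) (w : W) : l w = ∑ m, l (β m) * β.coord m w := by
  conv_lhs => rw [← β.sum_repr w, map_sum]
  exact Finset.sum_congr rfl fun m _ => by
    rw [map_smul, smul_eq_mul, mul_comm, Module.Basis.coord_apply]

theorem applyPt_eq_sum {W N κ : Type*} [AddCommGroup W] [Module ℝ W] [AddCommGroup N] [Module ℝ N]
    [Fintype κ] (β : Module.Basis κ ℝ W) (l : W →ₗ[ℝ] ℝ) (w : W ⊗[ℝ] N) :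
    applyPt l w = ∑ m, l (β m) • applyPt (β.coord m) w := by
  induction w using TensorProduct.induction_on with
  | zero => simp [applyPt]
  | tmul Y a =>
    simp only [applyPt, LinearMap.rTensor_tmul, TensorProduct.lid_tmul, smul_smul,
      ← Finset.sum_smul]
    rw [← linear_eq_sum β]
  | add x y hx hy =>
    simp only [applyPt, map_add, smul_add, Finset.sum_add_distrib] at hx hy ⊢
    rw [← hx, ← hy]

theorem evenBody_applyPt_point (l : spoEven B →ₗ[ℝ] ℝ) (X : SpoPoint B 𝒢) :
    evenBody 𝒢 (applyPt l X.1) = l (pointBody X) := evenBody_applyPt l X.1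

theorem evenBody_algebraMap (r : ℝ) : evenBody 𝒢 (algebraMap ℝ (𝒢 0) r) = r :=
  (evenBodyHom 𝒢).commutes r

theorem evenBody_soulCoord (X : SpoPoint B 𝒢) (l) : evenBody 𝒢 (soulCoord X l) = 0 := by
  rw [soulCoord, map_sub, evenBody_applyPt_point, evenBody_algebraMap, sub_self]

theorem prod_soulCoord (X : SpoPoint B 𝒢) (s : Fin (Module.finrank ℝ P + 1) → _) :
    ∏ r, soulCoord X (s r) = 0 :=
  prod_eq_zero_of_evenBody_eq_zero _ fun _ => evenBody_soulCoord X _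

theorem evenOne_commute (a : 𝒢 0) (w : ℂ ⊗[ℝ] P) : Commute (evenOne 𝒢 a) w :=
  evenInclHom_commute ((1 : ℂ) ⊗ₜ[ℝ] a) w

theorem value_eq_pointTaylor (X : SpoPoint B 𝒢) {F : spoEven B → OddAlgebra B}
    (hF : AnalyticAt ℝ F (pointBody X)) : value F X = pointTaylor X F :=
  Finset.sum_congr rfl fun d _ => by rw [jet_eq_sum d hF]; rfl

variable (X : SpoPoint B 𝒢)

/-- The even function `f` is analytic at the body of the point `X`, where it takes the value `y`. -/
def IsValue (f : spoEven B → EvenAlg (spoOdd B →ₗ[ℝ] ℂ)) (y : ℂ ⊗[ℝ] 𝒢 0) : Prop :=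
  AnalyticAt ℝ (fun Y => EvenAlg.val _ (f Y)) (pointBody X) ∧
    pointTaylor X (fun Y => EvenAlg.val _ (f Y)) = evenInclHom 𝒢 y

variable {X} {f g : spoEven B → EvenAlg (spoOdd B →ₗ[ℝ] ℂ)} {y z : ℂ ⊗[ℝ] 𝒢 0}

theorem IsValue.unique (hy : IsValue X f y) (hz : IsValue X f z) : y = z :=
  evenInclHom_injective (hy.2.symm.trans hz.2)

theorem IsValue.congr (hf : IsValue X f y) (h : f =ᶠ[nhds (pointBody X)] g) : IsValue X g y := by
  have h' : (fun Y => EvenAlg.val _ (f Y)) =ᶠ[nhds (pointBody X)] fun Y => EvenAlg.val _ (g Y) :=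
    h.fun_comp _
  exact ⟨hf.1.congr h', (taylor_congr _ h').symm.trans hf.2⟩

theorem IsValue.add (hf : IsValue X f y) (hg : IsValue X g z) :
    IsValue X (fun Y => f Y + g Y) (y + z) := by
  have h := taylor_add (φ := evalOdd X.2) (j := evenOne 𝒢) (β := Module.finBasis ℝ (spoEven B))
    (σ := soulCoord X) (Module.finrank ℝ P + 1) hf.1 hg.1
  simp only [IsValue, map_add]
  exact ⟨hf.1.fun_add hg.1, h.trans (congrArg₂ _ hf.2 hg.2)⟩

/-- Multiplicativity applies because the soul coordinates are central and products of `dim P + 1` of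
them vanish. -/
theorem IsValue.mul (hf : IsValue X f y) (hg : IsValue X g z) :
    IsValue X (fun Y => f Y * g Y) (y * z) := by
  have h := taylor_mul (φ := evalOdd X.2) (j := evenOne 𝒢) (β := Module.finBasis ℝ (spoEven B))
    (σ := soulCoord X) evenOne_commute (prod_soulCoord X) hf.1 hg.1
  simp only [IsValue, map_mul]
  exact ⟨analyticAt_exterior_mul hf.1 hg.1, h.trans (congrArg₂ _ hf.2 hg.2)⟩

theorem IsValue.const {a : EvenAlg (spoOdd B →ₗ[ℝ] ℂ)}
    (h : evalOdd X.2 (EvenAlg.val _ a) = evenInclHom 𝒢 y) : IsValue X (fun _ => a) y :=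
  ⟨analyticAt_const, (taylor_const (Nat.succ_pos _) _ _).trans h⟩

theorem IsValue.algebraMap (c : ℂ) : IsValue X (fun _ => algebraMap ℂ _ c) (algebraMap ℂ _ c) :=
  .const (by simp only [AlgHom.commutes])

theorem IsValue.smul (c : ℂ) (hf : IsValue X f y) : IsValue X (fun Y => c • f Y) (c • y) := by
  have e : c • y = Algebra.algebraMap ℂ _ c * y := Algebra.smul_def c y
  rw [e]
  simp only [Algebra.smul_def]
  exact (IsValue.algebraMap c).mul hf

theorem IsValue.sum {ι : Type*} (s : Finset ι) {f : ι → spoEven B → EvenAlg (spoOdd B →ₗ[ℝ] ℂ)}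
    {y : ι → ℂ ⊗[ℝ] 𝒢 0} (h : ∀ a ∈ s, IsValue X (f a) (y a)) :
    IsValue X (fun Y => ∑ a ∈ s, f a Y) (∑ a ∈ s, y a) := by
  classical
  induction s using Finset.induction_on with
  | empty => simpa using IsValue.algebraMap (X := X) 0
  | insert a s ha ih =>
    simp only [Finset.sum_insert ha]
    exact (h a (Finset.mem_insert_self a s)).add (ih fun c hc => h c (Finset.mem_insert_of_mem hc))

theorem IsValue.prod {ι : Type*} (s : Finset ι) {f : ι → spoEven B → EvenAlg (spoOdd B →ₗ[ℝ] ℂ)}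
    {y : ι → ℂ ⊗[ℝ] 𝒢 0} (h : ∀ a ∈ s, IsValue X (f a) (y a)) :
    IsValue X (fun Y => ∏ a ∈ s, f a Y) (∏ a ∈ s, y a) := by
  classical
  induction s using Finset.induction_on with
  | empty => simpa only [map_one, Finset.prod_empty] using IsValue.algebraMap (X := X) 1
  | insert a s ha ih =>
    simp only [Finset.prod_insert ha]
    exact (h a (Finset.mem_insert_self a s)).mul (ih fun c hc => h c (Finset.mem_insert_of_mem hc))

theorem IsValue.pfaffian {f : spoEven B → Matrix (Fin n) (Fin n) (EvenAlg (spoOdd B →ₗ[ℝ] ℂ))}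
    {y : Matrix (Fin n) (Fin n) (ℂ ⊗[ℝ] 𝒢 0)}
    (h : ∀ a c, IsValue X (fun Y => f Y a c) (y a c)) :
    IsValue X (fun Y => pfaffian (f Y)) (pfaffian y) := by
  simp only [SuperPfaffian.pfaffian]
  split_ifs with hn
  · refine .smul _ (.sum _ fun s _ => ?_)
    simp only [zsmul_eq_mul]
    refine .mul ?_ (.prod _ fun r _ => h _ _)
    have := IsValue.algebraMap (X := X) (((Equiv.Perm.sign s : ℤˣ) : ℤ) : ℂ)
    simpa only [map_intCast] using this
  · simpa using IsValue.algebraMap (X := X) 0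

theorem IsValue.mul₂ (l l' : spoOdd B →ₗ[ℝ] ℝ) : IsValue X
    (fun _ => EvenAlg.mul₂ (complexForm l) (complexForm l'))
    ((1 : ℂ) ⊗ₜ[ℝ] ⟨((applyPt l X.2 : 𝒢 1) : P) * ((applyPt l' X.2 : 𝒢 1) : P), by
      have h := odd_mul_even_mul_odd_mem (applyPt l X.2) 1 (applyPt l' X.2)
      rwa [SetLike.GradeZero.coe_one, mul_one] at h⟩) := by
  have h (l : spoOdd B →ₗ[ℝ] ℝ) : evalOdd X.2 (ExteriorAlgebra.ι ℂ (complexForm l)) =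
      (1 : ℂ) ⊗ₜ[ℝ] ((applyPt l X.2 : 𝒢 1) : P) := by
    rw [evalOdd, ExteriorAlgebra.lift_ι_apply]
    generalize X.2 = w
    change TensorProduct.map (complexForm l) (𝒢 1).subtype w = _
    induction w using TensorProduct.induction_on with
    | zero => simp [applyPt]
    | tmul Y a =>
      simp only [applyPt, TensorProduct.map_tmul, LinearMap.rTensor_tmul, TensorProduct.lid_tmul,
        complexForm_apply, Submodule.subtype_apply, Submodule.coe_smul]
      rw [TensorProduct.tmul_smul, TensorProduct.smul_tmul', Complex.real_smul, mul_one]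
    | add x y hx hy =>
      simp only [applyPt, map_add, Submodule.coe_add, TensorProduct.tmul_add] at hx hy ⊢
      rw [hx, hy]
  refine .const ?_
  rw [EvenAlg.val_mul₂, map_mul, h, h, Algebra.TensorProduct.tmul_mul_tmul, mul_one]
  rfl

/-! ### Values of real functions -/

variable (X) in
/-- The real function `f` is analytic at the body of the point `X`, where it takes the value `y`. -/
def IsRealValue (f : spoEven B → ℝ) (y : 𝒢 0) : Prop :=
  IsValue X (fun Y => (f Y : ℂ) • 1) ((1 : ℂ) ⊗ₜ[ℝ] y)

variable (B) in
/-- The inclusion of the real scalars. -/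
def realScalar : ℝ →L[ℝ] OddAlgebra B := ContinuousLinearMap.smulRight (1 : ℝ →L[ℝ] ℝ) 1

theorem val_smul_one (r : ℝ) :
    EvenAlg.val _ ((r : ℂ) • (1 : EvenAlg (spoOdd B →ₗ[ℝ] ℂ))) = realScalar B r := by
  rw [map_smul, map_one]
  exact Complex.coe_smul r _

theorem evalOdd_realScalar (r : ℝ) : evalOdd X.2 (realScalar B r) = algebraMap ℂ _ (r : ℂ) := by
  rw [← val_smul_one, map_smul, map_one, ← Algebra.algebraMap_eq_smul_one, AlgHom.commutes]

theorem analyticAt_realScalar {f : spoEven B → ℝ} {x : spoEven B} (hf : AnalyticAt ℝ f x) :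
    AnalyticAt ℝ (fun Y => realScalar B (f Y)) x := by
  have := ((realScalar B).analyticAt (f x)).comp hf
  simpa only [Function.comp_def] using this

variable (X) in
/-- The real part of Taylor's formula. -/
def realTaylor (f : spoEven B → ℝ) : 𝒢 0 :=
  ∑ d ∈ Finset.range (Module.finrank ℝ P + 1), ((d.factorial : ℝ)⁻¹) •
    ∑ s : Fin d → Fin (Module.finrank ℝ (spoEven B)),
      iteratedFDeriv ℝ d f (pointBody X) (fun r => Module.finBasis ℝ (spoEven B) (s r)) •
        ∏ r, soulCoord X (s r)

theorem evenBody_realTaylor (f : spoEven B → ℝ) :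
    evenBody 𝒢 (realTaylor X f) = f (pointBody X) := by
  rw [realTaylor, map_sum, Finset.sum_range_succ', Finset.sum_eq_zero, zero_add]
  · simp [evenBody_one]
  · intro d _
    rw [map_smul, map_sum, Finset.sum_eq_zero, smul_zero]
    intro s _
    rw [map_smul, Fin.prod_univ_succ, evenBody_mul, evenBody_soulCoord, zero_mul, smul_zero]

/-- A real function has a value in the real even part, not only in its complexification; this is
required to compare with inverses and square roots there. -/
theorem isRealValue_realTaylor {f : spoEven B → ℝ} (hf : AnalyticAt ℝ f (pointBody X)) :
    IsRealValue X f (realTaylor X f) := by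
  have hF := analyticAt_realScalar hf
  refine ⟨by simpa only [val_smul_one] using hF, ?_⟩
  simp only [val_smul_one]
  rw [pointTaylor, taylor, realTaylor, TensorProduct.tmul_sum, map_sum]
  refine Finset.sum_congr rfl fun d _ => ?_
  rw [jet_eq_sum d hF, one_tmul_smul, map_smul, TensorProduct.tmul_sum, map_sum,
    Complex.ofReal_inv, Complex.ofReal_natCast]
  congr 1
  refine Finset.sum_congr rfl fun s _ => ?_
  have h : iteratedFDeriv ℝ d (fun Y => realScalar B (f Y)) (pointBody X) =
      (realScalar B).compContinuousMultilinearMap (iteratedFDeriv ℝ d f (pointBody X)) :=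
    (realScalar B).iteratedFDeriv_comp_left (hf.contDiffAt (n := d)) le_rfl
  rw [h, ContinuousLinearMap.compContinuousMultilinearMap_coe, Function.comp_apply,
    evalOdd_realScalar, evenInclHom_one_tmul_smul]

variable {u v : spoEven B → ℝ} {α γ : 𝒢 0}

theorem IsRealValue.unique (h : IsRealValue X u α) (h' : IsRealValue X u γ) : α = γ :=
  one_tmul_injective (IsValue.unique h h')

theorem IsRealValue.congr (h : IsRealValue X u α) (h' : u =ᶠ[nhds (pointBody X)] v) :
    IsRealValue X v α :=
  IsValue.congr h (h'.fun_comp fun r : ℝ => (r : ℂ) • (1 : EvenAlg (spoOdd B →ₗ[ℝ] ℂ)))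

theorem IsRealValue.mul (h : IsRealValue X u α) (h' : IsRealValue X v γ) :
    IsRealValue X (fun Y => u Y * v Y) (α * γ) := by
  have := IsValue.mul h h'
  simpa only [IsRealValue, Complex.ofReal_mul, smul_mul_smul_comm, mul_one,
    Algebra.TensorProduct.tmul_mul_tmul] using this

theorem IsRealValue.const (r : ℝ) : IsRealValue X (fun _ => r) (algebraMap ℝ (𝒢 0) r) := by
  refine IsValue.const ?_
  rw [val_smul_one, evalOdd_realScalar, Algebra.algebraMap_eq_smul_one (A := 𝒢 0), evenInclHom_one_tmul_smul,
    map_one, mul_one]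

theorem IsRealValue.sum {ι : Type*} (s : Finset ι) {u : ι → spoEven B → ℝ}
    {α : ι → 𝒢 0} (h : ∀ a ∈ s, IsRealValue X (u a) (α a)) :
    IsRealValue X (fun Y => ∑ a ∈ s, u a Y) (∑ a ∈ s, α a) := by
  have := IsValue.sum s h
  simpa only [IsRealValue, Complex.ofReal_sum, Finset.sum_smul, TensorProduct.tmul_sum] using this

theorem IsRealValue.prod {ι : Type*} (s : Finset ι) {u : ι → spoEven B → ℝ}
    {α : ι → 𝒢 0} (h : ∀ a ∈ s, IsRealValue X (u a) (α a)) :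
    IsRealValue X (fun Y => ∏ a ∈ s, u a Y) (∏ a ∈ s, α a) := by
  classical
  induction s using Finset.induction_on with
  | empty => simpa only [map_one, Finset.prod_empty] using IsRealValue.const (X := X) 1
  | insert a s ha ih =>
    simp only [Finset.prod_insert ha]
    exact (h a (Finset.mem_insert_self a s)).mul (ih fun c hc => h c (Finset.mem_insert_of_mem hc))

theorem IsRealValue.evenBody (h : IsRealValue X u α) (hu : AnalyticAt ℝ u (pointBody X)) :
    evenBody 𝒢 α = u (pointBody X) := by
  rw [h.unique (isRealValue_realTaylor hu), evenBody_realTaylor]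

theorem isRealValue_linear (X : SpoPoint B 𝒢) (l : spoEven B →ₗ[ℝ] ℝ) :
    IsRealValue X l (applyPt l X.1) := by
  let L : spoEven B →L[ℝ] OddAlgebra B := (realScalar B).comp (LinearMap.toContinuousLinearMap l)
  have hL (Y : spoEven B) : realScalar B (l Y) = L Y := rfl
  -- The linear term must belong to the truncated series; `P` is nonzero because it maps onto `ℝ`.
  have hN : 1 < Module.finrank ℝ P + 1 := by
    have := NearSuperalgebra.finite (𝒢 := 𝒢)
    have : Nontrivial P := (NearSuperalgebra.body (𝒢 := 𝒢)).toRingHom.domain_nontrivial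
    have := Module.finrank_pos (R := ℝ) (M := P)
    omega
  refine ⟨?_, ?_⟩
  · simp only [val_smul_one]
    have h : AnalyticAt ℝ (fun Y => l Y) (pointBody X) := analyticAt_linear l (pointBody X)
    exact analyticAt_realScalar h
  · simp only [val_smul_one, hL]
    have h := taylor_linear (φ := evalOdd X.2) (j := evenOne 𝒢)
      (β := Module.finBasis ℝ (spoEven B)) (σ := soulCoord X) hN L (pointBody X)
    refine h.trans ?_
    have h4 (r : ℝ) (a : 𝒢 0) : algebraMap ℂ (ℂ ⊗[ℝ] P) (r : ℂ) * evenOne 𝒢 a =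
        evenOne 𝒢 (r • a) := (evenInclHom_one_tmul_smul r a).symm
    simp only [← hL, evalOdd_realScalar, h4]
    rw [← mul_one (algebraMap ℂ (ℂ ⊗[ℝ] P) _), ← map_one (evenOne 𝒢), h4, ← map_sum, ← map_add]
    refine congrArg (evenOne 𝒢) ?_
    rw [applyPt_eq_sum (Module.finBasis ℝ (spoEven B)) l X.1,
      linear_eq_sum (Module.finBasis ℝ (spoEven B)) l, Finset.sum_smul, ← Finset.sum_add_distrib]
    refine Finset.sum_congr rfl fun m _ => ?_
    rw [soulCoord, smul_sub, mul_smul, ← Algebra.algebraMap_eq_smul_one, add_sub_cancel]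

end Values

/-! ### The value of the superPfaffian -/

section PointValue

variable {P : Type*} [Ring P] [Algebra ℝ P] {𝒢 : ZMod 2 → Submodule ℝ P} [GradedAlgebra 𝒢]
  [NearSuperalgebra 𝒢]

variable {V₀ V₁ : Type*} [NormedAddCommGroup V₀] [NormedSpace ℝ V₀] [FiniteDimensional ℝ V₀]
  [NormedAddCommGroup V₁] [NormedSpace ℝ V₁] [FiniteDimensional ℝ V₁]
  {B : SymplecticForm V₀ V₁} {k n : ℕ} (b : SymplecticBasis B k n) (X : SpoPoint B 𝒢)

theorem isRealValue_realA (r s : Fin k × Fin 2) :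
    IsRealValue X (fun Y => realA b Y r s) (blockA b X r s) :=
  isRealValue_linear X (coordA b r s)

theorem isRealValue_det : IsRealValue X (fun Y => (realA b Y).det) (blockA b X).det := by
  simp only [Matrix.det_apply']
  refine .sum _ fun s _ => .mul ?_ (.prod _ fun r _ => isRealValue_realA b X _ _)
  have h := IsRealValue.const (X := X) ((((Equiv.Perm.sign s : ℤˣ) : ℤ) : ℝ))
  rwa [map_intCast] at h

variable {X}

theorem eventually_mem_regularSet (b : SymplecticBasis B k n) (hX : pointBody X ∈ regularSet B) :
    ∀ᶠ Y in nhds (pointBody X), Y ∈ regularSet B :=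
  (isOpen_regularSet b).mem_nhds hX

/-- The Taylor values of the entries of `A⁻¹` satisfy the equation of a right inverse, since values
respect sums and products. So they form the inverse of `blockA`. -/
theorem isRealValue_inv_realA (hX : pointBody X ∈ regularSet B) (r s : Fin k × Fin 2) :
    IsRealValue X (fun Y => (realA b Y)⁻¹ r s) ((blockA b X)⁻¹ r s) := by
  have ha (r s : Fin k × Fin 2) : AnalyticAt ℝ (fun Y => (realA b Y)⁻¹ r s) (pointBody X) :=
    analyticAt_inv_apply (fun r s => analyticAt_realA b r s) (realA_det_ne_zero b hX) r s
  let y : Matrix (Fin k × Fin 2) (Fin k × Fin 2) (𝒢 0) :=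
    Matrix.of fun r s => realTaylor X fun Y => (realA b Y)⁻¹ r s
  have hy (r s : Fin k × Fin 2) : IsRealValue X (fun Y => (realA b Y)⁻¹ r s) (y r s) :=
    isRealValue_realTaylor (ha r s)
  have h : blockA b X * y = 1 := by
    ext1 r s
    rw [Matrix.mul_apply]
    have h1 := IsRealValue.sum Finset.univ fun t _ => (isRealValue_realA b X r t).mul (hy t s)
    have h2 := IsRealValue.const (X := X) ((1 : Matrix (Fin k × Fin 2) (Fin k × Fin 2) ℝ) r s)
    refine (h1.unique (h2.congr ?_)).trans ?_
    · filter_upwards [eventually_mem_regularSet b hX] with Y hY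
      rw [← Matrix.mul_nonsing_inv (realA b Y)
        (isUnit_iff_ne_zero.mpr (realA_det_ne_zero b hY)), Matrix.mul_apply]
    · rw [Matrix.one_apply, Matrix.one_apply]
      split_ifs <;> simp
  rw [Matrix.inv_eq_right_inv h]
  exact hy r s

theorem evenBody_det : evenBody 𝒢 (blockA b X).det = (realA b (pointBody X)).det :=
  (isRealValue_det b X).evenBody (analyticAt_det fun r s => analyticAt_realA b r s)

theorem evenBody_det_ne_zero (hX : pointBody X ∈ regularSet B) :
    evenBody 𝒢 (blockA b X).det ≠ 0 := by
  rw [evenBody_det b]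
  exact realA_det_ne_zero b hX

theorem isRealValue_inv_sqrt (hX : pointBody X ∈ regularSet B) :
    IsRealValue X (fun Y => (√|(realA b Y).det|)⁻¹)
    (Ring.inverse (nearSqrt (nearAbs (blockA b X).det))) := by
  have hd := realA_det_ne_zero b hX
  have hda : AnalyticAt ℝ (fun Y => (realA b Y).det) (pointBody X) :=
    analyticAt_det fun r s => analyticAt_realA b r s
  have ha : AnalyticAt ℝ (fun Y => (√|(realA b Y).det|)⁻¹) (pointBody X) :=
    analyticAt_inv_sqrt_abs hda hd
  have h := isRealValue_realTaylor (X := X) ha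
  have h0 := evenBody_realTaylor (X := X) fun Y => (√|(realA b Y).det|)⁻¹
  rw [← eq_inverse_nearSqrt_nearAbs (evenBody_det_ne_zero b hX)
    (by rw [h0]; exact inv_pos.mpr (Real.sqrt_pos.mpr (abs_pos.mpr hd))) ?_]
  · exact h
  have h1 : IsRealValue X (fun Y => |(realA b (pointBody X)).det| / (realA b (pointBody X)).det *
      (realA b Y).det) (nearAbs (blockA b X).det) := by
    rw [nearAbs, evenBody_det b, Algebra.smul_def]
    exact (IsRealValue.const _).mul (isRealValue_det b X)
  have h2 := (h.mul h).mul h1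
  refine h2.unique ((map_one (algebraMap ℝ (𝒢 0)) ▸ IsRealValue.const (X := X) 1).congr ?_)
  -- Near the body the determinant keeps its sign, so its absolute value is a fixed sign times the
  -- determinant, matching the definition of `nearAbs`.
  have h3 : ∀ᶠ Y in nhds (pointBody X), |(realA b Y).det| =
      |(realA b (pointBody X)).det| / (realA b (pointBody X)).det * (realA b Y).det := by
    rcases lt_or_gt_of_ne hd with hneg | hpos
    · filter_upwards [hda.continuousAt.eventually_lt_const hneg] with Y hY
      rw [abs_of_neg hneg, abs_of_neg hY, neg_div, div_self hd, neg_one_mul]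
    · filter_upwards [hda.continuousAt.eventually_const_lt hpos] with Y hY
      rw [abs_of_pos hpos, abs_of_pos hY, div_self hd, one_mul]
  filter_upwards [h3, eventually_mem_regularSet b hX] with Y hY hY'
  rw [← hY, ← mul_inv, Real.mul_self_sqrt (abs_nonneg _),
    inv_mul_cancel₀ (abs_ne_zero.mpr (realA_det_ne_zero b hY'))]

/-- The plus sign in `spfMatrix` becomes `D - C A⁻¹ B` because `blockB` is minus the value of
`coordB`; the even entry of `A⁻¹` commutes with that of `C`. -/
theorem isValue_spfMatrix (hX : pointBody X ∈ regularSet B) (i : ℂ) (j l : Fin n) :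
    IsValue X (fun Y => spfMatrix b i Y j l) (schurOrthonormal b i X j l) := by
  have h1 : IsValue X (fun Y => (coordD b j l Y : ℂ) • 1) ((1 : ℂ) ⊗ₜ[ℝ] blockD b X j l) :=
    isRealValue_linear X (coordD b j l)
  have h2 := IsValue.sum Finset.univ fun r (_ : r ∈ Finset.univ) =>
    IsValue.sum Finset.univ fun s (_ : s ∈ Finset.univ) =>
      IsValue.mul (isRealValue_inv_realA b hX r s)
        (IsValue.mul₂ (X := X) (coordC b j r) (coordB b s l))
  have h := (h1.add h2).smul ((b.phase i j)⁻¹ * b.phase i l)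
  simp only [smul_mul_assoc, one_mul] at h
  refine (congrArg (IsValue X _) ?_).mpr h
  simp only [Algebra.TensorProduct.tmul_mul_tmul, mul_one, ← TensorProduct.tmul_sum,
    ← TensorProduct.tmul_add, TensorProduct.smul_tmul', smul_eq_mul]
  rw [schurOrthonormal]
  congr 1
  refine Subtype.ext ?_
  rw [schur]
  simp only [Submodule.coe_add, Submodule.coe_sum, sub_eq_add_neg]
  congr 1
  change -(∑ r, ∑ s, ((blockC b X j r : 𝒢 1) : P) * (((blockA b X)⁻¹ r s : 𝒢 0) : P) *
    ((blockB b X s l : 𝒢 1) : P)) = _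
  rw [← Finset.sum_neg_distrib]
  refine Finset.sum_congr rfl fun r _ => ?_
  rw [← Finset.sum_neg_distrib]
  refine Finset.sum_congr rfl fun s _ => ?_
  have h0 : (((blockA b X)⁻¹ r s : 𝒢 0) : P) * ((applyPt (coordC b j r) X.2 : 𝒢 1) : P) =
      ((applyPt (coordC b j r) X.2 : 𝒢 1) : P) * (((blockA b X)⁻¹ r s : 𝒢 0) : P) := by
    have := NearSuperalgebra.supercomm (𝒢 := 𝒢) 0 1 _ _ ((blockA b X)⁻¹ r s).2
      (applyPt (coordC b j r) X.2).2
    simpa using this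
  have h1 : ((blockB b X s l : 𝒢 1) : P) = -((applyPt (coordB b s l) X.2 : 𝒢 1) : P) := rfl
  rw [h1, mul_neg, neg_neg]
  symm
  change (((blockA b X)⁻¹ r s : 𝒢 0) : P) * (((applyPt (coordC b j r) X.2 : 𝒢 1) : P) *
    ((applyPt (coordB b s l) X.2 : 𝒢 1) : P)) = _
  rw [← mul_assoc, h0]
  rfl

theorem value_spfFun (hX : pointBody X ∈ regularSet B) {i : ℂ} :
    value (spfFun b i) X = i ^ sigNeg (quadForm (pointBody X)) • pfaffQuotient b i X := by
  have h := ((IsValue.pfaffian fun j l => isValue_spfMatrix b hX i j l).mul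
    (isRealValue_inv_sqrt b hX)).smul (i ^ sigNeg (quadForm (pointBody X)))
  rw [value_eq_pointTaylor X (analyticAt_spfFun b hX), pfaffQuotient, ← evenInclHom_apply,
    ← map_smul, ← h.2]
  refine taylor_congr _ ?_
  filter_upwards [eventually_sigNeg_eq b hX] with Y hY
  simp only [spfFun, hY, map_smul, mul_smul_comm, mul_one, smul_smul]

end PointValue

/-! ### The square of the Pfaffian -/

section PfaffianSquare

variable {R : Type*} [CommRing R] [Algebra ℂ R]

theorem map_pfaffian {S : Type*} [CommRing S] [Algebra ℂ S] {n : ℕ} (f : R →+* S)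
    (m : Matrix (Fin n) (Fin n) R) : pfaffian (m.map f) = f (pfaffian m) := by
  rw [pfaffian, pfaffian]
  split_ifs with hn
  · have h : (2 ^ (n / 2) * (n / 2).factorial : ℂ) = ((2 ^ (n / 2) * (n / 2).factorial : ℕ) : ℂ) := by
      push_cast; rfl
    rw [h, map_inv_natCast_smul f ℂ ℂ, map_sum]
    congr 1
    refine Finset.sum_congr rfl fun s _ => ?_
    rw [map_zsmul, map_prod]
    rfl
  · rw [map_zero]

theorem sum_sign_prod_eq_zero {α : Type*} [Fintype α] [DecidableEq α] (m : Matrix α α R) {t : α → α}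
    (ht : ¬ Function.Bijective t) :
    ∑ s : Equiv.Perm α, ((Equiv.Perm.sign s : ℤˣ) : ℤ) • ∏ a, m (s a) (t a) = 0 := by
  have h : ∑ s : Equiv.Perm α, ((Equiv.Perm.sign s : ℤˣ) : ℤ) • ∏ a, m (s a) (t a) =
      (m.submatrix id t).det := by
    rw [Matrix.det_apply']
    exact Finset.sum_congr rfl fun s _ => zsmul_eq_mul _ _
  have hi : ¬ Function.Injective t := fun hi => ht (Finite.injective_iff_bijective.mp hi)
  simp only [Function.Injective, not_forall] at hi
  obtain ⟨a, c, hac, hne⟩ := hi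
  rw [h]
  exact Matrix.det_zero_of_column_eq hne fun r => congrArg (m r) hac

theorem sum_sign_prod_perm {α : Type*} [Fintype α] [DecidableEq α] (m : Matrix α α R)
    (t : Equiv.Perm α) :
    ∑ s : Equiv.Perm α, ((Equiv.Perm.sign s : ℤˣ) : ℤ) • ∏ a, m (s a) (t a) =
      ((Equiv.Perm.sign t : ℤˣ) : ℤ) • m.det := by
  rw [zsmul_eq_mul, ← Matrix.det_permute', Matrix.det_apply']
  exact Finset.sum_congr rfl fun s _ => zsmul_eq_mul _ _

/-- The bijection `(r, c) ↦ 2 r + c`. -/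
def pairEquiv (h : ℕ) : Fin h × Fin 2 ≃ Fin (2 * h) :=
  finProdFinEquiv.trans (finCongr (mul_comm h 2))

theorem pairEquiv_zero {h : ℕ} (r : Fin h) : pairEquiv h (r, 0) = ⟨2 * r, by omega⟩ := by
  ext; simp [pairEquiv, finProdFinEquiv]

theorem pairEquiv_one {h : ℕ} (r : Fin h) : pairEquiv h (r, 1) = ⟨2 * r + 1, by omega⟩ := by
  ext; simp [pairEquiv, finProdFinEquiv, add_comm]

theorem prod_fin_pairs {h : ℕ} (u : Fin (2 * h) → R) :
    (∏ r : Fin h, u ⟨2 * r + 1, by omega⟩ * u ⟨2 * r, by omega⟩) = ∏ a, u a := by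
  rw [← Equiv.prod_comp (pairEquiv h), Fintype.prod_prod_type]
  refine Finset.prod_congr rfl fun r _ => ?_
  rw [Fin.prod_univ_two, pairEquiv_zero, pairEquiv_one, mul_comm]

/-- The Pfaffian of a congruent matrix. -/
theorem pfaffian_mul_mul_transpose {h : ℕ} (N m : Matrix (Fin (2 * h)) (Fin (2 * h)) R) :
    pfaffian (N * m * N.transpose) = N.det * pfaffian m := by
  rw [pfaffian_two_mul, pfaffian_two_mul, mul_smul_comm]
  congr 1
  -- Expanding both matrix products, each entry of `N` is used once, so the alternating sum over `s`
  -- is a determinant with columns selected by `t`.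
  have h1 (s : Equiv.Perm (Fin (2 * h))) :
      ∏ r : Fin h, (N * m * N.transpose) (s ⟨2 * r + 1, by omega⟩) (s ⟨2 * r, by omega⟩) =
        ∑ t : Fin (2 * h) → Fin (2 * h),
          (∏ r : Fin h, m (t ⟨2 * r + 1, by omega⟩) (t ⟨2 * r, by omega⟩)) *
            ∏ a, N (s a) (t a) := by
    have e (a c : Fin (2 * h)) : (N * m * N.transpose) a c =
        ∑ p : Fin (2 * h) × Fin (2 * h), m p.1 p.2 * (N a p.1 * N c p.2) := by
      rw [Fintype.sum_prod_type_right, Matrix.mul_apply]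
      refine Finset.sum_congr rfl fun d _ => ?_
      rw [Matrix.mul_apply, Finset.sum_mul]
      refine Finset.sum_congr rfl fun d' _ => ?_
      rw [Matrix.transpose_apply]
      ring
    simp only [e]
    rw [Finset.prod_univ_sum, Fintype.piFinset_univ, ← sum_fin_pairs]
    refine Finset.sum_congr rfl fun p _ => ?_
    rw [← prod_fin_pairs, ← Finset.prod_mul_distrib]
    refine Finset.prod_congr rfl fun l _ => ?_
    have h1 : (2 * (l : ℕ) + 1) % 2 = 1 := by omega
    have h2 : (2 * (l : ℕ)) % 2 = 0 := by omega
    have h3 : (2 * (l : ℕ) + 1) / 2 = l := by omega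
    have h4 : (2 * (l : ℕ)) / 2 = l := by omega
    simp only [h1, h2, h3, h4, one_ne_zero, if_false, if_true, Fin.eta]
  simp only [h1, Finset.smul_sum]
  rw [Finset.sum_comm]
  simp only [← mul_smul_comm, ← Finset.mul_sum]
  rw [← Fintype.sum_of_injective (fun s : Equiv.Perm (Fin (2 * h)) => (s : _ → _))
    DFunLike.coe_injective (fun t => N.det * (((Equiv.Perm.sign t : ℤˣ) : ℤ) • ∏ r : Fin h,
      m (t ⟨2 * r + 1, by omega⟩) (t ⟨2 * r, by omega⟩))) _ (fun t ht => ?_) fun t => ?_]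
  · rw [Finset.mul_sum]
  · rw [sum_sign_prod_eq_zero N fun hb => ht ⟨Equiv.ofBijective t hb, rfl⟩, mul_zero]
  · rw [sum_sign_prod_perm, mul_smul_comm, mul_smul_comm, mul_comm N.det]

theorem pfaffian_odd {n : ℕ} (hn : ¬ Even n) (m : Matrix (Fin n) (Fin n) R) : pfaffian m = 0 :=
  if_neg hn

/-- The determinant equals its opposite, and 2 is invertible in a `ℂ`-algebra. -/
theorem det_eq_zero_of_odd {n : ℕ} (hn : ¬ Even n) {m : Matrix (Fin n) (Fin n) R}
    (hm : m.transpose = -m) : m.det = 0 := by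
  have h := congrArg Matrix.det hm
  rw [Matrix.det_transpose, Matrix.det_neg, Fintype.card_fin,
    (Nat.not_even_iff_odd.mp hn).neg_one_pow, neg_one_mul] at h
  have h2 : (2 : ℂ) • m.det = 0 := by
    rw [two_smul]; nth_rewrite 1 [h]; rw [neg_add_cancel]
  have h3 := congrArg ((2 : ℂ)⁻¹ • ·) h2
  simpa [smul_smul] using h3

variable (R) in
/-- The standard antisymmetric matrix. -/
def stdMatrix (h : ℕ) : Matrix (Fin (2 * h)) (Fin (2 * h)) R :=
  (((sympMatrix h).transpose.submatrix (pairEquiv h).symm (pairEquiv h).symm).map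
    Complex.ofRealHom).map (algebraMap ℂ R)

theorem det_stdMatrix (h : ℕ) : (stdMatrix R h).det = 1 := by
  have e (f : ℂ →+* R) (g : ℝ →+* ℂ) (m : Matrix (Fin (2 * h)) (Fin (2 * h)) ℝ) :
      ((m.map g).map f).det = f (g m.det) := by
    rw [RingHom.map_det, RingHom.map_det]; rfl
  rw [stdMatrix, e, Matrix.det_submatrix_equiv_self, Matrix.det_transpose, det_sympMatrix, map_one,
    map_one]

theorem stdMatrix_transpose (h : ℕ) : (stdMatrix R h).transpose = -stdMatrix R h := by
  ext a c
  have := congrFun (congrFun (sympMatrix_transpose h) ((pairEquiv h).symm c)) ((pairEquiv h).symm a)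
  rw [Matrix.transpose_apply, Matrix.neg_apply] at this
  simp [stdMatrix, this]

theorem sympMatrix_mul_self (h : ℕ) : sympMatrix h * sympMatrix h = -1 := by
  have e2 : !![(0 : ℝ), 1; -1, 0] * !![(0 : ℝ), 1; -1, 0] = (-1 : ℝ) • 1 := by
    ext a c
    fin_cases a <;> fin_cases c <;> simp
  rw [sympMatrix_eq_kronecker, ← Matrix.mul_kronecker_mul, e2, Matrix.one_mul, Matrix.kronecker_smul,
    Matrix.one_kronecker_one, neg_one_smul]

theorem stdMatrix_mul_self (h : ℕ) : stdMatrix R h * stdMatrix R h = -1 := by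
  rw [stdMatrix, ← Matrix.map_mul, ← Matrix.map_mul, Matrix.submatrix_mul_equiv,
    ← Matrix.transpose_mul, sympMatrix_mul_self, Matrix.transpose_neg, Matrix.transpose_one]
  ext a c
  by_cases hac : a = c
  · subst hac; simp
  · simp [hac]

/-- In the expanded power, any repeated factor squares to zero, so only permutations remain. -/
theorem sum_pow_card_eq {h : ℕ} {x : Fin h → R} (hx : ∀ r, x r * x r = 0) :
    (∑ r, x r) ^ h = (h.factorial : R) * ∏ r, x r := by
  rw [Fintype.sum_pow, ← Fintype.sum_of_injective (fun s : Equiv.Perm (Fin h) => (s : _ → _))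
    DFunLike.coe_injective (fun _ => ∏ r, x r) _ (fun t ht => ?_) fun s => ?_]
  · rw [Finset.sum_const, Finset.card_univ, Fintype.card_perm, Fintype.card_fin, nsmul_eq_mul]
  · have hi : ¬ Function.Injective t := fun hi =>
      ht ⟨Equiv.ofBijective t (Finite.injective_iff_bijective.mp hi), rfl⟩
    simp only [Function.Injective, not_forall] at hi
    obtain ⟨a, c, hac, hne⟩ := hi
    rw [← Finset.mul_prod_erase _ _ (Finset.mem_univ a),
      ← Finset.mul_prod_erase _ _ (Finset.mem_erase.mpr ⟨Ne.symm hne, Finset.mem_univ c⟩), hac,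
      ← mul_assoc, hx, zero_mul]
  · exact (Equiv.prod_comp s x).symm

theorem EvenAlg.mul₂_self {M : Type*} [AddCommGroup M] [Module ℂ M] (x : M) :
    EvenAlg.mul₂ x x = 0 := by
  apply EvenAlg.val_injective
  rw [EvenAlg.val_mul₂, map_zero, ExteriorAlgebra.ι_sq_zero]

theorem sum_stdMatrix_mul {M : Type*} [AddCommGroup M] [Module ℂ M] {h : ℕ} (v : Fin (2 * h) → M) :
    ∑ a, ∑ c, stdMatrix (EvenAlg M) h a c * EvenAlg.mul₂ (v c) (v a) =
      2 * ∑ r : Fin h, EvenAlg.mul₂ (v ⟨2 * r, by omega⟩) (v ⟨2 * r + 1, by omega⟩) := by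
  rw [← Equiv.sum_comp (pairEquiv h)]
  simp only [← Equiv.sum_comp (pairEquiv h) fun c => stdMatrix (EvenAlg M) h _ c * _,
    Fintype.sum_prod_type, Fin.sum_univ_two, Finset.mul_sum]
  refine Finset.sum_congr rfl fun r _ => ?_
  have e (r s : Fin h) (c d : Fin 2) : stdMatrix (EvenAlg M) h (pairEquiv h (r, c))
      (pairEquiv h (s, d)) = if s = r then algebraMap ℂ _ ((!![(0 : ℝ), 1; -1, 0] d c : ℝ) : ℂ)
        else 0 := by
    simp only [stdMatrix, Matrix.map_apply, Matrix.submatrix_apply, Equiv.symm_apply_apply,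
      Matrix.transpose_apply, sympMatrix, Matrix.of_apply]
    split_ifs <;> simp
  simp only [e, ite_mul, zero_mul, Finset.sum_add_distrib, Finset.sum_ite_eq', Finset.mem_univ,
    if_true]
  rw [pairEquiv_zero, pairEquiv_one]
  simp only [Matrix.of_apply, Matrix.cons_val', Matrix.cons_val_zero, Matrix.cons_val_one,
    Matrix.cons_val_fin_one, Complex.ofReal_zero, Complex.ofReal_one, Complex.ofReal_neg, map_zero,
    map_one, map_neg, zero_mul, zero_add, one_mul, add_zero, neg_mul]
  rw [EvenAlg.mul₂_swap (v ⟨2 * (r : ℕ) + 1, _⟩), neg_neg]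
  exact (two_mul _).symm

/-- The top power of `∑ J ξξ` is computed twice: as `2^h h!` times the product of the standard
pairs, and as an alternating sum over permutations. Comparing Berezin integrals evaluates that sum.
-/
theorem pfaffian_stdMatrix (h : ℕ) : pfaffian (stdMatrix R h) = 1 := by
  suffices H : pfaffian (stdMatrix ℂ h) = 1 by
    have e : stdMatrix R h = (stdMatrix ℂ h).map (algebraMap ℂ R) := rfl
    rw [e, map_pfaffian, H, map_one]
  let M := Fin (2 * h) → ℂ
  let v : Fin (2 * h) → M := fun j => Pi.single j 1
  let d : Fin (2 * h) → Module.Dual ℂ M := fun j => LinearMap.proj j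
  have hd : ∀ j l, d j (v l) = if j = l then (fun _ => 1 : Fin (2 * h) → ℂ) j else 0 :=
    fun j l => Pi.single_apply l (1 : ℂ) j
  have h1 := sum_pow_eq v (stdMatrix (EvenAlg M) h) h
  rw [sum_stdMatrix_mul, mul_pow, sum_pow_card_eq fun r => by
    rw [EvenAlg.mul₂_mul_mul₂, EvenAlg.mul₂_self, zero_mul]] at h1
  have h2 : (2 : EvenAlg M) ^ h * ((h.factorial : EvenAlg M) *
      ∏ r : Fin h, EvenAlg.mul₂ (v ⟨2 * r, by omega⟩) (v ⟨2 * r + 1, by omega⟩)) =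
      (2 ^ h * h.factorial : ℂ) • pairProd v h (1 : Equiv.Perm (Fin (2 * h))) := by
    rw [Algebra.smul_def, ← mul_assoc, map_mul, map_pow, map_ofNat, map_natCast]
    rfl
  have h3 (t : Fin (2 * h) → Fin (2 * h)) : (∏ l : Fin h, stdMatrix (EvenAlg M) h
      (t ⟨2 * l + 1, by omega⟩) (t ⟨2 * l, by omega⟩)) * pairProd v h t =
      (∏ l : Fin h, stdMatrix ℂ h (t ⟨2 * l + 1, by omega⟩) (t ⟨2 * l, by omega⟩)) •
        pairProd v h t := by
    rw [Algebra.smul_def, map_prod]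
    rfl
  rw [h2] at h1
  simp only [h3] at h1
  have h4 := congrArg (fun z => berezinMap d (0 : M →ₗ[ℂ] M) (EvenAlg.val M z)) h1
  simp only [map_smul, map_sum] at h4
  rw [← Fintype.sum_of_injective (fun s : Equiv.Perm (Fin (2 * h)) => (s : _ → _))
    DFunLike.coe_injective (fun s => (∏ l : Fin h,
      stdMatrix ℂ h (s ⟨2 * l + 1, by omega⟩) (s ⟨2 * l, by omega⟩)) •
        berezinMap d (0 : M →ₗ[ℂ] M) (EvenAlg.val M (pairProd v h s))) _ (fun t ht => by
      rw [berezinMap_pairProd_eq_zero hd _ fun hb => ht ⟨Equiv.ofBijective t hb, rfl⟩,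
        smul_zero]) fun s => rfl] at h4
  simp only [berezinMap_pairProd_perm hd, Equiv.Perm.sign_one, Units.val_one, one_smul,
    Finset.prod_const_one, mul_one] at h4
  have h5 := congrArg ExteriorAlgebra.algebraMapInv h4
  have h6 : ((-1 : ℂ) ^ h) ≠ 0 := pow_ne_zero _ (by norm_num)
  simp only [map_smul, map_sum, zsmul_eq_mul, map_mul, map_intCast, AlgHom.commutes,
    Algebra.algebraMap_self, RingHom.id_apply, smul_eq_mul] at h5
  have h7 : (2 ^ h * h.factorial : ℂ) = ∑ s : Equiv.Perm (Fin (2 * h)),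
      ((Equiv.Perm.sign s : ℤˣ) : ℤ) • ∏ l : Fin h,
        stdMatrix ℂ h (s ⟨2 * l + 1, by omega⟩) (s ⟨2 * l, by omega⟩) := by
    refine mul_right_cancel₀ h6 (h5.trans ?_)
    rw [Finset.sum_mul]
    refine Finset.sum_congr rfl fun s _ => ?_
    rw [zsmul_eq_mul]
    ring
  rw [pfaffian_two_mul, ← h7, smul_eq_mul, inv_mul_cancel₀]
  exact mul_ne_zero (pow_ne_zero _ two_ne_zero) (Nat.cast_ne_zero.mpr (Nat.factorial_ne_zero _))

/-- The square root of `1 + X Q`. -/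
def sqrtMatrix {α : Type*} [Fintype α] [DecidableEq α] (Q : Matrix α α R) :
    Matrix α α (PowerSeries R) :=
  Matrix.of fun a c => PowerSeries.mk fun d => (sqrtCoeff d : ℂ) • (Q ^ d) a c

theorem sqrtMatrix_mul_self {α : Type*} [Fintype α] [DecidableEq α] (Q : Matrix α α R) :
    sqrtMatrix Q * sqrtMatrix Q =
      1 + (PowerSeries.X : PowerSeries R) • Q.map (PowerSeries.C (R := R)) := by
  ext a c d
  have h1 : PowerSeries.coeff d ((sqrtMatrix Q * sqrtMatrix Q) a c) =
      ((Nat.choose 1 d : ℝ) : ℂ) • (Q ^ d) a c := by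
    rw [← sum_sqrtCoeff_mul, Complex.ofReal_sum, Finset.sum_smul, Matrix.mul_apply, map_sum]
    simp only [PowerSeries.coeff_mul, sqrtMatrix, Matrix.of_apply, PowerSeries.coeff_mk]
    rw [Finset.sum_comm]
    refine Finset.sum_congr rfl fun p hp => ?_
    rw [← Finset.HasAntidiagonal.mem_antidiagonal.mp hp, pow_add, Matrix.mul_apply,
      Finset.smul_sum]
    refine Finset.sum_congr rfl fun t _ => ?_
    rw [smul_mul_smul_comm, Complex.ofReal_mul]
  rw [h1, Matrix.add_apply, Matrix.smul_apply, Matrix.map_apply, smul_eq_mul, map_add]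
  rcases d with _ | _ | d
  · by_cases hac : a = c
    · subst hac; simp
    · simp [hac]
  · have : PowerSeries.coeff 1 ((1 : Matrix α α (PowerSeries R)) a c) = 0 := by
      rw [Matrix.one_apply]; split_ifs <;> simp [PowerSeries.coeff_one]
    rw [zero_add, this, ← zero_add 1, PowerSeries.coeff_succ_X_mul]
    simp
  · have : PowerSeries.coeff (d + 1 + 1) ((1 : Matrix α α (PowerSeries R)) a c) = 0 := by
      rw [Matrix.one_apply]; split_ifs <;> simp [PowerSeries.coeff_one]
    rw [this, PowerSeries.coeff_succ_X_mul, PowerSeries.coeff_C,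
      Nat.choose_eq_zero_of_lt (by omega)]
    simp

/-- The relation `J Qᵀ = Q J` passes to all powers of `Q`, hence to the series. -/
theorem mul_sqrtMatrix_transpose {α : Type*} [Fintype α] [DecidableEq α] {J Q : Matrix α α R}
    (h : J * Q.transpose = Q * J) :
    J.map (PowerSeries.C (R := R)) * (sqrtMatrix Q).transpose =
      sqrtMatrix Q * J.map (PowerSeries.C (R := R)) := by
  have hd (d : ℕ) : J * (Q ^ d).transpose = Q ^ d * J := by
    induction d with
    | zero => simp
    | succ d ih =>
      rw [pow_succ, Matrix.transpose_mul, ← Matrix.mul_assoc, h, Matrix.mul_assoc, ih,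
        ← Matrix.mul_assoc, ← pow_succ', pow_succ]
  ext a c d
  have := congrFun (congrFun (hd d) a) c
  rw [Matrix.mul_apply, Matrix.mul_apply] at this
  rw [Matrix.mul_apply, Matrix.mul_apply, map_sum, map_sum]
  simp only [Matrix.map_apply, Matrix.transpose_apply, sqrtMatrix, Matrix.of_apply,
    PowerSeries.coeff_C_mul, PowerSeries.coeff_mul_C, PowerSeries.coeff_mk, mul_smul_comm,
    smul_mul_assoc, ← Finset.smul_sum]
  exact congrArg _ this

/-- The square of the Pfaffian of an antisymmetric matrix is its determinant. -/
theorem pfaffian_mul_self {n : ℕ} {m : Matrix (Fin n) (Fin n) R} (hm : m.transpose = -m) :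
    pfaffian m * pfaffian m = m.det := by
  by_cases hn : Even n
  swap
  · rw [pfaffian_odd hn, det_eq_zero_of_odd hn hm, zero_mul]
  obtain ⟨h, rfl⟩ := hn.two_dvd
  set J := stdMatrix R h with hJ
  have hJt : J.transpose = -J := stdMatrix_transpose h
  have hJJ : J * J = -1 := stdMatrix_mul_self h
  -- Chosen so that `(1 + Q) J = m`; then `1 + XQ` takes `J` to the segment from `J` to `m`.
  set Q := -((m - J) * J) with hQ
  have hQJ : Q * J = m - J := by
    rw [hQ, Matrix.neg_mul, Matrix.mul_assoc, hJJ, Matrix.mul_neg, Matrix.mul_one, neg_neg]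
  have hJQ : J * Q.transpose = Q * J := by
    rw [hQJ, hQ, Matrix.transpose_neg, Matrix.transpose_mul, Matrix.transpose_sub, hm, hJt,
      Matrix.mul_neg, Matrix.neg_mul, Matrix.mul_neg, neg_neg, ← Matrix.mul_assoc, hJJ,
      Matrix.neg_mul, Matrix.one_mul]
    abel
  set N := sqrtMatrix Q
  let J' : Matrix (Fin (2 * h)) (Fin (2 * h)) (PowerSeries R) := J.map (PowerSeries.C (R := R))
  have hJ' : J' = stdMatrix (PowerSeries R) h := by
    ext1 a c
    exact (PowerSeries.algebraMap_apply ..).symm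
  -- `G` joins `J` at `X = 0` to `m` at `X = 1`. Over power series it is congruent to `J` through
  -- the square root `N` of `1 + XQ`; being polynomial, it can still be evaluated at 1.
  let G : Matrix (Fin (2 * h)) (Fin (2 * h)) (Polynomial R) :=
    J.map Polynomial.C + (Polynomial.X : Polynomial R) • (m - J).map Polynomial.C
  have hG : G.map (Polynomial.coeToPowerSeries.ringHom (R := R)) = N * N * J' := by
    rw [sqrtMatrix_mul_self, Matrix.add_mul, Matrix.one_mul, Matrix.smul_mul, ← Matrix.map_mul,
      hQJ]
    ext1 a c
    simp [G, J']
  have hN : N * J' * N.transpose = N * N * J' := by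
    rw [Matrix.mul_assoc, mul_sqrtMatrix_transpose hJQ, Matrix.mul_assoc]
  -- `Pfaff(N J Nᵀ) = det N` and `det(N N J) = (det N)²`; polynomials embed in power series.
  have h1 : pfaffian G * pfaffian G = G.det := by
    have hinj : Function.Injective (Polynomial.coeToPowerSeries.ringHom (R := R)) :=
      Polynomial.coe_injective R
    refine hinj ?_
    rw [map_mul, ← map_pfaffian, RingHom.map_det, RingHom.mapMatrix_apply, hG, ← hN,
      pfaffian_mul_mul_transpose, hN, Matrix.det_mul, Matrix.det_mul, hJ', det_stdMatrix,
      pfaffian_stdMatrix]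
    ring
  have h2 : G.map (Polynomial.evalRingHom (1 : R)) = m := by
    ext a c
    simp [G]
  have h3 := congrArg (Polynomial.evalRingHom (1 : R)) h1
  rwa [map_mul, ← map_pfaffian, RingHom.map_det, RingHom.mapMatrix_apply, h2] at h3

end PfaffianSquare

/-! ### The square of the superPfaffian -/

section Square

variable {V₀ V₁ : Type*} [NormedAddCommGroup V₀] [NormedSpace ℝ V₀] [FiniteDimensional ℝ V₀]
  [NormedAddCommGroup V₁] [NormedSpace ℝ V₁] [FiniteDimensional ℝ V₁]
  {B : SymplecticForm V₀ V₁} {k n : ℕ} (b : SymplecticBasis B k n)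

theorem lengthSq_mul_self (j : Fin n) : lengthSq b j * lengthSq b j = 1 := by
  rw [lengthSq]
  split_ifs <;> norm_num

theorem phase_inv_mul_lengthSq {i : ℂ} (hi : i ^ 2 = -1) (j : Fin n) :
    (b.phase i j)⁻¹ * (lengthSq b j : ℂ) = b.phase i j := by
  have h0 := phase_ne_zero b hi j
  have h1 : ((lengthSq b j : ℝ) : ℂ) * (lengthSq b j : ℂ) = 1 := by
    rw [← Complex.ofReal_mul, lengthSq_mul_self, Complex.ofReal_one]
  have h2 : ((lengthSq b j : ℝ) : ℂ) * (b.phase i j * b.phase i j) = 1 := by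
    rw [← phase_inv_mul_inv b hi]
    field_simp
  have h3 : b.phase i j * b.phase i j = (lengthSq b j : ℂ) := by
    rw [← one_mul (b.phase i j * _), ← h1, mul_assoc, h2, mul_one]
  rw [← h3]
  field_simp

theorem map_oddInr_injective : Function.Injective (EvenAlg.map (oddInr B)) := by
  intro x y h
  apply EvenAlg.val_injective
  have h' := congrArg (EvenAlg.val _) h
  rw [EvenAlg.val_map, EvenAlg.val_map] at h'
  refine Function.LeftInverse.injective (g := ExteriorAlgebra.map (LinearMap.snd ℂ _ _))
    ((ExteriorAlgebra.leftInverse_map_iff).mpr fun z => rfl) h'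

theorem smul_smul_add_eq {E : Type*} [AddCommGroup E] [Module ℂ E] {c : ℂ} (hc : c * c = 1)
    (p q d : ℂ) (x z : E) :
    (p * q) • (d • x + z) = (p * c * q) • ((c * d) • x + c • z) := by
  have h : p * c * q * c = p * q := by rw [mul_right_comm, mul_assoc p, hc, mul_one]
  rw [smul_add, smul_add, smul_smul, smul_smul, smul_smul, ← mul_assoc, h]

theorem map_spfMatrix {i : ℂ} (hi : i ^ 2 = -1) (Y : spoEven B) (j l : Fin n) :
    EvenAlg.map (oddInr B) (spfMatrix b i Y j l) = (b.phase i j * b.phase i l) •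
      (((B.form₁ (b.g j) (Y.1.2 (b.g l)) : ℝ) : ℂ) • 1 +
        -∑ r, ∑ s, ((gram b Y)⁻¹ r s : ℂ) • EvenAlg.mul₂ (pairVec b j r) (pairVec b l s)) := by
  have h1 : EvenAlg.map (oddInr B) (spfMatrix b i Y j l) = ((b.phase i j)⁻¹ * b.phase i l) •
      ((coordD b j l Y : ℂ) • 1 + ∑ r, ∑ s, ((realA b Y)⁻¹ r s : ℂ) •
        EvenAlg.mul₂ (oddInr B (complexForm (coordC b j r)))
          (oddInr B (complexForm (coordB b s l)))) := by
    simp only [spfMatrix, map_smul, map_add, map_one, map_sum, EvenAlg.map_mul₂]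
  have h2 : ((B.form₁ (b.g j) (Y.1.2 (b.g l)) : ℝ) : ℂ) = lengthSq b j * coordD b j l Y := by
    rw [form_g_left, Complex.ofReal_mul]
    rfl
  rw [h1, sum_gram_inv_pairVec, h2, neg_neg]
  nth_rewrite 2 [← phase_inv_mul_lengthSq b hi j]
  generalize ∑ r, ∑ s, ((realA b Y)⁻¹ r s : ℂ) •
        EvenAlg.mul₂ (oddInr B (complexForm (coordC b j r)))
          (oddInr B (complexForm (coordB b s l))) = z
  have h3 : ((lengthSq b j : ℝ) : ℂ) * (lengthSq b j : ℂ) = 1 := by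
    rw [← Complex.ofReal_mul, lengthSq_mul_self, Complex.ofReal_one]
  exact smul_smul_add_eq h3 _ _ _ _ _

/-- Checked in the joint algebra, where the entries are expressed by the antisymmetric form `B(v,
Dw)` and the symmetric matrix `gram⁻¹` contracted with anticommuting sources. -/
theorem spfMatrix_antisymm {i : ℂ} (hi : i ^ 2 = -1) (Y : spoEven B) (j l : Fin n) :
    spfMatrix b i Y l j = -spfMatrix b i Y j l := by
  apply map_oddInr_injective
  rw [map_neg, map_spfMatrix b hi, map_spfMatrix b hi, mul_comm (b.phase i l), ← smul_neg, neg_add]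
  congr 2
  · have h := Y.2.2 (b.g j) (b.g l)
    have h2 : B.form₁ (b.g l) (Y.1.2 (b.g j)) = -B.form₁ (b.g j) (Y.1.2 (b.g l)) := by
      rw [B.isSymm.eq (b.g l)]
      exact eq_neg_of_add_eq_zero_left h
    rw [h2, Complex.ofReal_neg]
    exact neg_smul _ (1 : EvenAlg ((V₁ →ₗ[ℝ] ℂ) × (spoOdd B →ₗ[ℝ] ℂ)))
  · rw [neg_neg, ← Finset.sum_neg_distrib, Finset.sum_comm]
    refine Finset.sum_congr rfl fun s _ => ?_
    rw [← Finset.sum_neg_distrib]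
    refine Finset.sum_congr rfl fun r _ => ?_
    have h : (gram b Y)⁻¹ r s = (gram b Y)⁻¹ s r := by
      conv_rhs => rw [← gram_transpose, ← Matrix.transpose_nonsing_inv]
      rfl
    rw [h, EvenAlg.mul₂_swap, smul_neg, neg_neg]

variable {P : Type*} [Ring P] [Algebra ℝ P] {𝒢 : ZMod 2 → Submodule ℝ P} [GradedAlgebra 𝒢]
  [NearSuperalgebra 𝒢] {X : SpoPoint B 𝒢}

/-- Antisymmetry is inherited from `spfMatrix` by uniqueness of values. -/
theorem schurOrthonormal_transpose {i : ℂ} (hi : i ^ 2 = -1) (hX : pointBody X ∈ regularSet B) :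
    (schurOrthonormal b i X).transpose = -schurOrthonormal b i X := by
  ext1 j l
  have h1 := (isValue_spfMatrix b hX i j l).smul (-1)
  have h2 := isValue_spfMatrix b hX i l j
  simp only [spfMatrix_antisymm b hi _ j l] at h2
  simp only [neg_one_smul] at h1
  exact h2.unique h1

/-- The change from `g` to `f` is conjugation by a diagonal matrix of phases. -/
theorem det_schurOrthonormal {i : ℂ} (hi : i ^ 2 = -1) :
    (schurOrthonormal b i X).det = (1 : ℂ) ⊗ₜ[ℝ] (schur b X).det := by
  have h : schurOrthonormal b i X = Matrix.diagonal (fun j => (b.phase i j)⁻¹ ⊗ₜ[ℝ] (1 : 𝒢 0)) *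
      (schur b X).map (Algebra.TensorProduct.includeRight : 𝒢 0 →ₐ[ℝ] ℂ ⊗[ℝ] 𝒢 0) *
      Matrix.diagonal (fun j => b.phase i j ⊗ₜ[ℝ] (1 : 𝒢 0)) := by
    ext1 j l
    rw [Matrix.mul_diagonal, Matrix.diagonal_mul, Matrix.map_apply,
      Algebra.TensorProduct.includeRight_apply, Algebra.TensorProduct.tmul_mul_tmul,
      Algebra.TensorProduct.tmul_mul_tmul, one_mul, mul_one, mul_one]
    rfl
  have h2 : (∏ j, ((b.phase i j)⁻¹ ⊗ₜ[ℝ] (1 : 𝒢 0) : ℂ ⊗[ℝ] 𝒢 0)) *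
      ∏ j, (b.phase i j ⊗ₜ[ℝ] (1 : 𝒢 0) : ℂ ⊗[ℝ] 𝒢 0) = 1 := by
    rw [← Finset.prod_mul_distrib]
    refine Finset.prod_eq_one fun j _ => ?_
    rw [Algebra.TensorProduct.tmul_mul_tmul, inv_mul_cancel₀ (phase_ne_zero b hi j), mul_one]
    rfl
  have h3 : ((schur b X).map (Algebra.TensorProduct.includeRight : 𝒢 0 →ₐ[ℝ] ℂ ⊗[ℝ] 𝒢 0)).det =
      (1 : ℂ) ⊗ₜ[ℝ] (schur b X).det :=
    ((Algebra.TensorProduct.includeRight : 𝒢 0 →ₐ[ℝ] ℂ ⊗[ℝ] 𝒢 0).map_det (schur b X)).symm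
  rw [h, Matrix.det_mul, Matrix.det_mul, Matrix.det_diagonal, Matrix.det_diagonal, mul_right_comm,
    h2, one_mul, h3]

theorem smul_inverse_nearSqrt_mul_self {α : 𝒢 0} (hα : evenBody 𝒢 α ≠ 0) {c : ℝ} (hc : c * c = 1)
    (hc' : c * |evenBody 𝒢 α| = evenBody 𝒢 α) :
    c • (Ring.inverse (nearSqrt (nearAbs α)) * Ring.inverse (nearSqrt (nearAbs α))) =
      Ring.inverse α := by
  have h0 : 0 < evenBody 𝒢 (nearAbs α) := by rw [evenBody_nearAbs hα]; exact abs_pos.mpr hα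
  have h1 : evenBody 𝒢 (nearSqrt (nearAbs α)) ≠ 0 := by
    rw [evenBody_nearSqrt h0]; exact (Real.sqrt_pos.mpr h0).ne'
  have h2 : nearAbs α = c • α := by
    have : |evenBody 𝒢 α| = c * evenBody 𝒢 α := by
      conv_rhs => rw [← hc', ← mul_assoc, hc, one_mul]
    rw [nearAbs, this, mul_div_cancel_right₀ _ hα]
  have h3 := nearSqrt_mul_self h0
  have h4 := Ring.inverse_mul_cancel _ (isUnit_of_evenBody_ne_zero h1)
  set s := nearSqrt (nearAbs α)
  set t := Ring.inverse s
  have h5 : c • (t * t) * α = 1 := by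
    rw [smul_mul_assoc, ← mul_smul_comm, ← h2, ← h3]
    have : t * t * (s * s) = (t * s) * (t * s) := by ring
    rw [this, h4, mul_one]
  have hu := Ring.mul_inverse_cancel _ (isUnit_of_evenBody_ne_zero hα)
  rw [← mul_one (c • (t * t)), ← hu, ← mul_assoc, h5, one_mul]

/-- `(i^q)² = (-1)^q` is the sign of the body of `det A`, exactly what turns the inverse of `|det
A|` into that of `det A`. -/
theorem value_spfFun_sq {i : ℂ} (hi : i ^ 2 = -1) (hX : pointBody X ∈ regularSet B) :
    value (spfFun b i) X ^ 2 = (1 : ℂ) ⊗ₜ[ℝ] berInv b X := by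
  have hsgn := neg_one_pow_sigNeg_mul b (pointBody X)
  rw [← evenBody_det b] at hsgn
  have hc : ((-1 : ℝ) ^ sigNeg (quadForm (pointBody X))) *
      (-1 : ℝ) ^ sigNeg (quadForm (pointBody X)) = 1 := by
    rw [← mul_pow]; norm_num
  have h := smul_inverse_nearSqrt_mul_self (evenBody_det_ne_zero b hX) hc hsgn
  have e : i ^ sigNeg (quadForm (pointBody X)) * i ^ sigNeg (quadForm (pointBody X)) =
      (((-1 : ℝ) ^ sigNeg (quadForm (pointBody X)) : ℝ) : ℂ) := by
    rw [← mul_pow, ← sq, hi]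
    push_cast
    rfl
  rw [value_spfFun b hX, sq, smul_mul_smul_comm, e, pfaffQuotient, ← evenInclHom_apply,
    ← map_mul, mul_mul_mul_comm, pfaffian_mul_self (schurOrthonormal_transpose b hi hX),
    det_schurOrthonormal b hi, Algebra.TensorProduct.tmul_mul_tmul,
    Algebra.TensorProduct.tmul_mul_tmul, one_mul, one_mul, ← map_smul, ← one_tmul_smul,
    ← mul_smul_comm, h, mul_comm]
  rfl

end Square

end SuperPfaffian

end

open SuperPfaffian in
theorem mainTheorem6 {V₀ V₁ : Type*}
    [NormedAddCommGroup V₀] [NormedSpace ℝ V₀] [FiniteDimensional ℝ V₀]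
    [NormedAddCommGroup V₁] [NormedSpace ℝ V₁] [FiniteDimensional ℝ V₁]
    (B : SymplecticForm V₀ V₁) (k n : ℕ) (b : SymplecticBasis B k n)
    (i : ℂ) (hi : i ^ 2 = -1) :
    ∃ F : spoEven B → OddAlgebra B,
      AnalyticOnNhd ℝ F (regularSet B) ∧
      (∀ (ν : MeasureTheory.Measure (spoEven B)) [ν.IsAddHaarMeasure] (ρ : spoEven B → ℂ),
        ContDiff ℝ ∞ ρ → HasCompactSupport ρ → tsupport ρ ⊆ regularSet B →
          MeasureTheory.Integrable (spfInner b i ν ρ) ∧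
          spf b i ν ρ = ∫ X, ρ X • F X ∂ν) ∧
      ∀ {P : Type*} [Ring P] [Algebra ℝ P] (𝒢 : ZMod 2 → Submodule ℝ P) [GradedAlgebra 𝒢]
        [NearSuperalgebra 𝒢] (X : SpoPoint B 𝒢),
        (∀ p q : ℕ, p + q = 2 * k → pointBody X ∈ signatureSet B p q →
          value F X = i ^ q • pfaffQuotient b i X) ∧
        (pointBody X ∈ regularSet B →
          value F X ^ 2 = (1 : ℂ) ⊗ₜ[ℝ] berInv b X) := by
  refine ⟨spfFun b i, fun X hX => analyticAt_spfFun b hX, fun ν _ ρ hρ hc hs =>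
    ⟨integrable_spfInner hi b hρ hc, spf_eq_integral_spfFun hi b hρ hc hs⟩,
    fun 𝒢 _ _ X => ⟨fun p q hpq h => ?_, fun hX => value_spfFun_sq b hi hX⟩⟩
  obtain ⟨rfl, rfl⟩ := h
  -- A signature adding up to `2k` means that the form is nondegenerate at the body.
  exact value_spfFun b ((sigPos_add_sigNeg_eq_iff b _).mp hpq)
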